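/- **Gate complexity of Hamiltonian simulation in the interaction picture.** *Conventions.* A primitive gate is an arbitrary unitary on at most two qubits; the gate count of a circuit is its number of primitive gates; $\|\cdot\|$ is the spectral norm. A unitary $U$ on $n_s$ qubits is *approximated to error $\delta$ with $N$ gates* if, for some number of ancilla qubits $a$, there is a circuit $V$ of $N$ gates with $\|(V-\mathbb 1_a\otimes U)(|0\rangle_a\otimes\mathbb 1_s)\|\le\delta$. For $x\ge 0$ put $\operatorname{lg}x=\log(e+x)$ and $\ell(x)=\dfrac{\log(e^e+x)}{\log\log(e^e+x)}$ (these are $\log x$ and $\log x/\log\log x$, shifted so that they make sense and are at least $1$ for all $x\ge0$). *Theorem.* For every $\gamma>0$ there are a constant $K>0$ and an exponent $p\in\mathbb N$, depending only on $\gamma$, such that the following holds. Let $A,B\in\mathbb C^{2^{n_s}\times 2^{n_s}}$ be Hermitian with $\|A\|\le\alpha_A$, $\|B\|\le\alpha_B$, $\alpha_B>0$, and suppose that 1. there is a circuit $O_B$ of at most $C_B$ gates on $n_a+n_s$ qubits, with $C_B\ge 1$ and $C_B\ge n_a$, such that $(\langle 0|_a\otimes\mathbb 1_s)\,O_B\,(|0\rangle_a\otimes\mathbb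 1_s)=B/\alpha_B$; 2. there are constants $c_0\ge1$, $c_1\ge0$ such that for all $s\in\mathbb R$ and $\delta>0$ the unitary $e^{-iAs}$ can be approximated to error $\delta$ with at most $$C_{e^{-iAs}}[\delta]:=c_0+c_1|s|\operatorname{lg}^{\gamma}(|s|/\delta)$$ gates. Then for all $t>0$ and $\epsilon>0$ the time-evolution operator $e^{-i(A+B)t}$ can be approximated to error $\epsilon$ with a number $N$ of gates satisfying both $$N\le K\max(1,\alpha_Bt)\left(C_B+C_{e^{-iA/\alpha_B}}\!\left[\frac{\epsilon}{\alpha_Bt\operatorname{lg}\alpha_B}\right]\operatorname{lg}\!\left(\frac{t(\alpha_A+\alpha_B)}{\epsilon}\right)\right)\ell\!\left(\frac{\alpha_Bt}{\epsilon}\right)$$ and $$N\le K\max(1,\alpha_Bt)\left(C_B+C_{e^{-iA/\alpha_B}}[\epsilon]\right)\operatorname{lg}^{p}\!\left(\frac{t(\alpha_A+\alpha_B)}{\epsilon}\right).$$ -/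

import Mathlib

open scoped Matrix.Norms.L2Operator

noncomputable section

namespace QSim

/-- Operators on the Hilbert space of qubits labelled by `ι`, written in the computational basis
`ι → Bool`. The norm on matrices is the spectral norm. -/
abbrev Op (ι : Type) : Type := Matrix (ι → Bool) (ι → Bool) ℂ

/-- A primitive gate: an arbitrary unitary acting on at most two of the qubits. -/
structure Gate (ι : Type) [DecidableEq ι] where
  support : Finset ι
  card_support_le : support.card ≤ 2
  op : Matrix.unitaryGroup (support → Bool) ℂ

/-- The operator `op ⊗ 1` that a gate applies to the whole register. -/
def Gate.toOp {ι : Type} [Fintype ι] [DecidableEq ι] (g : Gate ι) : Op ι :=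
  fun x y =>
    if ∀ k, k ∉ g.support → x k = y k then
      (g.op : Matrix (g.support → Bool) (g.support → Bool) ℂ) (fun k => x k) (fun k => y k)
    else 0

/-- A circuit is a list of primitive gates, the head being applied first. Its gate count is the
length of the list. -/
abbrev Circuit (ι : Type) [DecidableEq ι] : Type := List (Gate ι)

/-- The operator applied by a circuit. -/
def Circuit.toOp {ι : Type} [Fintype ι] [DecidableEq ι] : Circuit ι → Op ι
  | [] => 1
  | g :: c => Circuit.toOp c * g.toOp

/-- The isometry `|0⟩_a ⊗ 1_s` that adjoins `a` ancilla qubits in the state `|0…0⟩` to `n` system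
qubits. -/
def zeroAncilla (a n : ℕ) : Matrix (Fin a ⊕ Fin n → Bool) (Fin n → Bool) ℂ :=
  fun z x => if z = Sum.elim (fun _ => false) x then 1 else 0

/-- The circuit `c` block-encodes `B / α`: `(⟨0|_a ⊗ 1_s) c (|0⟩_a ⊗ 1_s) = B / α`. -/
def BlockEncodes {a n : ℕ} (c : Circuit (Fin a ⊕ Fin n)) (B : Op (Fin n)) (α : ℝ) : Prop :=
  (zeroAncilla a n).conjTranspose * Circuit.toOp c * zeroAncilla a n = ((1 / α : ℝ) : ℂ) • B

/-- The circuit `c` approximates `U` to error `ε`, with its ancillas starting in and returned to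
`|0⟩`: `‖(c - 1_a ⊗ U)(|0⟩_a ⊗ 1_s)‖ ≤ ε` in spectral norm. -/
def Approximates {a n : ℕ} (c : Circuit (Fin a ⊕ Fin n)) (U : Op (Fin n)) (ε : ℝ) : Prop :=
  ‖Circuit.toOp c * zeroAncilla a n - zeroAncilla a n * U‖ ≤ ε

/-- `U` can be approximated to error `ε` with `N` primitive gates (and any number of ancillas). -/
def ApproximableWith {n : ℕ} (U : Op (Fin n)) (ε : ℝ) (N : ℕ) : Prop :=
  ∃ (a : ℕ) (c : Circuit (Fin a ⊕ Fin n)), c.length = N ∧ Approximates c U ε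

/-- The time-evolution operator `e^{-iHt}`. -/
def evolution {n : ℕ} (H : Op (Fin n)) (t : ℝ) : Op (Fin n) :=
  NormedSpace.exp ((-(Complex.I * (t : ℂ))) • H)

/-- The logarithm `log (e + x)`, which is at least `1` for every `x ≥ 0`. -/
def lg (x : ℝ) : ℝ := Real.log (Real.exp 1 + x)

/-- The function `log x / log log x`, shifted to `log (e^e + x) / log log (e^e + x)`, so that
numerator and denominator are at least `1` for every `x ≥ 0`. -/
def lgRatio (x : ℝ) : ℝ :=
  Real.log (Real.exp (Real.exp 1) + x) / Real.log (Real.log (Real.exp (Real.exp 1) + x))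

/-- The gate cost `c₀ + c₁ |s| log^γ (|s| / δ)` of approximating `e^{-iAs}` to error `δ`. -/
def evolutionCost (c₀ c₁ γ s δ : ℝ) : ℝ := c₀ + c₁ * |s| * lg (|s| / δ) ^ γ

end QSim

end

/-! Cut the time `t` into segments of length `τ` with `αB τ ≤ 1/2`. In the frame rotating with `A`,
the evolution over a segment is a time-ordered exponential generated by the rotated `B` alone, so
the order at which its Dyson series may be truncated is governed by `αB` and not by `αA`: because of
the factorials, `O(log y / log log y)` terms with `y = αB t / ε` suffice (`le_factorial`). Replacing
the time integrals by sums over strictly increasing times from a grid of `M = 2^L` points, of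
spacing `h = τ / M`, turns the untruncated series into the product `(e^{-iAh} (1 - ihB))^M`
(`evolution_mul_sum_dyson`), which differs from `e^{-i(A+B)τ}` by `O((τ(αA+αB))²/M)`. Thus `αA`
enters only through the number `L` of clock qubits, that is, logarithmically
(`norm_evolution_mul_dyson_sub_le`).

The truncated sum is realized with a clock register of `L` qubits. The strictly lower triangular
matrix `shiftOp` enforces time ordering and is block-encoded by a comparison circuit (`BE.shiftOp`).
The block-diagonal operator holding the rotated `B` at every clock time costs one use of the block
encoding of `B` between two clock-controlled evolutions under `A` (`BE.clockOp_interaction`). For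
the product `X` of the two, `(X/2)^j` maps the uniform clock state to the Dyson sums of order `j`
(`pow_mul_opColumn_eq`), so the whole series is an expectation of a geometric series in `X/2`
(`compress_geometric_eq`). Since `∑_{j<2^r} Z^j = ∏_{i<r} (1 + Z^{2^i})`, this geometric series is a
product of two-term linear combinations and uses `X` only `2^r - 1` times
(`BE.normalized_geometric`). The outcome is a block encoding of half of an almost unitary operator;
oblivious amplitude amplification removes the factor `1/2` (`BE.amplify`).

The accounting is done with two predicates: `Impl` for approximate implementation with ancillas that
start and end in `|0⟩`, and `BE` for block encodings. `BE` also tracks the number of ancillas,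
because the reflections of the amplification cost gates in proportion to it. Elementary inequalities
for logarithms (`lg_le_of_le`, `lg_le_of_le'`) convert the precision needed for `e^{-iAτ}` into the
two forms of the bound. -/

open scoped Matrix.Norms.L2Operator
noncomputable section
namespace QSim

set_option linter.unusedSectionVars false

open Matrix Function

/-! ### Operators on part of a register, and ancillas in the zero state -/

section Embedding

variable {S S' S'' X : Type} 

/-- `x` and `y` take the same values outside the range of `f`. -/
def AgreeOff (f : S → S') (x y : S' → Bool) : Prop := ∀ k, k ∉ Set.range f → x k = y k

/-- Extension of a bit string by zeros along `f`. -/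
def extZero (f : S → S') (w : S → Bool) : S' → Bool := extend f w fun _ => false

theorem AgreeOff.refl (f : S → S') (x : S' → Bool) : AgreeOff f x x := fun _ _ => rfl

theorem agreeOff_comm {f : S → S'} {x y : S' → Bool} : AgreeOff f x y ↔ AgreeOff f y x :=
  ⟨fun h k hk => (h k hk).symm, fun h k hk => (h k hk).symm⟩

theorem extend_of_notMem_range {f : S → S'} (w : S → Bool) (x : S' → Bool) {k : S'}
    (hk : k ∉ Set.range f) : extend f w x k = x k :=
  extend_apply' _ _ _ (by simpa using hk)

theorem extend_comp_self {f : S → S'} (hf : Injective f) (w : S → Bool) (x : S' → Bool) :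
    extend f w x ∘ f = w := by
  funext s; simp [hf.extend_apply]

theorem extZero_comp_self {f : S → S'} (hf : Injective f) (w : S → Bool) :
    extZero f w ∘ f = w := extend_comp_self hf _ _

theorem agreeOff_extend {f : S → S'} (w : S → Bool) (x : S' → Bool) :
    AgreeOff f x (extend f w x) := fun _ hk => (extend_of_notMem_range w x hk).symm

theorem AgreeOff.eq_extend {f : S → S'} (hf : Injective f) {x z : S' → Bool}
    (h : AgreeOff f x z) : extend f (z ∘ f) x = z := by
  funext k
  by_cases hk : k ∈ Set.range f
  · obtain ⟨s, rfl⟩ := hk; simp [hf.extend_apply]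
  · rw [extend_of_notMem_range _ _ hk, h k hk]

theorem AgreeOff.ext {f : S → S'} {x z : S' → Bool} (h : AgreeOff f x z)
    (h' : ∀ s, x (f s) = z (f s)) : x = z := by
  funext k
  by_cases hk : k ∈ Set.range f
  · obtain ⟨s, rfl⟩ := hk; exact h' s
  · exact h k hk

theorem agreeOff_extend_left {f : S → S'} (w : S → Bool) (x y : S' → Bool) :
    AgreeOff f (extend f w x) y ↔ AgreeOff f x y :=
  forall₂_congr fun _ hk => by rw [extend_of_notMem_range w x hk]

theorem agreeOff_extZero {f : S → S'} (w : S → Bool) (x : S' → Bool) :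
    AgreeOff f x (extZero f w) ↔ ∀ k, k ∉ Set.range f → x k = false :=
  forall₂_congr fun _ hk => by rw [extZero, extend_of_notMem_range _ _ hk]

theorem eq_extZero_iff {f : S → S'} (hf : Injective f) {x : S' → Bool} {w : S → Bool} :
    x = extZero f w ↔ (∀ k, k ∉ Set.range f → x k = false) ∧ x ∘ f = w := by
  constructor
  · rintro rfl
    exact ⟨(agreeOff_extZero w _).1 (AgreeOff.refl _ _), extZero_comp_self hf w⟩
  · rintro ⟨h, h'⟩
    refine AgreeOff.ext (f := f) ((agreeOff_extZero w x).2 h) fun s => ?_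
    rw [← h', extZero, hf.extend_apply]; rfl

theorem extZero_injective {f : S → S'} (hf : Injective f) : Injective (extZero f) := fun a b h => by
  rw [← extZero_comp_self hf a, h, extZero_comp_self hf]

theorem extZero_extZero {f : S → S'} {g : S' → S''} (hf : Injective f) (hg : Injective g)
    (w : S → Bool) : extZero g (extZero f w) = extZero (g ∘ f) w := by
  symm
  rw [eq_extZero_iff hg]
  refine ⟨fun k hk => ?_, ?_⟩
  · rw [extZero, extend_of_notMem_range]
    rintro ⟨s, rfl⟩; exact hk ⟨f s, rfl⟩
  · rw [eq_extZero_iff hf]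
    refine ⟨fun k hk => ?_, extZero_comp_self (hg.comp hf) w⟩
    rw [Function.comp_apply, extZero, extend_of_notMem_range]
    rintro ⟨s, hs⟩; exact hk ⟨s, hg hs⟩

/-- The matrix of the map `|y⟩ ↦ |g y⟩` on basis states. -/
def fnMatrix {Y Z : Type} [DecidableEq Z] (g : Y → Z) : Matrix Z Y ℂ :=
  fun z y => if z = g y then 1 else 0

theorem mul_fnMatrix {Y Z W : Type} [DecidableEq Z] [Fintype Z] (g : Y → Z) (M : Matrix W Z ℂ) :
    M * fnMatrix g = M.submatrix id g := by
  ext w y; simp [Matrix.mul_apply, fnMatrix]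

theorem conjTranspose_fnMatrix_mul {Y Z W : Type} [DecidableEq Z] [Fintype Z] (g : Y → Z)
    (M : Matrix Z W ℂ) : (fnMatrix g)ᴴ * M = M.submatrix g id := by
  ext w y; simp [Matrix.mul_apply, fnMatrix]

theorem fnMatrix_mul_fnMatrix {Y Z W : Type} [DecidableEq Z] [Fintype Z] [DecidableEq W]
    (g : Y → Z) (h : Z → W) : fnMatrix h * fnMatrix g = fnMatrix (h ∘ g) := by
  rw [mul_fnMatrix]; rfl

theorem fnMatrix_id {Y : Type} [DecidableEq Y] : fnMatrix (id : Y → Y) = 1 := by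
  ext x y; simp [fnMatrix, Matrix.one_apply]

theorem conjTranspose_fnMatrix_mul_self {Y Z : Type} [DecidableEq Z] [Fintype Z] [DecidableEq Y]
    {g : Y → Z} (hg : Injective g) : (fnMatrix g)ᴴ * fnMatrix g = 1 := by
  rw [conjTranspose_fnMatrix_mul]
  ext x y; simp [fnMatrix, Matrix.one_apply, hg.eq_iff]

theorem fnMatrix_mul_of_injective {Y Z W : Type} [DecidableEq Z] [Fintype Y] {g : Y → Z}
    (hg : Injective g) (M : Matrix Y W ℂ) (y : Y) (w : W) :
    (fnMatrix g * M) (g y) w = M y w := by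
  classical simp [Matrix.mul_apply, fnMatrix, hg.eq_iff]

variable [Fintype S] [DecidableEq S] [Fintype S'] [DecidableEq S'] [Fintype S''] [DecidableEq S'']
  [Fintype X] [DecidableEq X]

open Classical in
/-- The operator `U ⊗ 1` on the register `S'`, where `U` acts on the qubits in the range of `f`. -/
def emb (f : S → S') (U : Op S) : Op S' :=
  fun x y => if AgreeOff f x y then U (x ∘ f) (y ∘ f) else 0

/-- The isometry that adjoins the qubits outside the range of `f` in the state `|0⟩`. -/
def ket (f : S → S') : Matrix (S' → Bool) (S → Bool) ℂ := fnMatrix (extZero f)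

open Classical in
theorem sum_agreeOff {f : S → S'} (hf : Injective f) (x : S' → Bool) (F : (S' → Bool) → ℂ) :
    (∑ z, if AgreeOff f x z then F z else 0) = ∑ w : S → Bool, F (extend f w x) := by
  rw [← Finset.sum_filter]
  symm
  refine Finset.sum_bij (fun w _ => extend f w x) ?_ ?_ ?_ fun _ _ => rfl
  · intro w _; simpa using agreeOff_extend w x
  · intro a _ b _ h
    rw [← extend_comp_self hf a x, h, extend_comp_self hf]
  · intro z hz
    exact ⟨z ∘ f, Finset.mem_univ _, AgreeOff.eq_extend hf (by simpa using hz)⟩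

theorem emb_mul {f : S → S'} (hf : Injective f) (U V : Op S) :
    emb f (U * V) = emb f U * emb f V := by
  classical
  ext x y
  rw [Matrix.mul_apply]
  have : ∀ z, emb f U x z * emb f V z y =
      if AgreeOff f x z then U (x ∘ f) (z ∘ f) * emb f V z y else 0 := fun z => by
    simp only [emb]; split_ifs <;> simp
  simp_rw [this]
  rw [sum_agreeOff hf]
  simp only [emb, agreeOff_extend_left, extend_comp_self hf]
  split_ifs <;> simp [Matrix.mul_apply]

theorem emb_one {f : S → S'} : emb f (1 : Op S) = 1 := by
  classical
  ext x y
  simp only [emb, Matrix.one_apply]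
  by_cases h : x = y
  · subst h; simp [AgreeOff.refl]
  · rw [if_neg h]
    split_ifs with h1 h2
    · exact (h (h1.ext fun s => congrFun h2 s)).elim
    · rfl
    · rfl

theorem emb_conjTranspose (f : S → S') (U : Op S) : emb f Uᴴ = (emb f U)ᴴ := by
  ext x y
  simp only [emb, Matrix.conjTranspose_apply]
  rw [agreeOff_comm]
  split_ifs <;> simp

theorem emb_add (f : S → S') (U V : Op S) : emb f (U + V) = emb f U + emb f V := by
  ext x y; simp only [emb, Matrix.add_apply]; split_ifs <;> simp

theorem emb_zero (f : S → S') : emb f (0 : Op S) = 0 := by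
  ext x y; simp [emb]

theorem emb_smul (f : S → S') (c : ℂ) (U : Op S) : emb f (c • U) = c • emb f U := by
  ext x y; simp [emb]

/-- `emb f` as a homomorphism of `*`-algebras. -/
def embHom (f : S → S') (hf : Injective f) : Op S →⋆ₐ[ℂ] Op S' where
  toFun := emb f
  map_one' := emb_one
  map_mul' := emb_mul hf
  map_zero' := emb_zero f
  map_add' := emb_add f
  commutes' c := by
    rw [Algebra.algebraMap_eq_smul_one, Algebra.algebraMap_eq_smul_one, emb_smul, emb_one]
  map_star' U := emb_conjTranspose f U

theorem norm_emb_le {f : S → S'} (hf : Injective f) (U : Op S) : ‖emb f U‖ ≤ ‖U‖ :=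
  NonUnitalStarAlgHom.norm_apply_le (embHom f hf) U

theorem emb_sub {f : S → S'} (U V : Op S) : emb f (U - V) = emb f U - emb f V := by
  ext x y; simp only [emb, Matrix.sub_apply]; split_ifs <;> simp

theorem emb_mem_unitary {f : S → S'} (hf : Injective f) {U : Op S} (hU : U ∈ unitary (Op S)) :
    emb f U ∈ unitary (Op S') := by
  rw [Unitary.mem_iff] at *
  simp only [Matrix.star_eq_conjTranspose] at *
  rw [← emb_conjTranspose, ← emb_mul hf, ← emb_mul hf, hU.1, hU.2, emb_one]
  exact ⟨rfl, rfl⟩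

theorem emb_emb {f : S → S'} {g : S' → S''} (hg : Injective g) (U : Op S) :
    emb g (emb f U) = emb (g ∘ f) U := by
  ext x y
  have : AgreeOff (g ∘ f) x y ↔ AgreeOff g x y ∧ AgreeOff f (x ∘ g) (y ∘ g) := by
    constructor
    · refine fun h => ⟨fun k hk => h k ?_, fun k hk => h (g k) ?_⟩
      · rintro ⟨s, rfl⟩; exact hk ⟨f s, rfl⟩
      · rintro ⟨s, hs⟩; exact hk ⟨s, hg hs⟩
    · rintro ⟨h1, h2⟩ k hk
      by_cases hk' : k ∈ Set.range g
      · obtain ⟨s, rfl⟩ := hk'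
        refine h2 s ?_
        rintro ⟨s, rfl⟩; exact hk ⟨s, rfl⟩
      · exact h1 k hk'
  simp only [emb, this, comp_assoc]
  split_ifs <;> simp_all

theorem emb_id (U : Op S) : emb id U = U := by
  ext x y; simp [emb, AgreeOff]

theorem ket_ket {f : S → S'} {g : S' → S''} (hf : Injective f) (hg : Injective g) :
    ket g * ket f = ket (g ∘ f) := by
  rw [ket, ket, fnMatrix_mul_fnMatrix, ket]
  congr 1; funext w; exact extZero_extZero hf hg w

theorem ket_conjTranspose_mul_self {f : S → S'} (hf : Injective f) : (ket f)ᴴ * ket f = 1 :=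
  conjTranspose_fnMatrix_mul_self (extZero_injective hf)

open Classical in
theorem ket_mul_apply {f : S → S'} (hf : Injective f) {W : Type} (M : Matrix (S → Bool) W ℂ)
    (x : S' → Bool) (w : W) : (ket f * M) x w =
      if ∀ k, k ∉ Set.range f → x k = false then M (x ∘ f) w else 0 := by
  split_ifs with h
  · have hx : x = extZero f (x ∘ f) := (eq_extZero_iff hf).2 ⟨h, rfl⟩
    conv_lhs => rw [hx]
    exact fnMatrix_mul_of_injective (extZero_injective hf) M _ _
  · rw [Matrix.mul_apply]
    refine Finset.sum_eq_zero fun y _ => ?_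
    rw [ket, fnMatrix, if_neg, zero_mul]
    intro hx; exact h ((eq_extZero_iff hf).1 hx).1

theorem emb_mul_ket {f : S → S'} (hf : Injective f) (U : Op S) :
    emb f U * ket f = ket f * U := by
  classical
  ext x y
  rw [ket_mul_apply hf, ket, mul_fnMatrix]
  simp only [Matrix.submatrix_apply, id_eq, emb, agreeOff_extZero, extZero_comp_self hf]

theorem norm_of_conjTranspose_mul_self {Y Z : Type} [Fintype Y] [Fintype Z] [DecidableEq Y]
    [DecidableEq Z] [Nonempty Y] {M : Matrix Z Y ℂ} (h : Mᴴ * M = 1) : ‖M‖ = 1 := by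
  have h1 := Matrix.l2_opNorm_conjTranspose_mul_self M
  rw [h, norm_one] at h1
  nlinarith [norm_nonneg M]

theorem norm_ket {f : S → S'} (hf : Injective f) : ‖ket f‖ = 1 :=
  norm_of_conjTranspose_mul_self (ket_conjTranspose_mul_self hf)

theorem norm_unitary {U : Op S} (hU : U ∈ unitary (Op S)) : ‖U‖ = 1 :=
  norm_of_conjTranspose_mul_self (Unitary.mem_iff.1 hU).1

theorem norm_ket_mul_le {f : S → S'} (hf : Injective f) {W : Type} [Fintype W] [DecidableEq W]
    (M : Matrix (S → Bool) W ℂ) : ‖ket f * M‖ ≤ ‖M‖ :=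
  (Matrix.l2_opNorm_mul _ _).trans (by rw [norm_ket hf, one_mul])

/-- Commutative squares of injections `i₁ ∘ j₁ = i₂ ∘ j₂` that are pullbacks. -/
structure IsPullback {Y₁ Y₂ : Type} (j₁ : S → Y₁) (j₂ : S → Y₂) (i₁ : Y₁ → X) (i₂ : Y₂ → X) :
    Prop where
  inj₁ : Injective i₁
  inj₂ : Injective i₂
  injl : Injective j₁
  injr : Injective j₂
  comm : i₁ ∘ j₁ = i₂ ∘ j₂
  lift : ∀ a b, i₁ a = i₂ b → ∃ s, j₁ s = a ∧ j₂ s = b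

theorem IsPullback.extZero_eq {Y₁ Y₂ : Type} {j₁ : S → Y₁} {j₂ : S → Y₂} {i₁ : Y₁ → X}
    {i₂ : Y₂ → X} (h : IsPullback j₁ j₂ i₁ i₂) {a : Y₁ → Bool} {b : Y₂ → Bool} :
    extZero i₁ a = extZero i₂ b ↔ (∀ k, k ∉ Set.range j₁ → a k = false) ∧
      (∀ k, k ∉ Set.range j₂ → b k = false) ∧ a ∘ j₁ = b ∘ j₂ := by
  constructor
  · intro heq
    refine ⟨fun k hk => ?_, fun k hk => ?_, ?_⟩
    · rw [← extZero_comp_self h.inj₁ a, heq, Function.comp_apply, extZero, extend_of_notMem_range]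
      rintro ⟨s, hs⟩
      obtain ⟨t, ht, -⟩ := h.lift k s hs.symm
      exact hk ⟨t, ht⟩
    · rw [← extZero_comp_self h.inj₂ b, ← heq, Function.comp_apply, extZero, extend_of_notMem_range]
      rintro ⟨s, hs⟩
      obtain ⟨t, -, ht⟩ := h.lift s k hs
      exact hk ⟨t, ht⟩
    · conv_lhs => rw [← extZero_comp_self h.inj₁ a, heq]
      conv_rhs => rw [← extZero_comp_self h.inj₂ b]
      rw [comp_assoc, comp_assoc, h.comm]
  · rintro ⟨ha, hb, hab⟩
    rw [(eq_extZero_iff h.injl).2 ⟨ha, rfl⟩, (eq_extZero_iff h.injr).2 ⟨hb, rfl⟩,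
      extZero_extZero h.injl h.inj₁, extZero_extZero h.injr h.inj₂, hab, h.comm]

/-- Qubits common to both sides are exactly those coming from `S`, so adjoining zeros on one side
and projecting onto zeros on the other leaves only the conditions outside `S`. This is what lets
block encodings with disjoint ancillas be multiplied. -/
theorem IsPullback.ket_mul {Y₁ Y₂ : Type} [Fintype Y₁] [DecidableEq Y₁] [Fintype Y₂]
    [DecidableEq Y₂] {j₁ : S → Y₁} {j₂ : S → Y₂} {i₁ : Y₁ → X} {i₂ : Y₂ → X}
    (h : IsPullback j₁ j₂ i₁ i₂) : (ket i₂)ᴴ * ket i₁ = ket j₂ * (ket j₁)ᴴ := by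
  classical
  ext b a
  rw [ket_mul_apply h.injr, ket, conjTranspose_fnMatrix_mul]
  simp only [submatrix_apply, ket, fnMatrix, id, conjTranspose_apply, eq_extZero_iff h.injl,
    eq_comm (a := extZero i₂ b), h.extZero_eq]
  split_ifs <;> simp_all

/-- The projection onto the states in which the qubits outside the range of `f` are `|0⟩`. -/
theorem ket_mul_conjTranspose_apply {f : S → S'} (hf : Injective f) : ket f * (ket f)ᴴ =
    diagonal (fun x => if ∀ k, k ∉ Set.range f → x k = false then (1 : ℂ) else 0) := by
  classical
  ext x y
  rw [ket_mul_apply hf]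
  simp only [diagonal_apply, ket, fnMatrix, conjTranspose_apply, eq_extZero_iff hf]
  by_cases hxy : x = y
  · subst hxy; simp
  · rw [if_neg hxy]
    split_ifs with h1 h2
    · exact (hxy (AgreeOff.ext (f := f) (fun k hk => by rw [h1 k hk, h2.1 k hk])
        fun s => (congrFun h2.2 s).symm)).elim
    · simp
    · rfl

theorem emb_diagonal {f : S → S'} (d : (S → Bool) → ℂ) :
    emb f (diagonal d) = diagonal fun x => d (x ∘ f) := by
  ext x y
  simp only [emb, diagonal_apply]
  by_cases hxy : x = y
  · subst hxy; simp [AgreeOff.refl]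
  · rw [if_neg hxy]
    split_ifs with h1 h2
    · exact (hxy (h1.ext fun s => congrFun h2 s)).elim
    · rfl
    · rfl

/-- Adjoining idle qubits does not increase the error of an implementation. -/
theorem IsPullback.norm_emb_sub_le {Y₁ Y₂ : Type} [Fintype Y₁] [DecidableEq Y₁] [Fintype Y₂]
    [DecidableEq Y₂] {j₁ : S → Y₁} {j₂ : S → Y₂} {i₁ : Y₁ → X} {i₂ : Y₂ → X}
    (h : IsPullback j₁ j₂ i₁ i₂) (c : Op Y₁) (U : Op S) :
    ‖emb i₁ c * ket i₂ - ket i₂ * emb j₂ U‖ ≤ ‖c * ket j₁ - ket j₁ * U‖ := by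
  classical
  -- A qubit in the range of `i₁` that does not come from `S` lies outside the range of `i₂`, hence
  -- is already `|0⟩` in the image of `ket i₂`. The projection may therefore be inserted freely, and
  -- `c` is only tested on inputs of the form `ket j₁`.
  have hP : emb i₁ (ket j₁ * (ket j₁)ᴴ) * ket i₂ = ket i₂ := by
    rw [ket_mul_conjTranspose_apply h.injl, emb_diagonal]
    ext x y
    rw [diagonal_mul]
    simp only [ket, fnMatrix]
    split_ifs with h1 h2 h2 <;> try simp
    subst h2
    apply h1
    intro k hk
    rw [Function.comp_apply, extZero, extend_of_notMem_range]
    rintro ⟨s, hs⟩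
    obtain ⟨t, ht, -⟩ := h.lift k s hs.symm
    exact hk ⟨t, ht⟩
  have key : emb i₁ c * ket i₂ - ket i₂ * emb j₂ U =
      emb i₁ ((c * ket j₁ - ket j₁ * U) * (ket j₁)ᴴ) * ket i₂ := by
    have h1 : (c * ket j₁ - ket j₁ * U) * (ket j₁)ᴴ =
        (c - emb j₁ U) * (ket j₁ * (ket j₁)ᴴ) := by
      rw [← emb_mul_ket h.injl, ← Matrix.sub_mul, Matrix.mul_assoc]
    rw [h1, emb_mul h.inj₁, Matrix.mul_assoc, hP, emb_sub, Matrix.sub_mul, emb_emb h.inj₁, h.comm,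
      ← emb_emb h.inj₂, emb_mul_ket h.inj₂]
  rw [key]
  calc _ ≤ ‖emb i₁ ((c * ket j₁ - ket j₁ * U) * (ket j₁)ᴴ)‖ * ‖ket i₂‖ := l2_opNorm_mul _ _
    _ ≤ ‖(c * ket j₁ - ket j₁ * U) * (ket j₁)ᴴ‖ := by
        rw [norm_ket h.inj₂, mul_one]; exact norm_emb_le h.inj₁ _
    _ ≤ ‖c * ket j₁ - ket j₁ * U‖ * ‖(ket j₁)ᴴ‖ := l2_opNorm_mul _ _
    _ = _ := by rw [l2_opNorm_conjTranspose, norm_ket h.injl, mul_one]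

end Embedding

end QSim
end

open scoped Matrix.Norms.L2Operator
noncomputable section
namespace QSim

set_option linter.unusedSectionVars false

open Matrix Function

/-! ### Diagonalization of unitary matrices -/

section Diagonalization

/-- The spectral theorem is applied to the Hermitian logarithm obtained from `arg` by functional
calculus. The jump of `arg` is harmless because the spectrum is finite, and `exp (i arg z) = z`
there because the spectrum lies on the unit circle. -/
theorem exists_unitary_diagonal {n : Type} [Fintype n] [DecidableEq n] {U : Matrix n n ℂ}
    (hU : U ∈ unitary (Matrix n n ℂ)) : ∃ V ∈ unitary (Matrix n n ℂ), ∃ θ : n → ℝ,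
      U = V * diagonal (fun i => Complex.exp (Complex.I * θ i)) * star V := by
  have hfin : (spectrum ℂ U).Finite := U.finite_spectrum
  have hcont : ∀ g : ℂ → ℂ, ContinuousOn g (spectrum ℂ U) := fun g => hfin.continuousOn g
  have hnorm : IsStarNormal U := isStarNormal_of_mem_unitary hU
  set H : Matrix n n ℂ := cfc (Complex.ofReal ∘ Complex.arg : ℂ → ℂ) U with hH
  have hHs : IsSelfAdjoint H := IsSelfAdjoint.cfc_arg U
  have hHh : H.IsHermitian := hHs
  have hHn : IsStarNormal H := hHs.isStarNormal
  have hexp : NormedSpace.exp (Complex.I • H) = U := by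
    have h1 : Complex.I • H = cfc (fun z : ℂ => Complex.I * (Complex.arg z : ℂ)) U := by
      rw [hH, ← cfc_const_mul Complex.I _ U (hcont _)]; rfl
    have hn : IsStarNormal (Complex.I • H) := by
      rw [h1]; exact cfc_predicate _ _
    rw [← CFC.complex_exp_eq_normedSpace_exp hn, h1,
      ← cfc_comp' Complex.exp _ U (Complex.continuous_exp.continuousOn) (hcont _)]
    conv_rhs => rw [← cfc_id ℂ U]
    refine cfc_congr fun z hz => ?_
    have hz1 : ‖z‖ = 1 := by
      simpa using spectrum.subset_circle_of_unitary hU hz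
    have := Complex.norm_mul_exp_arg_mul_I z
    rw [hz1, Complex.ofReal_one, one_mul, mul_comm] at this
    simpa using this
  refine ⟨hHh.eigenvectorUnitary, hHh.eigenvectorUnitary.2, hHh.eigenvalues, ?_⟩
  set V := hHh.eigenvectorUnitary
  have hsp : H = (V : Matrix n n ℂ) * diagonal (RCLike.ofReal ∘ hHh.eigenvalues) *
      star (V : Matrix n n ℂ) := by
    conv_lhs => rw [hHh.spectral_theorem]
    rw [Unitary.conjStarAlgAut_apply]
  have hinv : star (V : Matrix n n ℂ) = (V : Matrix n n ℂ)⁻¹ := by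
    rw [Matrix.inv_eq_left_inv]
    exact (Unitary.mem_iff.1 V.2).1
  have hunit : IsUnit (V : Matrix n n ℂ) :=
    ⟨⟨V, star V, (Unitary.mem_iff.1 V.2).2, (Unitary.mem_iff.1 V.2).1⟩, rfl⟩
  have : Complex.I • ((V : Matrix n n ℂ) * diagonal (RCLike.ofReal ∘ hHh.eigenvalues) *
      (V : Matrix n n ℂ)⁻¹) = (V : Matrix n n ℂ) *
      diagonal (fun i => Complex.I * (hHh.eigenvalues i : ℂ)) * (V : Matrix n n ℂ)⁻¹ := by
    rw [← Matrix.smul_mul, ← Matrix.mul_smul, ← diagonal_smul]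
    rfl
  rw [← hexp, congrArg (fun H => NormedSpace.exp (Complex.I • H)) hsp, hinv]
  rw [this, Matrix.exp_conj _ _ hunit, Matrix.exp_diagonal]
  congr 3
  funext i
  rw [Pi.coe_exp, Complex.exp_eq_exp_ℂ]

end Diagonalization

/-! ### Permutation and phase unitaries -/

section Permutations

variable {S S' : Type} [Fintype S] [DecidableEq S] [Fintype S'] [DecidableEq S']

theorem mem_unitary_of_conjTranspose_mul_self {U : Op S} (h : Uᴴ * U = 1) : U ∈ unitary (Op S) :=
  Unitary.mem_iff.2 ⟨h, mul_eq_one_comm.1 h⟩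

theorem fnMatrix_mem_unitary {σ : (S → Bool) → S → Bool} (h : Injective σ) :
    (fnMatrix σ : Op S) ∈ unitary (Op S) :=
  mem_unitary_of_conjTranspose_mul_self (conjTranspose_fnMatrix_mul_self h)

theorem diagonal_mem_unitary {d : (S → Bool) → ℂ} (h : ∀ x, ‖d x‖ = 1) :
    (diagonal d : Op S) ∈ unitary (Op S) := by
  refine mem_unitary_of_conjTranspose_mul_self ?_
  rw [diagonal_conjTranspose, diagonal_mul_diagonal, ← diagonal_one]
  congr 1; funext x
  have := Complex.conj_mul' (d x)
  rw [h x] at this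
  simpa using this

theorem emb_fnMatrix {f : S → S'} {σ₀ : (S → Bool) → S → Bool} {σ : (S' → Bool) → S' → Bool}
    (h1 : ∀ x, AgreeOff f (σ x) x) (h2 : ∀ x s, σ x (f s) = σ₀ (x ∘ f) s) :
    emb f (fnMatrix σ₀) = fnMatrix σ := by
  ext x y
  simp only [emb, fnMatrix]
  by_cases hxy : x = σ y
  · subst hxy
    have : σ y ∘ f = σ₀ (y ∘ f) := funext fun s => h2 y s
    simp [h1, this]
  · rw [if_neg hxy]
    split_ifs with h3 h4
    · refine (hxy (AgreeOff.ext (f := f) (fun k hk => ?_) fun s => ?_)).elim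
      · rw [h3 k hk, h1 y k hk]
      · rw [h2, ← h4]; rfl
    · rfl
    · rfl

theorem fnMatrix_diagonal_fnMatrix {σ : (S → Bool) → S → Bool} (h : Involutive σ)
    (d : (S → Bool) → ℂ) : (fnMatrix σ : Op S) * diagonal d * fnMatrix σ = diagonal (d ∘ σ) := by
  rw [mul_fnMatrix]
  ext x y
  simp only [submatrix_apply, id, mul_diagonal, fnMatrix, diagonal_apply, h y]
  by_cases hxy : x = y <;> simp [hxy]

/-- The map that flips qubit `q` when `φ` holds. -/
def xorFn (q : S) (φ : (S → Bool) → Bool) (x : S → Bool) : S → Bool :=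
  update x q (x q ^^ φ x)

theorem xorFn_same (q : S) (φ : (S → Bool) → Bool) (x : S → Bool) :
    xorFn q φ x q = (x q ^^ φ x) := by simp [xorFn]

theorem xorFn_of_ne {q k : S} (h : k ≠ q) (φ : (S → Bool) → Bool) (x : S → Bool) :
    xorFn q φ x k = x k := by simp [xorFn, h]

/-- `φ` does not depend on qubit `q`. -/
def IndepOf (q : S) (φ : (S → Bool) → Bool) : Prop := ∀ x b, φ (update x q b) = φ x

theorem IndepOf.xorFn {q : S} {φ : (S → Bool) → Bool} (h : IndepOf q φ) (ψ : (S → Bool) → Bool)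
    (x : S → Bool) : φ (xorFn q ψ x) = φ x := h _ _

theorem xorFn_xorFn {q : S} {φ ψ : (S → Bool) → Bool} (h : IndepOf q φ) (x : S → Bool) :
    xorFn q φ (xorFn q ψ x) = xorFn q (fun x => ψ x ^^ φ x) x := by
  funext k
  by_cases hk : k = q
  · subst hk; simp [xorFn_same, h.xorFn]
  · simp [xorFn_of_ne hk]

theorem xorFn_involutive {q : S} {φ : (S → Bool) → Bool} (h : IndepOf q φ) :
    Involutive (xorFn q φ) := fun x => by
  rw [xorFn_xorFn h]; simp [xorFn]

/-- The unitary that flips qubit `q` when `φ` holds. -/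
def xorOp (q : S) (φ : (S → Bool) → Bool) : Op S := fnMatrix (xorFn q φ)

theorem xorOp_mem_unitary {q : S} {φ : (S → Bool) → Bool} (h : IndepOf q φ) :
    xorOp q φ ∈ unitary (Op S) := fnMatrix_mem_unitary (xorFn_involutive h).injective

theorem emb_xorOp {f : S → S'} (hf : Injective f) (q : S) (φ : (S → Bool) → Bool) :
    emb f (xorOp q φ) = xorOp (f q) fun x => φ (x ∘ f) := by
  refine emb_fnMatrix (fun x k hk => xorFn_of_ne ?_ _ _) fun x s => ?_
  · rintro rfl; exact hk ⟨q, rfl⟩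
  · by_cases h : s = q
    · subst h; simp [xorFn_same]
    · rw [xorFn_of_ne (fun h' => h (hf h')), xorFn_of_ne h]; rfl

end Permutations

/-! ### Circuits and approximate implementation -/

section Circuits

variable {S S' F : Type} [Fintype S] [DecidableEq S] [Fintype S'] [DecidableEq S'] [Fintype F]
  [DecidableEq F]

theorem Gate.toOp_eq_emb (g : Gate S) :
    g.toOp = emb (Subtype.val : g.support → S) (g.op : Op g.support) := by
  ext x y
  have : AgreeOff (Subtype.val : g.support → S) x y ↔ ∀ k, k ∉ g.support → x k = y k := by
    simp [AgreeOff]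
  simp only [Gate.toOp, emb, this]
  rfl

/-- The gate that applies the unitary `U` to the qubits `f k`. -/
def gateOf (f : F → S) (hf : Injective f) (hF : Fintype.card F ≤ 2) (U : Op F)
    (hU : U ∈ unitary (Op F)) : Gate S where
  support := Finset.univ.map ⟨f, hf⟩
  card_support_le := by simpa using hF
  op := ⟨emb (fun k => ⟨f k, by simp⟩) U,
    emb_mem_unitary (fun a b h => hf (congrArg Subtype.val h)) hU⟩

theorem toOp_gateOf (f : F → S) (hf : Injective f) (hF : Fintype.card F ≤ 2) (U : Op F)
    (hU : U ∈ unitary (Op F)) : (gateOf f hf hF U hU).toOp = emb f U := by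
  rw [Gate.toOp_eq_emb]
  exact emb_emb Subtype.val_injective U

theorem Gate.toOp_mem_unitary (g : Gate S) : g.toOp ∈ unitary (Op S) := by
  rw [Gate.toOp_eq_emb]; exact emb_mem_unitary Subtype.val_injective g.op.2

theorem Circuit.toOp_append (c d : Circuit S) :
    Circuit.toOp (c ++ d : Circuit S) = Circuit.toOp d * Circuit.toOp c := by
  induction c with
  | nil => simp [Circuit.toOp]
  | cons g c ih => simp only [List.cons_append, Circuit.toOp, ih, Matrix.mul_assoc]

theorem Circuit.toOp_singleton (g : Gate S) : Circuit.toOp [g] = g.toOp := by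
  simp [Circuit.toOp]

theorem Circuit.toOp_mem_unitary (c : Circuit S) : Circuit.toOp c ∈ unitary (Op S) := by
  induction c with
  | nil => exact one_mem _
  | cons g c ih => exact mul_mem ih g.toOp_mem_unitary

theorem Circuit.exists_emb (f : S → S') (hf : Injective f) (c : Circuit S) :
    ∃ d : Circuit S', d.length = c.length ∧ Circuit.toOp d = emb f (Circuit.toOp c) := by
  induction c with
  | nil => exact ⟨[], rfl, emb_one.symm⟩
  | cons g c ih =>
    obtain ⟨d, hd, hd'⟩ := ih
    refine ⟨gateOf (f ∘ (Subtype.val : g.support → S)) (hf.comp Subtype.val_injective)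
      (by simpa using g.card_support_le) g.op g.op.2 :: d, by simp [hd], ?_⟩
    simp only [Circuit.toOp, toOp_gateOf, hd']
    rw [← emb_emb hf, ← Gate.toOp_eq_emb, emb_mul hf]

theorem Circuit.exists_star (c : Circuit S) :
    ∃ d : Circuit S, d.length = c.length ∧ Circuit.toOp d = (Circuit.toOp c)ᴴ := by
  induction c with
  | nil => exact ⟨[], rfl, by simp [Circuit.toOp]⟩
  | cons g c ih =>
    obtain ⟨d, hd, hd'⟩ := ih
    refine ⟨d ++ [gateOf (Subtype.val : g.support → S) Subtype.val_injective
      (by simpa using g.card_support_le) (star g.op : unitary (Op g.support))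
      (star g.op : unitary (Op g.support)).2], by simp [hd], ?_⟩
    rw [Circuit.toOp_append, Circuit.toOp_singleton, toOp_gateOf, hd', Circuit.toOp,
      conjTranspose_mul, Gate.toOp_eq_emb g, ← emb_conjTranspose]
    rfl

/-- `U` is implemented to error `δ` by a circuit with at most `N` gates and some ancillas. -/
def Impl (U : Op S) (δ N : ℝ) : Prop :=
  ∃ (T : Type) (_ : Fintype T) (_ : DecidableEq T) (c : Circuit (T ⊕ S)), (c.length : ℝ) ≤ N ∧
    ‖Circuit.toOp c * ket (Sum.inr : S → T ⊕ S) - ket (Sum.inr : S → T ⊕ S) * U‖ ≤ δ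

theorem Impl.intro {T : Type} [Fintype T] [DecidableEq T] {U : Op S} {δ N : ℝ}
    (h : ∃ c : Circuit (T ⊕ S), (c.length : ℝ) ≤ N ∧
      ‖Circuit.toOp c * ket (Sum.inr : S → T ⊕ S) - ket (Sum.inr : S → T ⊕ S) * U‖ ≤ δ) :
    Impl U δ N := ⟨T, _, _, h⟩

theorem norm_emb_ket_comp_le {f : S → S'} {g : S' → F} (hf : Injective f) (hg : Injective g)
    (c : Op S') (U : Op S) :
    ‖emb g c * ket (g ∘ f) - ket (g ∘ f) * U‖ ≤ ‖c * ket f - ket f * U‖ := by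
  rw [← ket_ket hf hg, ← Matrix.mul_assoc, emb_mul_ket hg, Matrix.mul_assoc, Matrix.mul_assoc,
    ← Matrix.mul_sub]
  exact norm_ket_mul_le hg _

/-- The qubits of `S'` outside the range of `f` play the role of the ancillas, after relabelling. -/
theorem Impl.of_circuit {f : S → S'} (hf : Injective f) {U : Op S} {δ N : ℝ} (c : Circuit S')
    (hc : (c.length : ℝ) ≤ N) (h : ‖Circuit.toOp c * ket f - ket f * U‖ ≤ δ) : Impl U δ N := by
  classical
  let e : S' → {k // k ∉ Set.range f} ⊕ S := fun k =>
    if h : ∃ s, f s = k then Sum.inr h.choose else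
    Sum.inl ⟨k, h⟩
  have he : e ∘ f = Sum.inr := by
    funext s
    have h : ∃ t, f t = f s := ⟨s, rfl⟩
    simp only [e, Function.comp_apply, dif_pos h]
    rw [hf h.choose_spec]
  have hinj : Injective e := by
    intro a b hab
    by_cases ha : ∃ s, f s = a
    · obtain ⟨s, rfl⟩ := ha
      by_cases hb : ∃ s, f s = b
      · obtain ⟨t, rfl⟩ := hb
        have h1 := congrFun he s
        have h2 := congrFun he t
        simp only [Function.comp_apply] at h1 h2
        rw [h1, h2] at hab
        rw [Sum.inr_injective hab]
      · have h1 := congrFun he s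
        simp only [Function.comp_apply] at h1
        rw [h1] at hab
        simp [e, dif_neg hb] at hab
    · by_cases hb : ∃ s, f s = b
      · obtain ⟨t, rfl⟩ := hb
        have h1 := congrFun he t
        simp only [Function.comp_apply] at h1
        rw [h1] at hab
        simp [e, dif_neg ha] at hab
      · simp only [e, dif_neg ha, dif_neg hb] at hab
        exact congrArg Subtype.val (Sum.inl_injective hab)
  obtain ⟨d, hd, hd'⟩ := c.exists_emb e hinj
  refine Impl.intro ⟨d, by rwa [hd], ?_⟩
  rw [hd', ← he]
  exact (norm_emb_ket_comp_le hf hinj _ _).trans h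

theorem Impl.mono {U : Op S} {δ δ' N N' : ℝ} (h : Impl U δ N) (hδ : δ ≤ δ') (hN : N ≤ N') :
    Impl U δ' N' := by
  obtain ⟨T, _, _, c, hc, h⟩ := h
  exact Impl.intro ⟨c, hc.trans hN, h.trans hδ⟩

theorem Impl.circuit (c : Circuit S) : Impl (Circuit.toOp c) 0 c.length := by
  refine Impl.of_circuit injective_id c le_rfl ?_
  have : ket (id : S → S) = 1 := by
    rw [ket, ← fnMatrix_id]; congr 1; funext w
    exact ((eq_extZero_iff injective_id).2 ⟨fun k hk => (hk ⟨k, rfl⟩).elim, rfl⟩).symm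
  simp [this]

theorem Impl.one : Impl (1 : Op S) 0 0 := by
  simpa [Circuit.toOp] using Impl.circuit ([] : Circuit S)

theorem Impl.gate (f : F → S) (hf : Injective f) (hF : Fintype.card F ≤ 2) {U : Op F}
    (hU : U ∈ unitary (Op F)) : Impl (emb f U) 0 1 := by
  have := Impl.circuit [gateOf f hf hF U hU]
  rw [Circuit.toOp_singleton, toOp_gateOf] at this
  simpa using this

theorem Impl.emb {U : Op S} {δ N : ℝ} (h : Impl U δ N) {g : S → S'} (hg : Injective g) :
    Impl (emb g U) δ N := by
  obtain ⟨T, _, _, c, hc, h⟩ := h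
  obtain ⟨d, hd, hd'⟩ := c.exists_emb (Sum.map (id : T → T) g)
    (Sum.map_injective.2 ⟨injective_id, hg⟩)
  refine Impl.intro ⟨d, by rwa [hd], ?_⟩
  rw [hd']
  refine le_trans (IsPullback.norm_emb_sub_le (j₁ := Sum.inr) ?_ _ _) h
  refine ⟨Sum.map_injective.2 ⟨injective_id, hg⟩, Sum.inr_injective, Sum.inr_injective, hg, rfl, ?_⟩
  rintro (a | a) b hab
  · simp at hab
  · exact ⟨a, rfl, by simpa using hab⟩

/-- The two circuits receive separate ancilla registers. Errors add because the second circuit is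
unitary and `U` is a contraction. -/
theorem Impl.mul {U V : Op S} {δ δ' N N' : ℝ} (hV : Impl V δ' N') (hU : Impl U δ N)
    (hU1 : ‖U‖ ≤ 1) : Impl (V * U) (δ' + δ) (N' + N) := by
  obtain ⟨T, _, _, c, hc, h⟩ := hU
  obtain ⟨T', _, _, c', hc', h'⟩ := hV
  have hi : Injective (Sum.map Sum.inl id : T ⊕ S → (T ⊕ T') ⊕ S) :=
    Sum.map_injective.2 ⟨Sum.inl_injective, injective_id⟩
  have hi' : Injective (Sum.map Sum.inr id : T' ⊕ S → (T ⊕ T') ⊕ S) :=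
    Sum.map_injective.2 ⟨Sum.inr_injective, injective_id⟩
  obtain ⟨d, hd, hd'⟩ := c.exists_emb _ hi
  obtain ⟨e, he, he'⟩ := c'.exists_emb _ hi'
  refine Impl.intro ⟨d ++ e, ?_, ?_⟩
  · rw [List.length_append, hd, he]; push_cast; linarith
  rw [Circuit.toOp_append]
  set Z : Matrix ((T ⊕ T') ⊕ S → Bool) (S → Bool) ℂ := ket Sum.inr
  have h1 : ‖Circuit.toOp d * Z - Z * U‖ ≤ δ := by
    rw [hd']; exact (norm_emb_ket_comp_le (f := Sum.inr) Sum.inr_injective hi _ _).trans h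
  have h2 : ‖Circuit.toOp e * Z - Z * V‖ ≤ δ' := by
    rw [he']; exact (norm_emb_ket_comp_le (f := Sum.inr) Sum.inr_injective hi' _ _).trans h'
  have : Circuit.toOp e * Circuit.toOp d * Z - Z * (V * U) =
      Circuit.toOp e * (Circuit.toOp d * Z - Z * U) + (Circuit.toOp e * Z - Z * V) * U := by
    rw [Matrix.mul_sub, Matrix.sub_mul]; simp only [Matrix.mul_assoc]; abel
  rw [this]
  refine (norm_add_le _ _).trans ?_
  have h3 := l2_opNorm_mul (Circuit.toOp e) (Circuit.toOp d * Z - Z * U)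
  rw [norm_unitary e.toOp_mem_unitary, one_mul] at h3
  have h4 := l2_opNorm_mul (Circuit.toOp e * Z - Z * V) U
  have h5 := mul_le_mul_of_nonneg_left hU1 (norm_nonneg (Circuit.toOp e * Z - Z * V))
  linarith

/-- Run the circuit `c` backwards: with `Z` the ancilla isometry, `c† Z - Z U† = -c† (c Z - Z U)
U†`, and the outer factors have norm one. -/
theorem Impl.star {U : Op S} {δ N : ℝ} (h : Impl U δ N) (hU : U ∈ unitary (Op S)) :
    Impl (Uᴴ) δ N := by
  obtain ⟨T, _, _, c, hc, h⟩ := h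
  obtain ⟨d, hd, hd'⟩ := c.exists_star
  refine Impl.intro ⟨d, by rwa [hd], ?_⟩
  have h1 := (Unitary.mem_iff.1 c.toOp_mem_unitary).1
  have h2 := (Unitary.mem_iff.1 hU).2
  rw [star_eq_conjTranspose] at h1 h2
  have : Circuit.toOp d * ket (Sum.inr : S → T ⊕ S) - ket (Sum.inr : S → T ⊕ S) * Uᴴ = (Circuit.toOp c)ᴴ *
      (-(Circuit.toOp c * ket (Sum.inr : S → T ⊕ S) - ket (Sum.inr : S → T ⊕ S) * U)) * Uᴴ := by
    rw [neg_sub, Matrix.mul_sub, Matrix.sub_mul, ← Matrix.mul_assoc, ← Matrix.mul_assoc, h1,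
      Matrix.one_mul, Matrix.mul_assoc, Matrix.mul_assoc, h2, Matrix.mul_one, hd']
  rw [this]
  refine (l2_opNorm_mul _ _).trans ?_
  rw [l2_opNorm_conjTranspose, norm_unitary hU, mul_one]
  refine (l2_opNorm_mul _ _).trans ?_
  rwa [l2_opNorm_conjTranspose, norm_unitary c.toOp_mem_unitary, one_mul, norm_neg]

theorem Impl.of_ket {f : S → S'} (hf : Injective f) {Q : Op S'} {U : Op S} {δ η N : ℝ}
    (hQ : Impl Q δ N) (h : ‖Q * ket f - ket f * U‖ ≤ η) : Impl U (δ + η) N := by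
  obtain ⟨T, _, _, c, hc, hc'⟩ := hQ
  refine Impl.of_circuit (Sum.inr_injective.comp hf : Injective ((Sum.inr : S' → T ⊕ S') ∘ f)) c hc
    ?_
  rw [← ket_ket hf Sum.inr_injective]
  have : Circuit.toOp c * (ket (Sum.inr : S' → T ⊕ S') * ket f) - ket (Sum.inr : S' → T ⊕ S') * ket f * U =
      (Circuit.toOp c * ket (Sum.inr : S' → T ⊕ S') - ket (Sum.inr : S' → T ⊕ S') * Q) * ket f +
        ket (Sum.inr : S' → T ⊕ S') * (Q * ket f - ket f * U) := by
    rw [Matrix.mul_sub, Matrix.sub_mul]; simp only [Matrix.mul_assoc]; abel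
  rw [this]
  refine (norm_add_le _ _).trans (add_le_add ?_ ((norm_ket_mul_le Sum.inr_injective _).trans h))
  refine (l2_opNorm_mul _ _).trans ?_
  rwa [norm_ket hf, mul_one]

theorem Impl.of_ket_eq {f : S → S'} (hf : Injective f) {Q : Op S'} {U : Op S} {δ N : ℝ}
    (hQ : Impl Q δ N) (h : Q * ket f = ket f * U) : Impl U δ N := by
  have := hQ.of_ket hf (U := U) (η := 0) (by rw [h, sub_self, norm_zero])
  rwa [add_zero] at this

end Circuits

end QSim
end

open scoped Matrix.Norms.L2Operator
noncomputable section
namespace QSim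

set_option linter.unusedSectionVars false

open Matrix Function

/-! ### Controlled operators -/

section Control

variable {S S' : Type} [Fintype S] [DecidableEq S] [Fintype S'] [DecidableEq S']

theorem diagonal_mul_emb_comm {f : S → S'} {d : (S' → Bool) → ℂ}
    (h : ∀ x y, AgreeOff f x y → d x = d y) (U : Op S) :
    diagonal d * emb f U = emb f U * diagonal d := by
  ext x y
  simp only [diagonal_mul, mul_diagonal, emb]
  split_ifs with hxy
  · rw [h x y hxy, mul_comm]
  · simp

theorem diagonal_mul_ket {f : S → S'} (d : (S' → Bool) → ℂ) :
    diagonal d * ket f = ket f * diagonal (d ∘ extZero f) := by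
  ext x y
  simp only [diagonal_mul, mul_diagonal, ket, fnMatrix]
  split_ifs with h
  · subst h; simp
  · simp

/-- The projection onto the states in which the control qubit has value `b`. -/
def ctrlProj (b : Bool) : Op (Option S) := diagonal fun x => if x none = b then 1 else 0

/-- The controlled operator `|0⟩⟨0| ⊗ 1 + |1⟩⟨1| ⊗ U`, where `none` is the control qubit. -/
def ctrl (U : Op S) : Op (Option S) := ctrlProj false + ctrlProj true * emb some U

theorem ctrlProj_mul_emb (b : Bool) (U : Op S) :
    ctrlProj b * emb some U = emb some U * ctrlProj b :=
  diagonal_mul_emb_comm (fun x y h => by rw [h none (by simp)]) U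

theorem ctrlProj_mul_self (b : Bool) : (ctrlProj b * ctrlProj b : Op (Option S)) = ctrlProj b := by
  simp [ctrlProj]

theorem ctrlProj_mul_of_ne {b c : Bool} (h : b ≠ c) :
    (ctrlProj b * ctrlProj c : Op (Option S)) = 0 := by
  rw [ctrlProj, ctrlProj, diagonal_mul_diagonal, ← diagonal_zero]
  congr 1; funext x
  by_cases h1 : x none = b <;> simp_all

theorem ctrlProj_add : (ctrlProj false + ctrlProj true : Op (Option S)) = 1 := by
  rw [ctrlProj, ctrlProj, diagonal_add, ← diagonal_one]
  congr 1; funext x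
  cases x none <;> simp

theorem ctrlProj_conjTranspose (b : Bool) : (ctrlProj b : Op (Option S))ᴴ = ctrlProj b := by
  rw [ctrlProj, diagonal_conjTranspose]
  congr 1; funext x
  by_cases h : x none = b <;> simp [h]

theorem ctrl_one : ctrl (1 : Op S) = 1 := by
  rw [ctrl, emb_one, Matrix.mul_one, ctrlProj_add]

theorem ctrl_mul (U V : Op S) : ctrl (U * V) = ctrl U * ctrl V := by
  simp only [ctrl, Matrix.add_mul, Matrix.mul_add]
  have h1 : (ctrlProj true * emb some U) * (ctrlProj true * emb some V) =
      ctrlProj true * emb some (U * V) := by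
    rw [emb_mul (Option.some_injective S), ctrlProj_mul_emb true U]
    rw [Matrix.mul_assoc, ← Matrix.mul_assoc (ctrlProj true), ctrlProj_mul_self,
      ← Matrix.mul_assoc, ← ctrlProj_mul_emb, Matrix.mul_assoc]
  have h2 : ctrlProj false * (ctrlProj true * emb some V) = 0 := by
    rw [← Matrix.mul_assoc, ctrlProj_mul_of_ne (by simp), Matrix.zero_mul]
  have h3 : ctrlProj true * emb some U * ctrlProj false = 0 := by
    rw [ctrlProj_mul_emb, Matrix.mul_assoc, ctrlProj_mul_of_ne (by simp), Matrix.mul_zero]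
  rw [h1, h2, h3, ctrlProj_mul_self]; simp

theorem ctrl_conjTranspose (U : Op S) : ctrl Uᴴ = (ctrl U)ᴴ := by
  rw [ctrl, ctrl, conjTranspose_add, conjTranspose_mul, ctrlProj_conjTranspose,
    ctrlProj_conjTranspose, ← emb_conjTranspose, ctrlProj_mul_emb]

theorem ctrl_mem_unitary {U : Op S} (hU : U ∈ unitary (Op S)) :
    ctrl U ∈ unitary (Op (Option S)) := by
  refine mem_unitary_of_conjTranspose_mul_self ?_
  rw [← ctrl_conjTranspose, ← ctrl_mul]
  have := (Unitary.mem_iff.1 hU).1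
  rw [star_eq_conjTranspose] at this
  rw [this, ctrl_one]

theorem ctrl_emb {f : S → S'} (hf : Injective f) (U : Op S) :
    ctrl (emb f U) = emb (Option.map f) (ctrl U) := by
  rw [ctrl, ctrl, emb_add, emb_mul (Option.map_injective hf), ctrlProj, ctrlProj, ctrlProj,
    ctrlProj, emb_diagonal, emb_diagonal, emb_emb (Option.some_injective _),
    emb_emb (Option.map_injective hf)]
  rfl

theorem ctrl_diagonal (d : (S → Bool) → ℂ) :
    ctrl (diagonal d) = diagonal fun x => if x none then d (x ∘ some) else 1 := by
  rw [ctrl, emb_diagonal, ctrlProj, ctrlProj, diagonal_mul_diagonal, diagonal_add]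
  congr 1; funext x
  cases x none <;> simp

theorem ctrl_xorOp (q : S) (φ : (S → Bool) → Bool) :
    ctrl (xorOp q φ) = xorOp (some q) fun x => x none && φ (x ∘ some) := by
  rw [ctrl, emb_xorOp (Option.some_injective S)]
  ext x y
  simp only [ctrlProj, Matrix.add_apply, diagonal_mul, diagonal_apply, xorOp, fnMatrix]
  cases hy : y none
  · have h1 : xorFn (some q) (fun x => x none && φ (x ∘ some)) y = y := by
      funext k
      by_cases hk : k = some q
      · subst hk; simp [xorFn_same, hy]
      · simp [xorFn_of_ne hk]
    rw [h1]
    by_cases hxy : x = y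
    · subst hxy; simp [hy]
    · simp only [hxy, if_false, zero_add]
      split_ifs with h2 h3
      · rw [h3, xorFn_of_ne (by simp), hy] at h2; simp at h2
      all_goals simp
  · have h1 : xorFn (some q) (fun x => x none && φ (x ∘ some)) y =
        xorFn (some q) (fun x => φ (x ∘ some)) y := by
      simp [xorFn, hy]
    rw [h1]
    by_cases hxy : x = xorFn (some q) (fun x => φ (x ∘ some)) y
    · have hx : x none = true := by rw [hxy, xorFn_of_ne (by simp), hy]
      simp [hx, ← hxy]
    · simp only [hxy, if_false, mul_zero, add_zero]
      split_ifs with h2 h3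
      · rw [h2, hy] at h3; simp at h3
      · rfl
      · rfl

end Control

/-! ### Constant overhead of controlling a circuit -/

section ControlledCircuits

variable {S S' : Type} [Fintype S] [DecidableEq S] [Fintype S'] [DecidableEq S']

theorem pair_injective {a b : S} (h : a ≠ b) : Injective fun k : Bool => cond k b a := by
  intro x y hxy
  cases x <;> cases y <;> simp_all [eq_comm]

theorem Impl.diagonal_pair {a b : S} (h : a ≠ b) (θ : Bool → Bool → ℝ) :
    Impl (diagonal fun x : S → Bool => Complex.exp (Complex.I * θ (x a) (x b))) 0 1 := by
  have := Impl.gate (fun k : Bool => cond k b a) (pair_injective h) (by simp)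
    (U := diagonal fun x : Bool → Bool => Complex.exp (Complex.I * θ (x false) (x true)))
    (diagonal_mem_unitary fun x => by
      rw [mul_comm]; exact Complex.norm_exp_ofReal_mul_I _)
  rw [emb_diagonal] at this
  exact this

theorem indepOf_apply {a q : S} (h : a ≠ q) : IndepOf q fun x => x a := fun x b => by
  simp [h]

theorem Impl.cnot {a q : S} (h : a ≠ q) : Impl (xorOp q fun x => x a) 0 1 := by
  have := Impl.gate (fun k : Bool => cond k a q) (pair_injective h.symm) (by simp)
    (U := xorOp false fun x => x true) (xorOp_mem_unitary (indepOf_apply (by simp)))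
  rw [emb_xorOp (pair_injective h.symm)] at this
  exact this

theorem Impl.not (q : S) : Impl (xorOp q fun _ => true) 0 1 := by
  have hi : Injective fun _ : Unit => q := fun _ _ _ => rfl
  have := Impl.gate (fun _ : Unit => q) hi (by simp)
    (U := xorOp () fun _ => true) (xorOp_mem_unitary fun _ _ => rfl)
  rw [emb_xorOp hi] at this
  exact this

theorem mul_mem_unitary {U V : Op S} (hU : U ∈ unitary (Op S)) (hV : V ∈ unitary (Op S)) :
    U * V ∈ unitary (Op S) := mul_mem hU hV

theorem Impl.mul_zero {U V : Op S} {N N' : ℝ} (hV : Impl V 0 N') (hU : Impl U 0 N)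
    (hU1 : U ∈ unitary (Op S)) : Impl (V * U) 0 (N' + N) := by
  simpa using hV.mul hU (norm_unitary hU1).le

theorem diagonal_pair_mem_unitary (θ : (S → Bool) → ℝ) :
    (diagonal fun x => Complex.exp (Complex.I * θ x) : Op S) ∈ unitary (Op S) :=
  diagonal_mem_unitary fun x => by rw [mul_comm]; exact Complex.norm_exp_ofReal_mul_I _

/-- With `Δ` half the difference of `θ` in its first argument, the phase is `a · (mean of θ) + Δ ·
(b - (a xor b))`: for `a = 0` the last bracket vanishes, for `a = 1` it is `2b - 1`. Each term
depends on two bits, once `a xor b` has been written into `b` by a CNOT and is later undone. -/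
theorem Impl.diagonal_triple {a b c : S} (hab : a ≠ b) (hac : a ≠ c) (hbc : b ≠ c)
    (θ : Bool → Bool → ℝ) : Impl (diagonal fun x : S → Bool =>
      if x a then Complex.exp (Complex.I * θ (x b) (x c)) else 1) 0 5 := by
  let Δ : Bool → ℝ := fun c => (θ true c - θ false c) / 2
  let f₁ : Bool → Bool → ℝ := fun a c => if a then θ false c + Δ c else 0
  let f₂ : Bool → Bool → ℝ := fun b c => if b then Δ c else 0
  let f₃ : Bool → Bool → ℝ := fun b c => if b then - Δ c else 0
  let D₁ : Op S := diagonal fun x => Complex.exp (Complex.I * f₁ (x a) (x c))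
  let D₂ : Op S := diagonal fun x => Complex.exp (Complex.I * f₂ (x b) (x c))
  let D₃ : Op S := diagonal fun x => Complex.exp (Complex.I * f₃ (x b) (x c))
  let C : Op S := xorOp b fun x => x a
  have hC : IndepOf b fun x => x a := indepOf_apply hab
  have hCi : Impl C 0 1 := Impl.cnot hab
  have hCu : C ∈ unitary (Op S) := xorOp_mem_unitary hC
  have h1 : Impl D₁ 0 1 := Impl.diagonal_pair hac f₁
  have h2 : Impl D₂ 0 1 := Impl.diagonal_pair hbc f₂
  have h3 : Impl D₃ 0 1 := Impl.diagonal_pair hbc f₃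
  have hu2 : D₂ ∈ unitary (Op S) := diagonal_pair_mem_unitary fun x => f₂ (x b) (x c)
  have hu3 : D₃ ∈ unitary (Op S) := diagonal_pair_mem_unitary fun x => f₃ (x b) (x c)
  have hu4 : C * D₃ ∈ unitary (Op S) := mul_mem_unitary hCu hu3
  have hu5 : C * D₃ * C ∈ unitary (Op S) := mul_mem_unitary hu4 hCu
  have hu6 : D₂ * (C * D₃ * C) ∈ unitary (Op S) := mul_mem_unitary hu2 hu5
  have h4 : Impl (D₁ * (D₂ * (C * D₃ * C))) 0 (1 + (1 + (1 + 1 + 1))) :=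
    h1.mul_zero (h2.mul_zero ((hCi.mul_zero h3 hu3).mul_zero hCi hCu) hu5) hu6
  have h5 : D₁ * (D₂ * (C * D₃ * C)) = diagonal fun x : S → Bool =>
      if x a then Complex.exp (Complex.I * θ (x b) (x c)) else 1 := by
    rw [show C * D₃ * C = _ from fnMatrix_diagonal_fnMatrix (xorFn_involutive hC) _,
      diagonal_mul_diagonal, diagonal_mul_diagonal]
    congr 1; funext x
    simp only [Function.comp_apply, ← Complex.exp_add, ← mul_add, ← Complex.ofReal_add]
    rw [xorFn_same, xorFn_of_ne hbc.symm]
    cases ha : x a <;> cases hb : x b <;> cases hc : x c <;> simp [f₁, f₂, f₃, Δ] <;> ring_nf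
  rw [← h5]
  exact h4.mono le_rfl (by norm_num)

/-- Only the middle factor needs the control, since `V` and its adjoint cancel when the control is
off. -/
theorem ctrl_conj {V : Op S} (hV : V ∈ unitary (Op S)) (D : Op S) :
    ctrl (V * D * Star.star V) = emb some V * (ctrl D * emb some (Star.star V)) := by
  have h1 : emb some V * emb some (Star.star V) = 1 := by
    rw [← emb_mul (Option.some_injective _), (Unitary.mem_iff.1 hV).2, emb_one]
  simp only [ctrl, emb_mul (Option.some_injective S)]
  rw [Matrix.add_mul, Matrix.mul_add, ctrlProj_mul_emb,
    ← Matrix.mul_assoc (emb some V) (emb some (Star.star V)), h1, Matrix.one_mul]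
  simp only [← Matrix.mul_assoc]
  rw [ctrlProj_mul_emb]

theorem Impl.ctrl_conj {V D : Op S} (hV : V ∈ unitary (Op S)) (hVi : Impl (QSim.emb some V) 0 1)
    (hVs : Impl (QSim.emb some (Star.star V)) 0 1) (hD : D ∈ unitary (Op S))
    (hDi : Impl (ctrl D) 0 5) : Impl (ctrl (V * D * Star.star V)) 0 7 := by
  rw [QSim.ctrl_conj hV]
  have he := emb_mem_unitary (Option.some_injective S) (Unitary.star_mem hV)
  exact (hVi.mul_zero (hDi.mul_zero hVs he) (mul_mem_unitary (ctrl_mem_unitary hD) he)).mono le_rfl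
    (by norm_num)

theorem Impl.ctrl_gate_pair {U : Op Bool} (hU : U ∈ unitary (Op Bool)) : Impl (ctrl U) 0 7 := by
  obtain ⟨V, hV, θ, rfl⟩ := exists_unitary_diagonal hU
  refine Impl.ctrl_conj hV (Impl.gate some (Option.some_injective _) (by simp) hV)
    (Impl.gate some (Option.some_injective _) (by simp) (Unitary.star_mem hV))
    (diagonal_pair_mem_unitary θ) ?_
  have h := Impl.diagonal_triple (a := (none : Option Bool)) (b := some false) (c := some true)
    (by simp) (by simp) (by simp) fun b c => θ fun k => cond k c b
  rw [QSim.ctrl_diagonal]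
  convert h using 7 with x
  exact congrArg θ (by funext k; cases k <;> rfl)

theorem Impl.ctrl_gate (g : Gate S) : Impl (ctrl g.toOp) 0 7 := by
  rw [Gate.toOp_eq_emb, ctrl_emb Subtype.val_injective]
  -- With at most one target qubit the controlled gate is itself primitive. With two targets,
  -- diagonalization reduces it to a controlled phase on three qubits.
  rcases g.card_support_le.lt_or_eq with h | h
  · refine (Impl.gate _ (Option.map_injective Subtype.val_injective) ?_
      (ctrl_mem_unitary g.op.2)).mono le_rfl (by norm_num)
    rw [Fintype.card_option, Fintype.card_coe]; omega
  · have e : Bool ≃ g.support := Fintype.equivOfCardEq (by simp [h])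
    have h1 : (g.op : Op g.support) = QSim.emb e (QSim.emb e.symm (g.op : Op g.support)) := by
      rw [emb_emb e.injective, e.self_comp_symm, emb_id]
    rw [h1, ctrl_emb e.injective]
    exact ((Impl.ctrl_gate_pair (emb_mem_unitary e.symm.injective g.op.2)).emb
      (Option.map_injective e.injective)).emb (Option.map_injective Subtype.val_injective)

theorem Impl.ctrl_circuit (c : Circuit S) : Impl (ctrl (Circuit.toOp c)) 0 (7 * c.length) := by
  induction c with
  | nil => simpa [Circuit.toOp, ctrl_one] using Impl.one (S := Option S)
  | cons g c ih =>
    rw [Circuit.toOp, ctrl_mul]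
    refine (ih.mul_zero (Impl.ctrl_gate g) (ctrl_mem_unitary g.toOp_mem_unitary)).mono le_rfl ?_
    rw [List.length_cons]; push_cast; linarith

theorem norm_ctrlProj_le (b : Bool) : ‖(ctrlProj b : Op (Option S))‖ ≤ 1 := by
  rw [ctrlProj, l2_opNorm_diagonal]
  refine (pi_norm_le_iff_of_nonneg zero_le_one).2 fun x => ?_
  split_ifs <;> simp

/-- The precision does not deteriorate: the idle branch is exact, so the error is that of the
original circuit multiplied by the projection onto control value `1`. -/
theorem Impl.ctrl {U : Op S} {δ N : ℝ} (h : Impl U δ N) : Impl (ctrl U) δ (7 * N) := by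
  obtain ⟨T, _, _, c, hc, h⟩ := h
  have hj : Injective (Option.map (Sum.inr : S → T ⊕ S)) :=
    Option.map_injective Sum.inr_injective
  have hpb : IsPullback (Sum.inr : S → T ⊕ S) (some : S → Option S) some
      (Option.map (Sum.inr : S → T ⊕ S)) := by
    refine ⟨Option.some_injective _, hj, Sum.inr_injective, Option.some_injective _, rfl, ?_⟩
    rintro a (_ | b) hab
    · simp at hab
    · exact ⟨b, by simpa using hab.symm, rfl⟩
  have h0 := (hpb.norm_emb_sub_le (Circuit.toOp c) U).trans h
  have hP : ∀ b, (ctrlProj b : Op (Option (T ⊕ S))) * ket (Option.map (Sum.inr : S → T ⊕ S)) =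
      ket (Option.map (Sum.inr : S → T ⊕ S)) * (ctrlProj b : Op (Option S)) := fun b => by
    rw [ctrlProj, diagonal_mul_ket, ctrlProj]
    congr 2; funext w
    have := congrFun (extZero_comp_self hj w) none
    simp only [Function.comp_apply, Option.map_none] at this
    simp only [Function.comp_apply, this]
  have h1 : ‖QSim.ctrl (Circuit.toOp c) * ket (Option.map (Sum.inr : S → T ⊕ S)) -
      ket (Option.map (Sum.inr : S → T ⊕ S)) * QSim.ctrl U‖ ≤ δ := by
    have : QSim.ctrl (Circuit.toOp c) * ket (Option.map (Sum.inr : S → T ⊕ S)) -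
        ket (Option.map (Sum.inr : S → T ⊕ S)) * QSim.ctrl U =
        (ctrlProj true : Op (Option (T ⊕ S))) * (QSim.emb some (Circuit.toOp c) * ket (Option.map (Sum.inr : S → T ⊕ S)) -
          ket (Option.map (Sum.inr : S → T ⊕ S)) * QSim.emb some U) := by
      rw [QSim.ctrl, QSim.ctrl, Matrix.add_mul, Matrix.mul_add, Matrix.mul_sub, hP,
        ← Matrix.mul_assoc (ket _) (ctrlProj true) (QSim.emb some U), ← hP true]
      simp only [Matrix.mul_assoc]; abel
    rw [this]
    refine (l2_opNorm_mul _ _).trans ?_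
    have h2 := mul_le_mul_of_nonneg_right (norm_ctrlProj_le (S := T ⊕ S) true) (norm_nonneg
      (QSim.emb some (Circuit.toOp c) * ket (Option.map (Sum.inr : S → T ⊕ S)) -
          ket (Option.map (Sum.inr : S → T ⊕ S)) * QSim.emb some U))
    rw [one_mul] at h2
    exact h2.trans h0
  have := (Impl.ctrl_circuit c).of_ket hj h1
  rw [zero_add] at this
  exact this.mono le_rfl (by linarith)

end ControlledCircuits

end QSim
end

open scoped Matrix.Norms.L2Operator
noncomputable section
namespace QSim

set_option linter.unusedSectionVars false

open Matrix Function

/-! ### Reversible comparison of binary numbers and reflections -/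

section Classical

variable {S S' : Type} [Fintype S] [DecidableEq S] [Fintype S'] [DecidableEq S']

theorem xorOp_mul_xorOp {q : S} {φ ψ : (S → Bool) → Bool} (h : IndepOf q φ) :
    xorOp q φ * xorOp q ψ = xorOp q fun x => ψ x ^^ φ x := by
  rw [xorOp, xorOp, fnMatrix_mul_fnMatrix]
  exact congrArg fnMatrix (funext fun x => xorFn_xorFn h x)

theorem Impl.xor {q : S} {φ ψ : (S → Bool) → Bool} {N N' : ℝ} (hφ : IndepOf q φ)
    (hψ : IndepOf q ψ) (h : Impl (xorOp q φ) 0 N) (h' : Impl (xorOp q ψ) 0 N') :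
    Impl (xorOp q fun x => ψ x ^^ φ x) 0 (N + N') := by
  rw [← xorOp_mul_xorOp hφ]
  exact h.mul_zero h' (xorOp_mem_unitary hψ)

theorem indepOf_and {a b q : S} (ha : a ≠ q) (hb : b ≠ q) : IndepOf q fun x => x a && x b :=
  fun x c => by simp [ha, hb]

/-- A Toffoli gate is a controlled CNOT, hence seven gates; for `a = b` it degenerates to a CNOT. -/
theorem Impl.toffoli {a b q : S} (ha : a ≠ q) (hb : b ≠ q) :
    Impl (xorOp q fun x => x a && x b) 0 7 := by
  by_cases hab : a = b
  · subst hab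
    simpa using (Impl.cnot ha).mono le_rfl (by norm_num : (1 : ℝ) ≤ 7)
  · let f : Option Bool → S := fun k => k.elim b fun j => cond j a q
    have hf : Injective f := by
      rintro (_ | _ | _) (_ | _ | _) <;> simp_all [f, eq_comm]
    have h := ((Impl.cnot (S := Bool) (a := true) (q := false) (by simp)).ctrl).emb hf
    rw [ctrl_xorOp, emb_xorOp hf] at h
    refine Impl.mono ?_ le_rfl (by norm_num : 7 * (1 : ℝ) ≤ 7)
    have hφ : (fun x : S → Bool => x a && x b) =
        fun x => (x ∘ f) none && ((x ∘ f) ∘ some) true := by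
      funext x; simp [f, Bool.and_comm]
    rw [hφ]
    exact h

/-- One step of the comparison of two binary numbers: the digits `x`, `y` decide unless equal. -/
def cmpStep (c x y : Bool) : Bool := bif x ^^ y then x else c

theorem indepOf_cmpStep {p a b q : S} (hp : p ≠ q) (ha : a ≠ q) (hb : b ≠ q) :
    IndepOf q fun x => cmpStep (x p) (x a) (x b) := fun x c => by
  simp [hp, ha, hb]

/-- Over the field with two elements `cmpStep p a b = a + ab + p + pa + pb`: two CNOTs and three
Toffoli gates, `23` in all. -/
theorem Impl.cmpStep {p a b q : S} (hp : p ≠ q) (ha : a ≠ q) (hb : b ≠ q) :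
    Impl (xorOp q fun x => cmpStep (x p) (x a) (x b)) 0 23 := by
  have ia := indepOf_apply ha
  have ip := indepOf_apply hp
  have iab := indepOf_and ha hb
  have ipa := indepOf_and hp ha
  have ipb := indepOf_and hp hb
  have h1 := Impl.xor ia iab (Impl.cnot ha) (Impl.toffoli ha hb)
  have i1 : IndepOf q fun x : S → Bool => (x a && x b) ^^ x a := fun x c => by simp [ha, hb]
  have h2 := Impl.xor i1 ip h1 (Impl.cnot hp)
  have i2 : IndepOf q fun x : S → Bool => x p ^^ ((x a && x b) ^^ x a) := fun x c => by
    simp [ha, hb, hp]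
  have h3 := Impl.xor i2 ipa h2 (Impl.toffoli hp ha)
  have i3 : IndepOf q fun x : S → Bool => (x p && x a) ^^ (x p ^^ ((x a && x b) ^^ x a)) :=
    fun x c => by simp [ha, hb, hp]
  have h4 := Impl.xor i3 ipb h3 (Impl.toffoli hp hb)
  refine Impl.mono ?_ le_rfl (by norm_num : (1 + 7 + 1 + 7 + 7 : ℝ) ≤ 23)
  convert h4 using 2
  funext x
  simp only [QSim.cmpStep]
  cases x p <;> cases x a <;> cases x b <;> rfl

/-- The comparison of the binary numbers with digits `x a`, `x b`, `(a, b) ∈ l`, lowest first. The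
result for equal numbers is `c`. -/
def cmp (c : Bool) (l : List (S × S)) (x : S → Bool) : Bool :=
  l.foldl (fun c ab => cmpStep c (x ab.1) (x ab.2)) c

theorem cmp_congr (c : Bool) (l : List (S × S)) {x : S → Bool} {y : S' → Bool} (f : S → S')
    (h : ∀ ab ∈ l, y (f ab.1) = x ab.1 ∧ y (f ab.2) = x ab.2) :
    cmp c (l.map (Prod.map f f)) y = cmp c l x := by
  induction l generalizing c with
  | nil => rfl
  | cons ab l ih =>
    obtain ⟨h1, h2⟩ := h ab (by simp)
    simp only [cmp, List.map_cons, List.foldl_cons, Prod.map_fst, Prod.map_snd, h1, h2] at *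
    exact ih _ fun ab hab => h ab (by simp [hab])

theorem cmp_cons (c : Bool) (a b : S) (l : List (S × S)) (x : S → Bool) :
    cmp c ((a, b) :: l) x = cmp (cmpStep c (x a) (x b)) l x := rfl

theorem indepOf_cmp {p q : S} {l : List (S × S)} (hp : p ≠ q)
    (hl : ∀ ab ∈ l, ab.1 ≠ q ∧ ab.2 ≠ q) : IndepOf q fun x => cmp (x p) l x := fun x b => by
  have := cmp_congr (x p) l (x := x) (y := update x q b) id fun ab hab => by
    simp [hl ab hab]
  simp only [Prod.map_id, List.map_id] at this
  simp only [update_of_ne hp, this]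

theorem extZero_some_none (w : S → Bool) : extZero some w none = false :=
  extend_of_notMem_range _ _ (by simp)

theorem extZero_some_some (w : S → Bool) (s : S) : extZero some w (some s) = w s :=
  congrFun (extZero_comp_self (Option.some_injective S) w) s

theorem fnMatrix_mul_ket_eq {f : S → S'} {σ : (S' → Bool) → S' → Bool} {σ' : (S → Bool) → S → Bool}
    (h : ∀ w, σ (extZero f w) = extZero f (σ' w)) :
    fnMatrix σ * ket f = ket f * fnMatrix σ' := by
  rw [ket, fnMatrix_mul_fnMatrix, fnMatrix_mul_fnMatrix]
  exact congrArg fnMatrix (funext h)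

/-- Write the result of the lowest digit into a fresh ancilla, compare the remaining digits with
that ancilla as the initial value, then uncompute it. Each digit thus costs two `cmpStep`s, and the
end of the recursion one CNOT. -/
theorem Impl.cmp (n : ℕ) : ∀ {S : Type} [Fintype S] [DecidableEq S] (l : List (S × S)) {p q : S},
    l.length = n → p ≠ q → (∀ ab ∈ l, ab.1 ≠ q ∧ ab.2 ≠ q) →
      Impl (xorOp q fun x => cmp (x p) l x) 0 (46 * n + 1) := by
  induction n with
  | zero =>
    intro S _ _ l p q hl hp _
    rw [List.length_eq_zero_iff] at hl
    subst hl
    exact (Impl.cnot hp).mono le_rfl (by simp)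
  | succ n ih =>
    intro S _ _ l p q hl hp hlq
    obtain _ | ⟨⟨a, b⟩, l⟩ := l
    · simp at hl
    rw [List.length_cons, add_left_inj] at hl
    obtain ⟨ha, hb⟩ := hlq (a, b) (by simp)
    have hlq' : ∀ ab ∈ l, ab.1 ≠ q ∧ ab.2 ≠ q := fun ab hab => hlq ab (by simp [hab])
    let l' : List (Option S × Option S) := l.map (Prod.map some some)
    have hl'q : ∀ ab ∈ l', ab.1 ≠ some q ∧ ab.2 ≠ some q := by
      intro ab hab
      obtain ⟨cd, hcd, rfl⟩ := List.mem_map.1 hab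
      simpa using hlq' cd hcd
    have h1 := ih l' (p := none) (q := some q) (by simp [l', hl]) (by simp) hl'q
    have h2 := Impl.cmpStep (S := Option S) (p := some p) (a := some a) (b := some b) (q := none)
      (by simp) (by simp) (by simp)
    have i1 : IndepOf (some q) fun x : Option S → Bool => QSim.cmp (x none) l' x :=
      indepOf_cmp (by simp) hl'q
    have i2 : IndepOf none fun x : Option S → Bool =>
      QSim.cmpStep (x (some p)) (x (some a)) (x (some b)) :=
      indepOf_cmpStep (by simp) (by simp) (by simp)
    have h3 := h2.mul_zero (h1.mul_zero h2 (xorOp_mem_unitary i2))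
      (mul_mem_unitary (xorOp_mem_unitary i1) (xorOp_mem_unitary i2))
    refine (h3.of_ket_eq (Option.some_injective S) ?_).mono le_rfl
      (by push_cast; linarith : (23 + (46 * (n : ℝ) + 1 + 23)) ≤ _)
    simp only [xorOp, fnMatrix_mul_fnMatrix]
    refine fnMatrix_mul_ket_eq fun w => ?_
    simp only [Function.comp_apply]
    set x := extZero some w with hx
    set y := xorFn none (fun x : Option S → Bool =>
      QSim.cmpStep (x (some p)) (x (some a)) (x (some b))) x with hy
    have hyn : y none = QSim.cmpStep (w p) (w a) (w b) := by
      rw [hy, xorFn_same, hx, extZero_some_none]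
      simp only [extZero_some_some, Bool.false_xor]
    have hys : ∀ s, y (some s) = w s := fun s => by
      rw [hy, xorFn_of_ne (by simp), hx, extZero_some_some]
    have hcmp : QSim.cmp (y none) l' y = QSim.cmp (w p) ((a, b) :: l) w := by
      rw [cmp_cons, hyn]
      exact cmp_congr _ l some fun ab _ => ⟨hys _, hys _⟩
    set z := xorFn (some q) (fun x : Option S → Bool => QSim.cmp (x none) l' x) y with hz
    funext k
    obtain _ | k := k
    · rw [xorFn_same, extZero_some_none, hz, xorFn_of_ne (by simp), hyn, xorFn_of_ne (by simpa),
        xorFn_of_ne (by simpa), xorFn_of_ne (by simpa), hys, hys, hys, Bool.xor_self]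
    · rw [xorFn_of_ne (by simp), extZero_some_some]
      by_cases hk : k = q
      · subst hk
        rw [hz, xorFn_same, xorFn_same, hys, hcmp]
      · rw [hz, xorFn_of_ne (by simpa), xorFn_of_ne hk, hys]

theorem Impl.cmp_false (l : List (S × S)) {q : S} (hlq : ∀ ab ∈ l, ab.1 ≠ q ∧ ab.2 ≠ q) :
    Impl (xorOp q fun x => QSim.cmp false l x) 0 (46 * l.length + 1) := by
  let l' : List (Option S × Option S) := l.map (Prod.map some some)
  have h := Impl.cmp l.length l' (p := none) (q := some q) (by simp [l']) (by simp) (by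
    intro ab hab
    obtain ⟨cd, hcd, rfl⟩ := List.mem_map.1 hab
    simpa using hlq cd hcd)
  refine h.of_ket_eq (Option.some_injective S) (fnMatrix_mul_ket_eq fun w => ?_)
  funext k
  obtain _ | k := k
  · rw [xorFn_of_ne (by simp), extZero_some_none, extZero_some_none]
  · rw [extZero_some_some]
    by_cases hk : k = q
    · subst hk
      rw [xorFn_same, xorFn_same, extZero_some_some, extZero_some_none,
        cmp_congr false l some fun ab _ => ⟨extZero_some_some _ _, extZero_some_some _ _⟩]
    · rw [xorFn_of_ne (by simpa), xorFn_of_ne hk, extZero_some_some]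

/-- Against a digit that is always zero, a bit `1` makes the result false and a bit `0` preserves
it. Comparison therefore doubles as a many-bit conjunction, which is what the reflection needs. -/
theorem cmp_zero_true (z : S) (l : List S) (x : S → Bool) (hz : x z = false) :
    ∀ c, cmp c (l.map fun s => (z, s)) x = (c && l.all fun s => !x s) := by
  induction l with
  | nil => intro c; simp [cmp]
  | cons s l ih =>
    intro c
    rw [List.map_cons, cmp_cons, ih, List.all_cons, hz]
    cases c <;> cases x s <;> simp [cmpStep]

/-- The reflection that changes the sign of the states in which the qubits of `l` are all zero. -/
theorem Impl.reflection (l : List S) :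
    Impl (diagonal fun x : S → Bool => if ∀ s ∈ l, x s = false then (-1 : ℂ) else 1) 0
      (92 * l.length + 5) := by
  -- Three ancillas: `none` receives the result, `some none` is the initial value of the comparison
  -- and is flipped to `1` by `hX`, and `some (some none)` remains `0` as the digit to compare with.
  let R := Option (Option (Option S))
  let f : S → R := fun s => some (some (some s))
  have hf : Injective f := fun a b h =>
    Option.some_injective _ (Option.some_injective _ (Option.some_injective _ h))
  let l' : List (R × R) := l.map fun s => (some (some none), f s)
  have hlq : ∀ ab ∈ l', ab.1 ≠ (none : R) ∧ ab.2 ≠ (none : R) := by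
    intro ab hab
    obtain ⟨s, hs, rfl⟩ := List.mem_map.1 hab
    simp [f]
  have ic : IndepOf (none : R) fun x => QSim.cmp (x (some none)) l' x :=
    indepOf_cmp (by simp) hlq
  have hc : Impl (xorOp (none : R) fun x => QSim.cmp (x (some none)) l' x) 0 (46 * l.length + 1) :=
    Impl.cmp l.length l' (by simp [l']) (by simp) hlq
  have hX : Impl (xorOp (some none : R) fun _ => true) 0 1 := Impl.not _
  have iX : IndepOf (some none : R) fun _ => true := fun _ _ => rfl
  let d : (R → Bool) → ℂ := fun x => if x none then -1 else 1
  have hdu : ∀ {F : Type} [Fintype F] [DecidableEq F] (q : F),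
      (diagonal (fun x : F → Bool => if x q then (-1 : ℂ) else 1) : Op F) ∈ unitary (Op F) :=
    fun q => diagonal_mem_unitary fun x => by split_ifs <;> simp
  have hD : Impl (diagonal d) 0 1 := by
    have := Impl.gate (fun _ : Unit => (none : R)) (fun _ _ _ => rfl) (by simp) (hdu ())
    rw [emb_diagonal] at this
    exact this
  have uc := xorOp_mem_unitary ic
  have uX := xorOp_mem_unitary iX
  -- Compute the conjunction, apply the sign to the result qubit, uncompute: a diagonal operator
  -- conjugated by a permutation.
  have h1 := (hc.mul_zero hD (hdu none)).mul_zero hc uc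
  rw [xorOp, fnMatrix_diagonal_fnMatrix (xorFn_involutive ic)] at h1
  have u1 : (diagonal (d ∘ xorFn none fun x => QSim.cmp (x (some none)) l' x) : Op R) ∈
      unitary (Op R) := by
    refine diagonal_mem_unitary fun x => ?_
    simp only [d, Function.comp_apply]; split_ifs <;> simp
  have h2 := (hX.mul_zero h1 u1).mul_zero hX uX
  rw [xorOp, fnMatrix_diagonal_fnMatrix (xorFn_involutive iX)] at h2
  refine (h2.of_ket_eq hf (U := diagonal fun x : S → Bool => if ∀ s ∈ l, x s = false then (-1 : ℂ)
    else 1) ?_).mono le_rfl (by linarith)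
  rw [diagonal_mul_ket]
  congr 2; funext w
  simp only [Function.comp_apply, d]
  set x := xorFn (some none : R) (fun _ => true) (extZero f w) with hx
  have hxf : ∀ s, x (f s) = w s := fun s => by
    rw [hx, xorFn_of_ne (by simp [f])]; exact congrFun (extZero_comp_self hf w) s
  have hx0 : x none = false := by
    rw [hx, xorFn_of_ne (by simp)]
    exact extend_of_notMem_range _ _ (by simp [f])
  have hx1 : x (some none) = true := by
    rw [hx, xorFn_same, extZero, extend_of_notMem_range _ _ (by simp [f])]; rfl
  have hx2 : x (some (some none)) = false := by
    rw [hx, xorFn_of_ne (by simp)]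
    exact extend_of_notMem_range _ _ (by simp [f])
  have hl' : l' = (l.map f).map fun s => (some (some none), s) := by simp [l']
  rw [xorFn_same, hx0, hx1, hl', cmp_zero_true _ _ _ hx2]
  simp [hxf]

end Classical

end QSim
end

open scoped Matrix.Norms.L2Operator
noncomputable section
namespace QSim

set_option linter.unusedSectionVars false

open Matrix Function

/-! ### Block encodings: products, linear combinations, amplification -/

section BlockEncoding

variable {S S' C : Type} [Fintype S] [DecidableEq S] [Fintype S'] [DecidableEq S'] [Fintype C]
  [DecidableEq C]

/-- The compression `(⟨0| ⊗ 1) M (|0⟩ ⊗ 1)` to the states with zeros outside the range of `f`. -/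
def compress (f : S → S') (M : Op S') : Op S := (ket f)ᴴ * M * ket f

theorem compress_apply (f : S → S') (M : Op S') (x y : S → Bool) :
    compress f M x y = M (extZero f x) (extZero f y) := by
  rw [compress, ket, conjTranspose_fnMatrix_mul, mul_fnMatrix]; rfl

theorem compress_comp {f : S → S'} {g : S' → C} (hf : Injective f) (hg : Injective g) (M : Op C) :
    compress (g ∘ f) M = compress f (compress g M) := by
  rw [compress, ← ket_ket hf hg, compress, compress, conjTranspose_mul]
  simp only [Matrix.mul_assoc]

theorem compress_emb {f : S → S'} (hf : Injective f) (U : Op S) : compress f (emb f U) = U := by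
  rw [compress, Matrix.mul_assoc, emb_mul_ket hf, ← Matrix.mul_assoc,
    ket_conjTranspose_mul_self hf, Matrix.one_mul]

theorem compress_mul_emb {f : S → S'} (hf : Injective f) (M : Op S') (U : Op S) :
    compress f (M * emb f U) = compress f M * U := by
  simp only [compress, Matrix.mul_assoc, emb_mul_ket hf]

theorem compress_add (f : S → S') (M N : Op S') :
    compress f (M + N) = compress f M + compress f N := by
  ext x y; simp [compress_apply]

theorem emb_mul_apply {f : S → S'} (hf : Injective f) {W : Type} (U : Op S)
    (M : Matrix (S' → Bool) W ℂ) (x : S' → Bool) (w : W) :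
    (emb f U * M) x w = ∑ z, U (x ∘ f) z * M (extend f z x) w := by
  classical
  rw [Matrix.mul_apply]
  have : ∀ z, emb f U x z * M z w =
      if AgreeOff f x z then U (x ∘ f) (z ∘ f) * M z w else 0 := fun z => by
    simp only [emb]; split_ifs <;> simp
  simp_rw [this]
  rw [sum_agreeOff hf]
  simp only [extend_comp_self hf]

open Classical in
theorem emb_mul_emb_apply {f : S → S'} {g : C → S'} (hf : Injective f)
    (hfg : ∀ s c, f s ≠ g c) (U : Op S) (V : Op C) (x y : S' → Bool) :
    (emb f U * emb g V) x y = if ∀ k, k ∉ Set.range f → k ∉ Set.range g → x k = y k then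
      U (x ∘ f) (y ∘ f) * V (x ∘ g) (y ∘ g) else 0 := by
  rw [emb_mul_apply hf]
  have hg : ∀ z, extend f z x ∘ g = x ∘ g := fun z => by
    funext c
    exact extend_of_notMem_range _ _ (by rintro ⟨s, hs⟩; exact hfg s c hs)
  have hA : ∀ z, AgreeOff g (extend f z x) y ↔
      z = y ∘ f ∧ ∀ k, k ∉ Set.range f → k ∉ Set.range g → x k = y k := by
    intro z
    constructor
    · intro h
      refine ⟨?_, fun k hk hk' => ?_⟩
      · funext s
        have := h (f s) (by rintro ⟨c, hc⟩; exact hfg s c hc.symm)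
        rwa [hf.extend_apply] at this
      · rw [← h k hk', extend_of_notMem_range _ _ hk]
    · rintro ⟨rfl, h⟩ k hk
      by_cases hk' : k ∈ Set.range f
      · obtain ⟨s, rfl⟩ := hk'
        rw [hf.extend_apply]; rfl
      · rw [extend_of_notMem_range _ _ hk', h k hk' hk]
  simp only [emb, hg, hA]
  split_ifs with h
  · rw [Finset.sum_eq_single (y ∘ f)]
    · rw [if_pos ⟨rfl, h⟩]
    · intro z _ hz; rw [if_neg (fun h' => hz h'.1), mul_zero]
    · simp
  · exact Finset.sum_eq_zero fun z _ => by rw [if_neg (fun h' => h h'.2), mul_zero]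

theorem emb_mul_emb_comm {f : S → S'} {g : C → S'} (hf : Injective f) (hg : Injective g)
    (hfg : ∀ s c, f s ≠ g c) (U : Op S) (V : Op C) : emb f U * emb g V = emb g V * emb f U := by
  classical
  ext x y
  rw [emb_mul_emb_apply hf hfg, emb_mul_emb_apply hg fun c s => (hfg s c).symm]
  congr 1
  · exact propext ⟨fun h k hk hk' => h k hk' hk, fun h k hk hk' => h k hk' hk⟩
  · rw [mul_comm]

/-- `X` is the compression of a unitary that uses at most `a` ancillas and is implemented to error
`δ` with at most `N` gates. -/
def BE (X : Op S) (δ a N : ℝ) : Prop :=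
  ∃ (T : Type) (_ : Fintype T) (_ : DecidableEq T) (U : Op (T ⊕ S)), (Fintype.card T : ℝ) ≤ a ∧
    U ∈ unitary (Op (T ⊕ S)) ∧ Impl U δ N ∧ compress (Sum.inr : S → T ⊕ S) U = X

theorem BE.intro {T : Type} [Fintype T] [DecidableEq T] {X : Op S} {δ a N : ℝ} (U : Op (T ⊕ S))
    (ha : (Fintype.card T : ℝ) ≤ a) (hU : U ∈ unitary (Op (T ⊕ S))) (h : Impl U δ N)
    (hX : compress (Sum.inr : S → T ⊕ S) U = X) : BE X δ a N := ⟨T, _, _, U, ha, hU, h, hX⟩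

theorem BE.mono {X : Op S} {δ a N δ' a' N' : ℝ} (h : BE X δ a N) (hδ : δ ≤ δ') (ha : a ≤ a')
    (hN : N ≤ N') : BE X δ' a' N' := by
  obtain ⟨T, _, _, U, h1, h2, h3, h4⟩ := h
  exact BE.intro U (h1.trans ha) h2 (h3.mono hδ hN) h4

theorem exists_sum_of_injective {f : S → S'} (hf : Injective f) :
    ∃ (T : Type) (_ : Fintype T) (_ : DecidableEq T) (e : S' → T ⊕ S), Injective e ∧
      e ∘ f = Sum.inr ∧ Fintype.card T + Fintype.card S = Fintype.card S' := by
  classical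
  let e : S' ≃ {k // k ∉ Set.range f} ⊕ S :=
    ((Equiv.sumComm _ _).trans ((Equiv.sumCongr (Equiv.ofInjective f hf) (Equiv.refl _)).trans
      (Equiv.Set.sumCompl (Set.range f)))).symm
  refine ⟨{k // k ∉ Set.range f}, inferInstance, inferInstance, e, e.injective, ?_, ?_⟩
  · funext s
    rw [Function.comp_apply, Equiv.symm_apply_eq]
    simp
  · rw [← Fintype.card_sum]; exact (Fintype.card_congr e).symm

theorem BE.of_ket {f : S → S'} (hf : Injective f) {X : Op S} {δ a N : ℝ} {U : Op S'}
    (ha : (Fintype.card S' : ℝ) ≤ a + Fintype.card S) (hU : U ∈ unitary (Op S')) (h : Impl U δ N)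
    (hX : compress f U = X) : BE X δ a N := by
  obtain ⟨T, _, _, e, he, hef, hc⟩ := exists_sum_of_injective hf
  refine BE.intro (T := T) (emb e U) ?_ (emb_mem_unitary he hU) (h.emb he) ?_
  · rw [← hc] at ha; push_cast at ha; linarith
  · rw [← hef, compress_comp hf he, compress_emb he, hX]

theorem BE.compress {f : S → S'} (hf : Injective f) {X : Op S'} {δ a N : ℝ} (h : BE X δ a N) :
    BE (QSim.compress f X) δ (a + Fintype.card S' - Fintype.card S) N := by
  obtain ⟨T, _, _, U, h1, h2, h3, h4⟩ := h
  refine BE.of_ket (Sum.inr_injective.comp hf : Injective ((Sum.inr : S' → T ⊕ S') ∘ f)) ?_ h2 h3 ?_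
  · rw [Fintype.card_sum]; push_cast; linarith
  · rw [compress_comp hf Sum.inr_injective, h4]

theorem BE.impl {U : Op S} {δ N : ℝ} (hU : U ∈ unitary (Op S)) (h : Impl U δ N) : BE U δ 0 N := by
  refine BE.of_ket injective_id (by simp) hU h ?_
  have := compress_emb (injective_id (α := S)) U
  rwa [emb_id] at this

/-- The ancilla registers are kept disjoint. By `IsPullback.ket_mul`, adjoining the ancillas of `V`
and projecting on those of `U` commute past each other, so the compression of the product factors.
-/
theorem BE.mul {X Y : Op S} {δ a N δ' a' N' : ℝ} (hY : BE Y δ' a' N') (hX : BE X δ a N) :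
    BE (Y * X) (δ' + δ) (a' + a) (N' + N) := by
  obtain ⟨T, _, _, U, ha, hU, hi, rfl⟩ := hX
  obtain ⟨T', _, _, V, hb, hV, hj, rfl⟩ := hY
  obtain ⟨I, hI⟩ : ∃ I : T ⊕ S → (T ⊕ T') ⊕ S, I = Sum.map Sum.inl id := ⟨_, rfl⟩
  obtain ⟨J, hJ⟩ : ∃ J : T' ⊕ S → (T ⊕ T') ⊕ S, J = Sum.map Sum.inr id := ⟨_, rfl⟩
  have hf : Injective I := hI ▸ Sum.map_injective.2 ⟨Sum.inl_injective, injective_id⟩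
  have hg : Injective J := hJ ▸ Sum.map_injective.2 ⟨Sum.inr_injective, injective_id⟩
  refine BE.intro (T := T ⊕ T') (QSim.emb J V * QSim.emb I U)
    ?_ (mul_mem_unitary (emb_mem_unitary hg hV) (emb_mem_unitary hf hU))
    ((hj.emb hg).mul (hi.emb hf) (norm_unitary (emb_mem_unitary hf hU)).le) ?_
  · rw [Fintype.card_sum]; push_cast; linarith
  · have hpb : IsPullback (Sum.inr : S → T ⊕ S) (Sum.inr : S → T' ⊕ S) I J := by
      refine ⟨hf, hg, Sum.inr_injective, Sum.inr_injective, by rw [hI, hJ]; rfl, ?_⟩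
      rintro (a | a) (b | b) hab <;> simp_all
    have h1 : (ket (Sum.inr : S → (T ⊕ T') ⊕ S)) = ket I * ket (Sum.inr : S → T ⊕ S) := by
      rw [ket_ket Sum.inr_injective hf, hI]; rfl
    have h2 : (ket (Sum.inr : S → (T ⊕ T') ⊕ S)) = ket J * ket (Sum.inr : S → T' ⊕ S) := by
      rw [ket_ket Sum.inr_injective hg, hJ]; rfl
    have h3 := hpb.ket_mul
    rw [QSim.compress, QSim.compress, QSim.compress]
    have e1 : QSim.emb I U * ket (Sum.inr : S → (T ⊕ T') ⊕ S) =
        ket I * (U * ket (Sum.inr : S → T ⊕ S)) := by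
      rw [h1, ← Matrix.mul_assoc, emb_mul_ket hf, Matrix.mul_assoc]
    have e2 : (ket (Sum.inr : S → (T ⊕ T') ⊕ S))ᴴ * QSim.emb J V =
        ((ket (Sum.inr : S → T' ⊕ S))ᴴ * V) * (ket J)ᴴ := by
      have := congrArg conjTranspose (emb_mul_ket hg Vᴴ)
      rw [emb_conjTranspose, conjTranspose_mul, conjTranspose_mul, conjTranspose_conjTranspose,
        conjTranspose_conjTranspose] at this
      rw [h2, conjTranspose_mul, Matrix.mul_assoc, this, Matrix.mul_assoc]
    rw [← Matrix.mul_assoc, e2, Matrix.mul_assoc _ (QSim.emb I U), e1,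
      Matrix.mul_assoc, ← Matrix.mul_assoc (ket J)ᴴ (ket I), h3]
    simp only [Matrix.mul_assoc]

theorem BE.one : BE (1 : Op S) 0 0 0 := BE.impl (one_mem _) Impl.one

theorem BE.pow {X : Op S} {δ a N : ℝ} (h : BE X δ a N) (n : ℕ) :
    BE (X ^ n) (n * δ) (n * a) (n * N) := by
  induction n with
  | zero => simpa using BE.one
  | succ n ih =>
    rw [pow_succ]
    exact (ih.mul h).mono (by push_cast; linarith) (by push_cast; linarith)
      (by push_cast; linarith)

theorem BE.emb {X : Op S} {δ a N : ℝ} (h : BE X δ a N) {g : S → S'} (hg : Injective g) :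
    BE (emb g X) δ a N := by
  obtain ⟨T, _, _, U, ha, hU, hi, rfl⟩ := h
  have hG : Injective (Sum.map (id : T → T) g) := Sum.map_injective.2 ⟨injective_id, hg⟩
  refine BE.intro (T := T) (QSim.emb (Sum.map id g) U) ha (emb_mem_unitary hG hU) (hi.emb hG) ?_
  have h0 : ∀ w : S' → Bool, extZero (Sum.inr : S' → T ⊕ S') w = Sum.elim (fun _ => false) w := by
    intro w
    symm
    rw [eq_extZero_iff Sum.inr_injective]
    refine ⟨?_, by funext s; rfl⟩
    rintro (k | k) hk
    · rfl
    · exact (hk ⟨k, rfl⟩).elim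
  have h1 : ∀ w : S → Bool, extZero (Sum.inr : S → T ⊕ S) w = Sum.elim (fun _ => false) w := by
    intro w
    symm
    rw [eq_extZero_iff Sum.inr_injective]
    refine ⟨?_, by funext s; rfl⟩
    rintro (k | k) hk
    · rfl
    · exact (hk ⟨k, rfl⟩).elim
  ext x y
  rw [compress_apply, h0, h0]
  have h2 : ∀ w : S' → Bool, (Sum.elim (fun _ => false) w : T ⊕ S' → Bool) ∘ Sum.map id g =
      Sum.elim (fun _ => false) (w ∘ g) := by
    intro w; funext k; cases k <;> rfl
  have h3 : AgreeOff (Sum.map (id : T → T) g) (Sum.elim (fun _ => false) x)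
      (Sum.elim (fun _ => false) y) ↔ AgreeOff g x y := by
    constructor
    · intro h k hk
      refine h (Sum.inr k) ?_
      rintro ⟨s | s, hs⟩
      · simp at hs
      · exact hk ⟨s, by simpa using hs⟩
    · rintro h (k | k) hk
      · rfl
      · exact h k (by rintro ⟨s, rfl⟩; exact hk ⟨Sum.inr s, rfl⟩)
  by_cases h : AgreeOff g x y
  · rw [QSim.emb, QSim.emb, if_pos (h3.2 h), if_pos h, compress_apply, h1, h1, h2, h2]
  · rw [QSim.emb, QSim.emb, if_neg (fun h' => h (h3.1 h')), if_neg h]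

/-- A single-qubit unitary with first column `(z, w)`. -/
def rot (z w : ℂ) : Op Unit := fun x y =>
  bif x () then (bif y () then star z else w) else (bif y () then - star w else z)

theorem sum_unit_bool (F : (Unit → Bool) → ℂ) :
    ∑ x, F x = F (fun _ => false) + F (fun _ => true) := by
  rw [← Equiv.sum_comp (Equiv.funUnique Unit Bool).symm F, Fintype.sum_bool, add_comm]
  rfl

theorem rot_mem_unitary {z w : ℂ} (h : ‖z‖ ^ 2 + ‖w‖ ^ 2 = 1) : rot z w ∈ unitary (Op Unit) := by
  refine mem_unitary_of_conjTranspose_mul_self ?_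
  have hz := Complex.conj_mul' z
  have hw := Complex.conj_mul' w
  have h' : (‖z‖ : ℂ) ^ 2 + (‖w‖ : ℂ) ^ 2 = 1 := by exact_mod_cast h
  have key : (starRingEnd ℂ) z * z + (starRingEnd ℂ) w * w = 1 := by rw [hz, hw, h']
  ext x y
  rw [Matrix.mul_apply, sum_unit_bool]
  have hxy : x = y ↔ x () = y () := ⟨fun h => by rw [h], fun h => by funext k; exact h⟩
  simp only [conjTranspose_apply, rot, one_apply, hxy]
  cases hx : x () <;> cases hy : y () <;> simp
  · exact key
  · ring
  · ring
  · rw [mul_comm w, mul_comm z, add_comm]; exact key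

theorem compress_emb_none (M : Op Unit) :
    compress (some : S → Option S) (emb (fun _ : Unit => none) M) =
      M (fun _ => false) (fun _ => false) • 1 := by
  ext x y
  have h : AgreeOff (fun _ : Unit => (none : Option S)) (extZero some x) (extZero some y) ↔
      x = y := by
    constructor
    · intro h
      funext s
      have := h (some s) (by simp)
      rwa [extZero_some_some, extZero_some_some] at this
    · rintro rfl; exact AgreeOff.refl _ _
  have h2 : ∀ w : S → Bool, extZero some w ∘ (fun _ : Unit => none) = fun _ => false := by
    intro w; funext _; exact extZero_some_none w
  simp only [compress_apply, emb, h, h2, Matrix.smul_apply, Matrix.one_apply]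
  split_ifs <;> simp

theorem unit_none_injective : Injective fun _ : Unit => (none : Option S) := fun _ _ _ => rfl

theorem Impl.rot {z w : ℂ} (h : ‖z‖ ^ 2 + ‖w‖ ^ 2 = 1) :
    Impl (QSim.emb (fun _ : Unit => (none : Option S)) (rot z w)) 0 1 :=
  Impl.gate _ unit_none_injective (by simp) (rot_mem_unitary h)

/-- The number `z` is the amplitude for one ancilla to remain in `|0⟩` under a rotation. -/
theorem BE.scalar {z : ℂ} (hz : ‖z‖ ≤ 1) : BE (z • (1 : Op S)) 0 1 1 := by
  have h : ‖z‖ ^ 2 + ‖((Real.sqrt (1 - ‖z‖ ^ 2) : ℝ) : ℂ)‖ ^ 2 = 1 := by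
    rw [Complex.norm_real, Real.norm_eq_abs, sq_abs, Real.sq_sqrt]
    · ring
    · nlinarith [norm_nonneg z]
  refine BE.of_ket (Option.some_injective S) (by simp [add_comm])
    (emb_mem_unitary unit_none_injective (rot_mem_unitary h)) (Impl.rot h) ?_
  rw [compress_emb_none]; rfl

/-- Prepare a control qubit with amplitudes `√(1-p)`, `√p`, apply the controlled block encoding, and
undo the preparation. -/
theorem BE.lcu {X : Op S} {δ a N : ℝ} (h : BE X δ a N) {p : ℝ} (h0 : 0 ≤ p) (h1 : p ≤ 1) :
    BE (((1 - p : ℝ) : ℂ) • 1 + (p : ℂ) • X) δ (a + 1) (7 * N + 2) := by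
  obtain ⟨T, _, _, U, ha, hU, hi, rfl⟩ := h
  set z : ℂ := ((Real.sqrt (1 - p) : ℝ) : ℂ) with hz
  set w : ℂ := ((Real.sqrt p : ℝ) : ℂ) with hw
  have hn : ‖z‖ ^ 2 + ‖w‖ ^ 2 = 1 := by
    rw [hz, hw, Complex.norm_real, Complex.norm_real, Real.norm_eq_abs, Real.norm_eq_abs, sq_abs,
      sq_abs, Real.sq_sqrt (by linarith), Real.sq_sqrt h0]
    ring
  have hu := rot_mem_unitary hn
  set R := QSim.emb (fun _ : Unit => (none : Option (T ⊕ S))) (rot z w) with hR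
  have hRu : R ∈ unitary (Op (Option (T ⊕ S))) := emb_mem_unitary unit_none_injective hu
  have hRi : Impl R 0 1 := Impl.rot hn
  have hRs : Rᴴ ∈ unitary (Op (Option (T ⊕ S))) := Unitary.star_mem hRu
  have h3 : Impl (Rᴴ * (ctrl U * R)) (0 + (δ + 0)) (1 + (7 * N + 1)) :=
    (hRi.star hRu).mul (hi.ctrl.mul hRi (norm_unitary hRu).le)
    (norm_unitary (mul_mem_unitary (ctrl_mem_unitary hU) hRu)).le
  refine (BE.of_ket (a := a + 1) ((Option.some_injective _).comp Sum.inr_injective :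
    Injective ((some : T ⊕ S → _) ∘ (Sum.inr : S → T ⊕ S))) ?_
    (mul_mem_unitary hRs (mul_mem_unitary (ctrl_mem_unitary hU) hRu)) h3 ?_).mono (by simp) le_rfl
    (by linarith)
  · rw [Fintype.card_option, Fintype.card_sum]; push_cast; linarith
  rw [compress_comp Sum.inr_injective (Option.some_injective _)]
  have hP : ∀ b, (ctrlProj b : Op (Option (T ⊕ S))) = QSim.emb (fun _ : Unit => none)
      (diagonal fun x => if x () = b then 1 else 0) := fun b => by
    rw [emb_diagonal]; rfl
  have hcomm : QSim.emb some U * R = R * QSim.emb some U :=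
    emb_mul_emb_comm (Option.some_injective _) unit_none_injective (by simp) _ _
  have hc : ∀ b, QSim.compress some (Rᴴ * (ctrlProj b * R)) =
      (if b then (p : ℂ) else ((1 - p : ℝ) : ℂ)) • (1 : Op (T ⊕ S)) := fun b => by
    rw [hP, hR, ← emb_conjTranspose, ← emb_mul unit_none_injective,
      ← emb_mul unit_none_injective, compress_emb_none]
    congr 1
    rw [Matrix.mul_apply, sum_unit_bool]
    simp only [diagonal_mul, conjTranspose_apply, QSim.rot]
    cases b
    · simp only [Bool.cond_false, Bool.cond_true, if_true, Bool.true_eq_false, if_false, one_mul,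
        zero_mul, mul_zero, add_zero, hz, RCLike.star_def, Complex.conj_ofReal, Bool.false_eq_true]
      rw [← Complex.ofReal_mul, Real.mul_self_sqrt (by linarith)]
    · simp only [Bool.cond_false, Bool.cond_true, if_true, Bool.false_eq_true, if_false, one_mul,
        zero_mul, mul_zero, zero_add, hw, RCLike.star_def, Complex.conj_ofReal]
      rw [← Complex.ofReal_mul, Real.mul_self_sqrt h0]
  have key : Rᴴ * (ctrl U * R) = Rᴴ * (ctrlProj false * R) +
      Rᴴ * (ctrlProj true * R) * QSim.emb some U := by
    rw [ctrl, Matrix.add_mul, Matrix.mul_add, Matrix.mul_assoc (ctrlProj true), hcomm]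
    simp only [Matrix.mul_assoc]
  rw [key, compress_add, compress_mul_emb (Option.some_injective _), hc, hc, compress_add]
  simp only [Bool.false_eq_true, if_false, if_true, Matrix.smul_mul, Matrix.one_mul]
  congr 1
  · rw [← compress_emb (Sum.inr_injective : Injective (Sum.inr : S → T ⊕ S)) (1 : Op S), emb_one]
    ext x y; simp [compress_apply]
  · ext x y; simp [compress_apply]

theorem neg_one_mem_unitary : (-1 : Op S) ∈ unitary (Op S) :=
  mem_unitary_of_conjTranspose_mul_self (by simp)

/-- A global sign counts as one gate, with empty support. -/
theorem Impl.neg_one : Impl (-1 : Op S) 0 1 := by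
  have h := Impl.gate (fun k : Empty => k.elim) (fun k => k.elim) (by simp)
    (neg_one_mem_unitary (S := Empty)) (S := S)
  have : QSim.emb (fun k : Empty => (k.elim : S)) (-1 : Op Empty) = -1 := by
    rw [← neg_one_smul ℂ (1 : Op Empty), emb_smul, emb_one, neg_one_smul]
  rwa [this] at h

/-- On zero ancillas, `-W R W† R W` acts as `D` plus an error proportional to `1 - D† D`. If `D`,
twice the encoded operator, were exactly unitary, the ancillas would return to zero and `D` would be
applied exactly. -/
theorem amplify_mul_ket {f : S → S'} (hf : Injective f) {W R : Op S'}
    (hW : W ∈ unitary (Op S')) (hR : R = 1 - (2 : ℂ) • (ket f * (ket f)ᴴ)) {D : Op S}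
    (hD : D = (2 : ℂ) • QSim.compress f W) :
    -1 * (W * (R * (Wᴴ * (R * W)))) * ket f = W * ket f * (1 - Dᴴ * D) + ket f * D := by
  obtain ⟨h1, h2⟩ := Unitary.mem_iff.1 hW
  rw [star_eq_conjTranspose] at h1 h2
  have hZ := ket_conjTranspose_mul_self hf
  set Z := ket f
  have hA : (2 : ℂ) • (Zᴴ * (W * Z)) = D := by rw [hD, QSim.compress, Matrix.mul_assoc]
  have hA' : (2 : ℂ) • (Zᴴ * (Wᴴ * Z)) = Dᴴ := by
    rw [← hA, conjTranspose_smul, conjTranspose_mul, conjTranspose_mul, conjTranspose_conjTranspose,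
      Matrix.mul_assoc]
    simp
  have hRM : ∀ M : Matrix (S' → Bool) (S → Bool) ℂ, R * M = M - Z * ((2 : ℂ) • (Zᴴ * M)) := by
    intro M
    rw [hR, Matrix.sub_mul, Matrix.one_mul, Matrix.smul_mul, Matrix.mul_smul, Matrix.mul_assoc]
  have s1 : R * (W * Z) = W * Z - Z * D := by rw [hRM, hA]
  have s2 : Wᴴ * (R * (W * Z)) = Z - Wᴴ * (Z * D) := by
    rw [s1, Matrix.mul_sub, ← Matrix.mul_assoc, h1, Matrix.one_mul]
  have s3 : R * (Wᴴ * (R * (W * Z))) = -Z - Wᴴ * (Z * D) + Z * (Dᴴ * D) := by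
    rw [s2, hRM, Matrix.mul_sub, smul_sub, hZ]
    have : (2 : ℂ) • (Zᴴ * (Wᴴ * (Z * D))) = Dᴴ * D := by
      rw [← hA', Matrix.smul_mul]; simp only [Matrix.mul_assoc]
    rw [this, Matrix.mul_sub, Matrix.mul_smul, Matrix.mul_one, two_smul]
    abel
  have s4 : W * (R * (Wᴴ * (R * (W * Z)))) = -(W * Z) - Z * D + W * (Z * (Dᴴ * D)) := by
    rw [s3, Matrix.mul_add, Matrix.mul_sub, Matrix.mul_neg, ← Matrix.mul_assoc W Wᴴ, h2,
      Matrix.one_mul]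
  simp only [Matrix.mul_assoc] at s4 ⊢
  rw [s4, Matrix.mul_sub, Matrix.mul_sub, Matrix.neg_mul, Matrix.one_mul, Matrix.mul_one]
  abel

/-- Expanding around the unitary `V` gives `2η + η²`, which is at most `3η` for `η ≤ 1`. -/
theorem norm_one_sub_conjTranspose_mul_le {D V : Op S} (hV : V ∈ unitary (Op S)) {η : ℝ}
    (hη : ‖D - V‖ ≤ η) (hη1 : η ≤ 1) : ‖1 - Dᴴ * D‖ ≤ 3 * η := by
  have hVV : Vᴴ * V = 1 := (Unitary.mem_iff.1 hV).1
  have h0 := norm_nonneg (D - V)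
  have : 1 - Dᴴ * D = -(Vᴴ * (D - V) + (D - V)ᴴ * V + (D - V)ᴴ * (D - V)) := by
    rw [conjTranspose_sub]
    simp only [Matrix.sub_mul, Matrix.mul_sub, hVV]
    abel
  rw [this, norm_neg]
  have a1 := l2_opNorm_mul Vᴴ (D - V)
  have a2 := l2_opNorm_mul (D - V)ᴴ V
  have a3 := l2_opNorm_mul (D - V)ᴴ (D - V)
  rw [l2_opNorm_conjTranspose, norm_unitary hV, one_mul] at a1
  rw [l2_opNorm_conjTranspose, norm_unitary hV, mul_one] at a2
  rw [l2_opNorm_conjTranspose] at a3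
  have a4 := norm_add_le (Vᴴ * (D - V) + (D - V)ᴴ * V) ((D - V)ᴴ * (D - V))
  have a5 := norm_add_le (Vᴴ * (D - V)) ((D - V)ᴴ * V)
  nlinarith

theorem norm_amplify_sub_le {f : S → S'} (hf : Injective f) {W R : Op S'}
    (hW : W ∈ unitary (Op S')) (hR : R = 1 - (2 : ℂ) • (ket f * (ket f)ᴴ)) {V : Op S}
    (hV : V ∈ unitary (Op S)) {η : ℝ} (hη : ‖(2 : ℂ) • QSim.compress f W - V‖ ≤ η) (hη1 : η ≤ 1) :
    ‖-1 * (W * (R * (Wᴴ * (R * W)))) * ket f - ket f * V‖ ≤ 4 * η := by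
  rw [amplify_mul_ket hf hW hR rfl]
  set D := (2 : ℂ) • QSim.compress f W
  have h1 := norm_one_sub_conjTranspose_mul_le hV hη hη1
  have h2 : ‖ket f * (D - V)‖ ≤ ‖D - V‖ := norm_ket_mul_le hf _
  have h3 : ‖W * ket f * (1 - Dᴴ * D)‖ ≤ ‖1 - Dᴴ * D‖ := by
    rw [Matrix.mul_assoc]
    refine (l2_opNorm_mul _ _).trans ?_
    rw [norm_unitary hW, one_mul]
    exact norm_ket_mul_le hf _
  have h4 : W * ket f * (1 - Dᴴ * D) + ket f * D - ket f * V =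
      W * ket f * (1 - Dᴴ * D) + ket f * (D - V) := by
    rw [Matrix.mul_sub (ket f)]; abel
  rw [h4]
  have h5 := norm_add_le (W * ket f * (1 - Dᴴ * D)) (ket f * (D - V))
  linarith

theorem Impl.amplify {W R : Op S} {δ N N' : ℝ} (hW : W ∈ unitary (Op S)) (hR : R ∈ unitary (Op S))
    (hWi : Impl W δ N) (hRi : Impl R 0 N') :
    Impl (-1 * (W * (R * (Wᴴ * (R * W))))) (3 * δ) (3 * N + 2 * N' + 1) := by
  have hWs : Wᴴ ∈ unitary (Op S) := Unitary.star_mem hW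
  have u1 : R * W ∈ unitary (Op S) := mul_mem_unitary hR hW
  have u2 : Wᴴ * (R * W) ∈ unitary (Op S) := mul_mem_unitary hWs u1
  have u3 : R * (Wᴴ * (R * W)) ∈ unitary (Op S) := mul_mem_unitary hR u2
  have u4 : W * (R * (Wᴴ * (R * W))) ∈ unitary (Op S) := mul_mem_unitary hW u3
  have i1 : Impl (R * W) (0 + δ) (N' + N) := hRi.mul hWi (norm_unitary hW).le
  have i2 : Impl (Wᴴ * (R * W)) (δ + (0 + δ)) (N + (N' + N)) :=
    (hWi.star hW).mul i1 (norm_unitary u1).le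
  have i3 : Impl (R * (Wᴴ * (R * W))) (0 + (δ + (0 + δ))) (N' + (N + (N' + N))) :=
    hRi.mul i2 (norm_unitary u2).le
  have i4 : Impl (W * (R * (Wᴴ * (R * W)))) (δ + (0 + (δ + (0 + δ)))) (N + (N' + (N + (N' + N)))) :=
    hWi.mul i3 (norm_unitary u3).le
  have i5 : Impl (-1 * (W * (R * (Wᴴ * (R * W))))) (0 + (δ + (0 + (δ + (0 + δ)))))
    (1 + (N + (N' + (N + (N' + N))))) := Impl.mul Impl.neg_one i4 (norm_unitary u4).le
  exact Impl.mono i5 (by linarith) (by linarith)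

theorem reflection_mem_unitary (l : List S) : (diagonal fun x : S → Bool =>
    if ∀ s ∈ l, x s = false then (-1 : ℂ) else 1 : Op S) ∈ unitary (Op S) := by
  refine diagonal_mem_unitary fun x => ?_
  by_cases hx : ∀ s ∈ l, x s = false
  · rw [if_pos hx, norm_neg, norm_one]
  · rw [if_neg hx, norm_one]

theorem reflection_eq {f : S → S'} (hf : Injective f) {l : List S'}
    (hl : ∀ k, k ∈ l ↔ k ∉ Set.range f) : (diagonal fun x : S' → Bool =>
      if ∀ s ∈ l, x s = false then (-1 : ℂ) else 1 : Op S') =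
      1 - (2 : ℂ) • (ket f * (ket f)ᴴ) := by
  rw [ket_mul_conjTranspose_apply hf, ← diagonal_one, ← diagonal_smul, diagonal_sub]
  congr 1; funext x
  simp only [Pi.smul_apply, ← hl]
  split_ifs <;> norm_num

/-- Oblivious amplitude amplification of a block encoding of (almost) half a unitary. -/
theorem BE.amplify {X V : Op S} {δ a N η : ℝ} (h : BE X δ a N) (hV : V ∈ unitary (Op S))
    (hη : ‖(2 : ℂ) • X - V‖ ≤ η) (hη1 : η ≤ 1) :
    Impl V (3 * δ + 4 * η) (3 * N + 184 * a + 11) := by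
  obtain ⟨T, _, _, W, ha, hW, hi, rfl⟩ := h
  obtain ⟨l, hl⟩ : ∃ l : List (T ⊕ S), l = (Finset.univ : Finset T).toList.map Sum.inl := ⟨_, rfl⟩
  have hla : (l.length : ℝ) ≤ a := by
    rw [hl, List.length_map, Finset.length_toList, Finset.card_univ]; exact ha
  have hf : Injective (Sum.inr : S → T ⊕ S) := Sum.inr_injective
  have hmem : ∀ k, k ∈ l ↔ k ∉ Set.range (Sum.inr : S → T ⊕ S) := by
    rintro (k | k) <;> simp [hl]
  have h1 := norm_amplify_sub_le hf hW (reflection_eq hf hmem) hV hη hη1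
  have h2 := Impl.amplify hW (reflection_mem_unitary l) hi (Impl.reflection l)
  -- Three uses of `W` or its adjoint, two reflections of `92a + 5` gates, and one sign.
  exact Impl.mono (Impl.of_ket hf h2 h1) le_rfl (by linarith)

end BlockEncoding

end QSim
end

open scoped Matrix.Norms.L2Operator
noncomputable section
namespace QSim

set_option linter.unusedSectionVars false

open Matrix Function

/-! ### Operators on a clock register and a system -/

section OperatorMatrices

variable {S C : Type} [Fintype S] [DecidableEq S] [Fintype C] [DecidableEq C]

theorem sum_sum_bool (F : (C ⊕ S → Bool) → ℂ) :
    ∑ z, F z = ∑ a : C → Bool, ∑ b : S → Bool, F (Sum.elim a b) := by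
  rw [← Equiv.sum_comp (Equiv.sumArrowEquivProdArrow C S Bool).symm F, Fintype.sum_prod_type]
  rfl

/-- The operator on `C ⊕ S` given by a matrix of operators on `S`. -/
def opMatrix (G : (C → Bool) → (C → Bool) → Op S) : Op (C ⊕ S) :=
  fun x y => G (x ∘ Sum.inl) (y ∘ Sum.inl) (x ∘ Sum.inr) (y ∘ Sum.inr)

/-- The column of operators on `S`. -/
def opColumn (v : (C → Bool) → Op S) : Matrix (C ⊕ S → Bool) (S → Bool) ℂ :=
  fun x y => v (x ∘ Sum.inl) (x ∘ Sum.inr) y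

/-- The block-diagonal operator with blocks `E a`. -/
def clockOp (E : (C → Bool) → Op S) : Op (C ⊕ S) := opMatrix fun a b => if a = b then E a else 0

theorem opMatrix_mul (G H : (C → Bool) → (C → Bool) → Op S) :
    opMatrix G * opMatrix H = opMatrix fun a b => ∑ c, G a c * H c b := by
  ext x y
  rw [Matrix.mul_apply, sum_sum_bool]
  simp only [opMatrix, Matrix.sum_apply, Matrix.mul_apply]
  rfl

theorem opMatrix_mul_opColumn (G : (C → Bool) → (C → Bool) → Op S) (v : (C → Bool) → Op S) :
    opMatrix G * opColumn v = opColumn fun a => ∑ b, G a b * v b := by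
  ext x y
  rw [Matrix.mul_apply, sum_sum_bool]
  simp only [opMatrix, opColumn, Matrix.sum_apply, Matrix.mul_apply]
  rfl

theorem conjTranspose_opColumn_mul (w v : (C → Bool) → Op S) :
    (opColumn w)ᴴ * opColumn v = ∑ a, (w a)ᴴ * v a := by
  ext x y
  rw [Matrix.mul_apply, sum_sum_bool]
  simp only [opColumn, Matrix.sum_apply, Matrix.mul_apply, conjTranspose_apply]
  rfl

theorem clockOp_mul_opColumn (E v : (C → Bool) → Op S) :
    clockOp E * opColumn v = opColumn fun a => E a * v a := by
  rw [clockOp, opMatrix_mul_opColumn]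
  congr 1; funext a
  simp [ite_mul]

theorem clockOp_mul (E F : (C → Bool) → Op S) :
    clockOp E * clockOp F = clockOp fun a => E a * F a := by
  rw [clockOp, clockOp, opMatrix_mul, clockOp]
  congr 1; funext a b
  rw [Finset.sum_eq_single a]
  · by_cases h : a = b <;> simp [h]
  · intro c _ hc; rw [if_neg (fun h => hc h.symm), Matrix.zero_mul]
  · simp

theorem elim_comp_eq (x y : C ⊕ S → Bool) (h1 : x ∘ Sum.inl = y ∘ Sum.inl)
    (h2 : x ∘ Sum.inr = y ∘ Sum.inr) : x = y := by
  funext k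
  cases k with
  | inl k => exact congrFun h1 k
  | inr k => exact congrFun h2 k

theorem agreeOff_inr {x y : C ⊕ S → Bool} :
    AgreeOff (Sum.inr : S → C ⊕ S) x y ↔ x ∘ Sum.inl = y ∘ Sum.inl := by
  constructor
  · intro h; funext k; exact h (Sum.inl k) (by simp)
  · rintro h (k | k) hk
    · exact congrFun h k
    · exact (hk ⟨k, rfl⟩).elim

theorem agreeOff_inl {x y : C ⊕ S → Bool} :
    AgreeOff (Sum.inl : C → C ⊕ S) x y ↔ x ∘ Sum.inr = y ∘ Sum.inr := by
  constructor
  · intro h; funext k; exact h (Sum.inr k) (by simp)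
  · rintro h (k | k) hk
    · exact (hk ⟨k, rfl⟩).elim
    · exact congrFun h k

theorem emb_inr_eq_clockOp (B : Op S) : emb (Sum.inr : S → C ⊕ S) B = clockOp fun _ => B := by
  ext x y
  simp only [emb, clockOp, opMatrix, agreeOff_inr]
  by_cases h : x ∘ Sum.inl = y ∘ Sum.inl <;> simp [h]

theorem emb_inl_eq_opMatrix (T : Op C) :
    emb (Sum.inl : C → C ⊕ S) T = opMatrix fun a b => T a b • (1 : Op S) := by
  ext x y
  simp only [emb, opMatrix, agreeOff_inl, Matrix.smul_apply, Matrix.one_apply]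
  by_cases h : x ∘ Sum.inr = y ∘ Sum.inr <;> simp [h]

theorem extZero_inr (w : S → Bool) :
    extZero (Sum.inr : S → C ⊕ S) w = Sum.elim (fun _ => false) w := by
  symm
  rw [eq_extZero_iff Sum.inr_injective]
  refine ⟨?_, by funext s; rfl⟩
  rintro (k | k) hk
  · rfl
  · exact (hk ⟨k, rfl⟩).elim

theorem ket_inr_eq_opColumn : ket (Sum.inr : S → C ⊕ S) =
    opColumn fun a => if a = fun _ => false then 1 else 0 := by
  ext x y
  simp only [ket, fnMatrix, extZero_inr, opColumn]
  by_cases h : x = Sum.elim (fun _ => false) y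
  · subst h
    have h1 : (Sum.elim (fun _ => false) y : C ⊕ S → Bool) ∘ Sum.inl = fun _ => false := rfl
    have h2 : (Sum.elim (fun _ => false) y : C ⊕ S → Bool) ∘ Sum.inr = y := rfl
    rw [h1, if_pos rfl, if_pos rfl, h2, Matrix.one_apply_eq]
  · rw [if_neg h]
    split_ifs with h1
    · rw [Matrix.one_apply, if_neg]
      intro h2
      exact h (elim_comp_eq _ _ h1 h2)
    · rfl

theorem emb_inl_mul_ket_inr (W : Op C) : emb (Sum.inl : C → C ⊕ S) W * ket (Sum.inr : S → C ⊕ S) =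
    opColumn fun a => W a (fun _ => false) • 1 := by
  rw [emb_inl_eq_opMatrix, ket_inr_eq_opColumn, opMatrix_mul_opColumn]
  congr 1; funext a
  simp [mul_ite]

theorem clockOp_conjTranspose (E : (C → Bool) → Op S) :
    (clockOp E)ᴴ = clockOp fun a => (E a)ᴴ := by
  ext x y
  simp only [clockOp, opMatrix, conjTranspose_apply]
  by_cases h : x ∘ Sum.inl = y ∘ Sum.inl
  · simp [h]
  · rw [if_neg h, if_neg (fun h' => h h'.symm)]; simp

theorem clockOp_one : clockOp (fun _ : C → Bool => (1 : Op S)) = 1 := by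
  rw [← emb_inr_eq_clockOp, emb_one]

theorem clockOp_mem_unitary {E : (C → Bool) → Op S} (h : ∀ a, E a ∈ unitary (Op S)) :
    clockOp E ∈ unitary (Op (C ⊕ S)) := by
  refine mem_unitary_of_conjTranspose_mul_self ?_
  rw [clockOp_conjTranspose, clockOp_mul, ← clockOp_one]
  congr 1; funext a
  exact (Unitary.mem_iff.1 (h a)).1

theorem emb_ctrl_eq_clockOp (j : C) (U : Op S) :
    emb (fun k : Option S => k.elim (Sum.inl j) Sum.inr : Option S → C ⊕ S) (ctrl U) =
      clockOp fun a => if a j then U else 1 := by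
  have hi : Injective (fun k : Option S => k.elim (Sum.inl j) Sum.inr : Option S → C ⊕ S) := by
    rintro (_ | a) (_ | b) h <;> simp_all
  have hs : (fun k : Option S => k.elim (Sum.inl j) Sum.inr : Option S → C ⊕ S) ∘ some =
    Sum.inr := rfl
  rw [ctrl, emb_add, emb_mul hi, ctrlProj, ctrlProj, emb_diagonal, emb_diagonal, emb_emb hi, hs,
    emb_inr_eq_clockOp]
  ext x y
  simp only [Matrix.add_apply, diagonal_mul, diagonal_apply, clockOp, opMatrix,
    Function.comp_apply, Option.elim_none]
  by_cases h : x ∘ Sum.inl = y ∘ Sum.inl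
  · have h1 : x = y ↔ x ∘ Sum.inr = y ∘ Sum.inr :=
      ⟨fun h' => by rw [h'], fun h' => elim_comp_eq _ _ h h'⟩
    have h2 : x (Sum.inl j) = y (Sum.inl j) := congrFun h j
    simp only [h, if_true, h1, h2]
    cases y (Sum.inl j)
    · simp [Matrix.one_apply]
    · simp
  · have h1 : x ≠ y := fun h' => h (by rw [h'])
    simp [h, h1]

/-- A one-parameter group turns the sum over the set bits of the clock into a product, so each bit
controls one fixed evolution. -/
theorem Impl.clockOp_exp {E : ℝ → Op S} (hadd : ∀ x y, E (x + y) = E x * E y) (h0 : E 0 = 1)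
    (hu : ∀ x, E x ∈ unitary (Op S)) {θ δ N : C → ℝ} (h : ∀ j, Impl (E (θ j)) (δ j) (N j))
    (s : Finset C) : Impl (clockOp fun a => E (∑ j ∈ s, if a j then θ j else 0)) (∑ j ∈ s, δ j)
      (7 * ∑ j ∈ s, N j) := by
  induction s using Finset.induction_on with
  | empty => simpa [h0, clockOp_one] using Impl.one (S := C ⊕ S)
  | insert j s hj ih =>
    have hi : Injective (fun k : Option S => k.elim (Sum.inl j) Sum.inr : Option S → C ⊕ S) := by
      rintro (_ | a) (_ | b) h <;> simp_all
    have h1 := ((h j).ctrl).emb hi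
    rw [emb_ctrl_eq_clockOp] at h1
    have h2 := h1.mul ih (norm_unitary (clockOp_mem_unitary fun a => hu _)).le
    rw [clockOp_mul] at h2
    rw [Finset.sum_insert hj, Finset.sum_insert hj]
    refine Impl.mono ?_ le_rfl (by linarith : 7 * N j + 7 * ∑ j ∈ s, N j ≤ _)
    convert h2 using 2
    funext a
    rw [Finset.sum_insert hj, hadd]
    split_ifs <;> simp [h0]

end OperatorMatrices

/-! ### The clock: uniform states, swaps and time ordering -/

section Uniform

variable {C : Type} [Fintype C] [DecidableEq C]

theorem exists_uniform_on (s : Finset C) : ∃ W ∈ unitary (Op C), Impl W 0 s.card ∧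
    ∀ x, W x (fun _ => false) =
      if ∀ k, k ∉ s → x k = false then ((((Real.sqrt 2)⁻¹ ^ s.card : ℝ)) : ℂ) else 0 := by
  induction s using Finset.induction_on with
  | empty =>
    refine ⟨1, one_mem _, by simpa using Impl.one, fun x => ?_⟩
    rw [Matrix.one_apply]
    simp [funext_iff]
  | insert j s hj ih =>
    obtain ⟨W, hW, hi, hx⟩ := ih
    set r : ℂ := ((((Real.sqrt 2)⁻¹ : ℝ)) : ℂ) with hr
    have hn : ‖r‖ ^ 2 + ‖r‖ ^ 2 = 1 := by
      rw [hr, Complex.norm_real, Real.norm_eq_abs, sq_abs, inv_pow, Real.sq_sqrt (by norm_num)]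
      norm_num
    have hu := rot_mem_unitary hn
    have hf : Injective fun _ : Unit => j := fun _ _ _ => rfl
    have hg : Impl (emb (fun _ : Unit => j) (rot r r)) 0 1 := Impl.gate _ hf (by simp) hu
    refine ⟨emb (fun _ : Unit => j) (rot r r) * W, mul_mem_unitary (emb_mem_unitary hf hu) hW,
      (hg.mul_zero hi hW).mono le_rfl ?_, fun x => ?_⟩
    · rw [Finset.card_insert_of_notMem hj]; push_cast; linarith
    rw [emb_mul_apply hf, sum_unit_bool]
    have hext : ∀ b : Bool, extend (fun _ : Unit => j) (fun _ => b) x = update x j b := by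
      intro b; funext k
      by_cases hk : k = j
      · subst hk; simp [hf.extend_apply (fun _ => b) x ()]
      · rw [update_of_ne hk, extend_of_notMem_range]
        rintro ⟨u, hu⟩; exact hk hu.symm
    -- Before its own rotation qubit `j` is still zero, so only one of the two terms survives.
    have h1 : W (update x j true) (fun _ => false) = 0 := by
      rw [hx, if_neg]
      intro h
      simpa using h j hj
    have h2 : (∀ k, k ∉ s → update x j false k = false) ↔ ∀ k, k ∉ insert j s → x k = false := by
      refine forall_congr' fun k => ?_
      by_cases hk : k = j
      · subst hk; simp
      · simp [hk]
    have h3 : rot r r (x ∘ fun _ : Unit => j) (fun _ => false) = r := by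
      simp only [rot]; cases (x ∘ fun _ : Unit => j) () <;> rfl
    rw [hext, hext, h1, mul_zero, add_zero, h3, hx]
    simp only [h2]
    rw [Finset.card_insert_of_notMem hj, mul_ite, mul_zero, hr, ← Complex.ofReal_mul, ← pow_succ']

variable (C) in
theorem exists_uniform : ∃ W ∈ unitary (Op C), Impl W 0 (Fintype.card C) ∧
    ∀ x, W x (fun _ => false) = ((((Real.sqrt 2)⁻¹ ^ Fintype.card C : ℝ)) : ℂ) := by
  obtain ⟨W, hW, hi, hx⟩ := exists_uniform_on (Finset.univ : Finset C)
  exact ⟨W, hW, hi, fun x => by rw [hx, if_pos (by simp)]; rfl⟩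

theorem uniform_mul_self (n : ℕ) : ((((Real.sqrt 2)⁻¹ ^ n : ℝ)) : ℂ) *
    ((((Real.sqrt 2)⁻¹ ^ n : ℝ)) : ℂ) = ((2 : ℂ) ^ n)⁻¹ := by
  rw [← Complex.ofReal_mul, ← mul_pow, ← mul_inv, Real.mul_self_sqrt (by norm_num)]
  push_cast
  rw [inv_pow]

end Uniform

section Swap

variable {C : Type} [Fintype C] [DecidableEq C]

/-- The map that exchanges the bits `inl c` and `inr c` for `c ∈ s`. -/
def swapOn (s : Finset C) (x : C ⊕ C → Bool) : C ⊕ C → Bool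
  | Sum.inl c => if c ∈ s then x (Sum.inr c) else x (Sum.inl c)
  | Sum.inr c => if c ∈ s then x (Sum.inl c) else x (Sum.inr c)

theorem swapOn_involutive (s : Finset C) : Involutive (swapOn s) := fun x => by
  funext k; rcases k with c | c <;> simp only [swapOn] <;> split_ifs <;> rfl

theorem Impl.swapOn (s : Finset C) : Impl (fnMatrix (swapOn s)) 0 s.card := by
  induction s using Finset.induction_on with
  | empty =>
    have : (QSim.swapOn (∅ : Finset C)) = id := by
      funext x k; rcases k with c | c <;> rfl
    rw [this, fnMatrix_id]
    simpa using Impl.one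
  | insert j s hj ih =>
    let f : Bool → C ⊕ C := fun k => cond k (Sum.inr j) (Sum.inl j)
    have hf : Injective f := pair_injective (by simp)
    have hinj : Injective fun x : Bool → Bool => x ∘ Bool.not := fun x y h => by
      funext k
      have := congrFun h (!k)
      simpa using this
    have h := Impl.gate f hf (by simp) (fnMatrix_mem_unitary hinj)
    have h1 : QSim.emb f (fnMatrix fun x : Bool → Bool => x ∘ Bool.not) =
        fnMatrix (QSim.swapOn {j}) := by
      refine emb_fnMatrix (fun x => ?_) fun x s => ?_
      · rintro (c | c) hk
        · have : c ≠ j := by rintro rfl; exact hk ⟨false, rfl⟩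
          simp [QSim.swapOn, this]
        · have : c ≠ j := by rintro rfl; exact hk ⟨true, rfl⟩
          simp [QSim.swapOn, this]
      · cases s <;> simp [QSim.swapOn, f]
    rw [h1] at h
    have h2 := h.mul_zero ih (fnMatrix_mem_unitary (swapOn_involutive s).injective)
    rw [fnMatrix_mul_fnMatrix] at h2
    have h3 : QSim.swapOn {j} ∘ QSim.swapOn s = QSim.swapOn (insert j s) := by
      funext x k
      rcases k with c | c <;> by_cases hc : c = j
      · subst hc; simp [QSim.swapOn, hj]
      · simp [QSim.swapOn, hc]
      · subst hc; simp [QSim.swapOn, hj]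
      · simp [QSim.swapOn, hc]
    rw [h3] at h2
    refine h2.mono le_rfl ?_
    rw [Finset.card_insert_of_notMem hj]; push_cast; linarith

end Swap

section Clock

/-- The binary number with digits `x`, lowest first. -/
def clockVal {L : ℕ} (x : Fin L → Bool) : ℕ := ∑ i, if x i then 2 ^ (i : ℕ) else 0

theorem clockVal_succ {L : ℕ} (x : Fin (L + 1) → Bool) :
    clockVal x = clockVal (x ∘ Fin.castSucc) + if x (Fin.last L) then 2 ^ L else 0 := by
  simp [clockVal, Fin.sum_univ_castSucc]

theorem clockVal_lt {L : ℕ} (x : Fin L → Bool) : clockVal x < 2 ^ L := by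
  induction L with
  | zero => simp [clockVal]
  | succ L ih =>
    rw [clockVal_succ, pow_succ]
    have := ih (x ∘ Fin.castSucc)
    split_ifs <;> omega

/-- Induction on the most significant digit, which is processed last and overrides the lower ones
unless the two digits agree. -/
theorem cmp_eq_decide_lt {L : ℕ} (x y : Fin L → Bool) :
    (List.finRange L).foldl (fun c i => cmpStep c (x i) (y i)) false =
      decide (clockVal y < clockVal x) := by
  induction L with
  | zero => simp [clockVal]
  | succ L ih =>
    rw [List.finRange_succ_last, List.foldl_append, List.foldl_map]
    have h := ih (x ∘ Fin.castSucc) (y ∘ Fin.castSucc)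
    simp only [Function.comp_apply] at h
    rw [h, clockVal_succ x, clockVal_succ y]
    have hx := clockVal_lt (x ∘ Fin.castSucc)
    have hy := clockVal_lt (y ∘ Fin.castSucc)
    simp only [List.foldl_cons, List.foldl_nil, cmpStep]
    cases x (Fin.last L) <;> cases y (Fin.last L) <;> simp <;> omega

theorem clockVal_injective {L : ℕ} : Injective (clockVal : (Fin L → Bool) → ℕ) := by
  induction L with
  | zero => intro x y _; funext k; exact k.elim0
  | succ L ih =>
    intro x y h
    rw [clockVal_succ x, clockVal_succ y] at h
    have hx := clockVal_lt (x ∘ Fin.castSucc)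
    have hy := clockVal_lt (y ∘ Fin.castSucc)
    have h1 : x (Fin.last L) = y (Fin.last L) := by
      revert h
      cases x (Fin.last L) <;> cases y (Fin.last L) <;> simp <;> omega
    rw [h1, add_left_inj] at h
    have h2 := ih h
    funext k
    refine Fin.lastCases h1 (fun i => ?_) k
    exact congrFun h2 i

theorem image_clockVal (L : ℕ) :
    (Finset.univ : Finset (Fin L → Bool)).image clockVal = Finset.range (2 ^ L) := by
  refine Finset.eq_of_subset_of_card_le ?_ ?_
  · intro n hn
    obtain ⟨x, -, rfl⟩ := Finset.mem_image.1 hn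
    exact Finset.mem_range.2 (clockVal_lt x)
  · rw [Finset.card_image_of_injective _ clockVal_injective]
    simp

theorem sum_clockVal {M : Type} [AddCommMonoid M] (L : ℕ) (F : ℕ → M) :
    ∑ x : Fin L → Bool, F (clockVal x) = ∑ m ∈ Finset.range (2 ^ L), F m := by
  rw [← image_clockVal, Finset.sum_image clockVal_injective.injOn]

/-- The strictly lower triangular matrix with entries `2⁻ᴸ`. -/
def shiftOp (L : ℕ) : Op (Fin L) :=
  fun x y => if clockVal y < clockVal x then ((2 : ℂ) ^ L)⁻¹ else 0

theorem emb_mul_ket_apply {L : ℕ} (W : Op (Fin L)) (z : Option (Fin L ⊕ Fin L) → Bool)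
    (y : Fin L → Bool) :
    (emb (some ∘ Sum.inl : Fin L → Option (Fin L ⊕ Fin L)) W *
      ket (some ∘ Sum.inr : Fin L → Option (Fin L ⊕ Fin L))) z y =
      if z none = false ∧ z ∘ (some ∘ Sum.inr) = y then W (z ∘ (some ∘ Sum.inl)) (fun _ => false)
      else 0 := by
  have hg : Injective (some ∘ Sum.inl : Fin L → Option (Fin L ⊕ Fin L)) :=
    (Option.some_injective _).comp Sum.inl_injective
  have hf : Injective (some ∘ Sum.inr : Fin L → Option (Fin L ⊕ Fin L)) :=
    (Option.some_injective _).comp Sum.inr_injective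
  rw [emb_mul_apply hg]
  have hiff : ∀ w : Fin L → Bool, extend (some ∘ Sum.inl : Fin L → Option (Fin L ⊕ Fin L)) w z =
      extZero (some ∘ Sum.inr) y ↔
        w = (fun _ => false) ∧ z none = false ∧ z ∘ (some ∘ Sum.inr) = y := by
    intro w
    have hn : extend (some ∘ Sum.inl : Fin L → Option (Fin L ⊕ Fin L)) w z none = z none :=
      extend_of_notMem_range _ _ (by simp)
    have hr : ∀ i, extend (some ∘ Sum.inl : Fin L → Option (Fin L ⊕ Fin L)) w z
        (some (Sum.inr i)) = z (some (Sum.inr i)) := fun i =>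
      extend_of_notMem_range _ _ (by simp)
    have hl : ∀ i, extend (some ∘ Sum.inl : Fin L → Option (Fin L ⊕ Fin L)) w z
        (some (Sum.inl i)) = w i := fun i => hg.extend_apply w z i
    rw [eq_extZero_iff hf]
    constructor
    · rintro ⟨h1, h2⟩
      refine ⟨?_, ?_, ?_⟩
      · funext i; rw [← hl i]; exact h1 _ (by simp)
      · rw [← hn]; exact h1 _ (by simp)
      · rw [← h2]; funext i; exact (hr i).symm
    · rintro ⟨h1, h2, h3⟩
      refine ⟨?_, ?_⟩
      · rintro (_ | i | i) hk
        · rw [hn, h2]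
        · rw [hl, h1]
        · exact (hk ⟨i, rfl⟩).elim
      · rw [← h3]; funext i; exact hr i
  simp only [ket, fnMatrix, hiff]
  rw [Finset.sum_eq_single (fun _ => false)]
  · simp
  · intro w _ hw; simp [hw]
  · simp

/-- Besides the input `y`, prepare a second register in the uniform superposition of all `m`. Flip a
flag unless `y < m`, swap the registers, and undo the uniform preparation. The amplitude for output
`m` with all ancillas zero is `2^{-L/2} · 2^{-L/2}` if `y < m` and zero otherwise. Two preparations,
a swap, a NOT and a comparison cost `L + L + L + 1 + (46L + 1)` gates. -/
theorem BE.shiftOp (L : ℕ) : BE (shiftOp L) 0 (L + 1) (49 * L + 2) := by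
  let Q := Option (Fin L ⊕ Fin L)
  let f : Fin L → Q := some ∘ Sum.inr
  let g : Fin L → Q := some ∘ Sum.inl
  have hf : Injective f := (Option.some_injective _).comp Sum.inr_injective
  have hg : Injective g := (Option.some_injective _).comp Sum.inl_injective
  obtain ⟨W, hW, hWi, hW0⟩ := exists_uniform (Fin L)
  let l : List (Q × Q) := (List.finRange L).map fun i => (g i, f i)
  have hlq : ∀ ab ∈ l, ab.1 ≠ (none : Q) ∧ ab.2 ≠ (none : Q) := by
    intro ab hab
    obtain ⟨i, hi, rfl⟩ := List.mem_map.1 hab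
    simp [f, g]
  have hc := Impl.cmp_false l hlq
  have ic : IndepOf (none : Q) fun x => QSim.cmp false l x := fun x b => by
    have := cmp_congr false l (x := x) (y := update x none b) id fun ab hab => by
      simp [hlq ab hab]
    simpa using this
  have hXc := Impl.xor (ψ := fun x => QSim.cmp false l x) (fun _ _ => rfl) ic (Impl.not (none : Q)) hc
  have iXc : IndepOf (none : Q) fun x => QSim.cmp false l x ^^ true := fun x b => by
    simp only [ic x b]
  have hs := (Impl.swapOn (Finset.univ : Finset (Fin L))).emb (Option.some_injective _)
  let σ : (Q → Bool) → Q → Bool := fun x k => k.elim (x none) (swapOn Finset.univ (x ∘ some))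
  have hσ : QSim.emb (some : _ → Q) (fnMatrix (swapOn (Finset.univ : Finset (Fin L)))) =
      fnMatrix σ := by
    refine emb_fnMatrix (fun x => ?_) fun x s => rfl
    rintro (_ | k) hk
    · rfl
    · exact (hk ⟨k, rfl⟩).elim
  rw [hσ] at hs
  have hσi : Involutive σ := fun x => by
    funext k
    obtain _ | k := k
    · rfl
    · exact congrFun (swapOn_involutive Finset.univ (x ∘ some)) k
  have hl : l.length = L := by simp [l]
  have hgW := emb_mem_unitary hg hW
  have uσ := fnMatrix_mem_unitary hσi.injective
  have uX := xorOp_mem_unitary iXc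
  have hh := ((hWi.emb hg).star hgW).mul_zero ((hs.mul_zero hXc uX).mul_zero (hWi.emb hg) hgW)
    (mul_mem_unitary (mul_mem_unitary uσ uX) hgW)
  refine (BE.of_ket hf (a := L + 1) ?_ (mul_mem_unitary (Unitary.star_mem hgW)
    (mul_mem_unitary (mul_mem_unitary uσ uX) hgW)) hh ?_).mono le_rfl le_rfl ?_
  · simp only [Q, Fintype.card_option, Fintype.card_sum, Fintype.card_fin]; push_cast; linarith
  swap
  · rw [hl]; simp only [Fintype.card_fin, Finset.card_univ]; linarith
  let τ : (Q → Bool) → Q → Bool := σ ∘ xorFn none fun x => QSim.cmp false l x ^^ true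
  have h1 : QSim.compress f ((QSim.emb g W)ᴴ * (fnMatrix σ *
      xorOp none (fun x => QSim.cmp false l x ^^ true) * QSim.emb g W)) =
      (QSim.emb g W * ket f)ᴴ * fnMatrix τ * (QSim.emb g W * ket f) := by
    rw [xorOp, fnMatrix_mul_fnMatrix, QSim.compress, conjTranspose_mul]
    simp only [Matrix.mul_assoc]
    rfl
  refine h1.trans ?_
  ext x y
  rw [Matrix.mul_apply]
  simp only [mul_fnMatrix, submatrix_apply, conjTranspose_apply, id]
  have hV : ∀ z y, (QSim.emb g W * ket f) z y = if z none = false ∧ z ∘ f = y then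
      ((((Real.sqrt 2)⁻¹ ^ L : ℝ)) : ℂ) else 0 := fun z y => by
    have := emb_mul_ket_apply W z y
    rw [hW0, Fintype.card_fin] at this
    exact this
  simp only [hV]
  have hcmp : ∀ z : Q → Bool, QSim.cmp false l z = decide (clockVal (z ∘ f) < clockVal (z ∘ g)) := by
    intro z
    rw [← cmp_eq_decide_lt, QSim.cmp, List.foldl_map]; rfl
  have hτn : ∀ z, τ z none = (z none ^^ (decide (clockVal (z ∘ f) < clockVal (z ∘ g)) ^^ true)) := by
    intro z
    simp only [τ, σ, Function.comp_apply, Option.elim_none, xorFn_same, hcmp]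
  have hτf : ∀ z, τ z ∘ f = z ∘ g := by
    intro z
    funext i
    simp [τ, σ, f, g, swapOn, xorFn]
  simp only [hτn, hτf, QSim.shiftOp]
  let z₀ : Q → Bool := fun k => k.elim false (Sum.elim x y)
  have hz₀f : z₀ ∘ f = y := rfl
  have hz₀g : z₀ ∘ g = x := rfl
  rw [Finset.sum_eq_single z₀]
  · have : z₀ none = false := rfl
    rw [hz₀f, hz₀g, this]
    by_cases hlt : clockVal y < clockVal x
    · simp only [hlt, decide_true, Bool.xor_true, Bool.not_true, Bool.false_xor, and_self, if_true,
        RCLike.star_def, Complex.conj_ofReal, uniform_mul_self]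
    · simp [hlt]
  · intro z _ hz
    by_cases h2 : z none = false ∧ z ∘ f = y
    · by_cases h3 : z ∘ g = x
      · refine (hz ?_).elim
        funext k
        obtain _ | k | k := k
        · exact h2.1
        · exact congrFun h3 k
        · exact congrFun h2.2 k
      · simp [h3]
    · rw [if_neg h2, mul_zero]
  · simp

end Clock

end QSim
end

open scoped Matrix.Norms.L2Operator
noncomputable section
namespace QSim

set_option linter.unusedSectionVars false

open Matrix Function

/-! ### Second-order estimates for exponentials -/

section Exponential

theorem norm_exp_sub_one_sub_le {A : Type} [NormedRing A] [NormedAlgebra ℂ A] [CompleteSpace A]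
    {x : A} (hx : ‖x‖ ≤ 1) : ‖NormedSpace.exp x - 1 - x‖ ≤ ‖x‖ ^ 2 := by
  have h1 := NormedSpace.exp_series_hasSum_exp' (𝕂 := ℂ) x
  have h2 := NormedSpace.expSeries_div_hasSum_exp (𝔸 := ℝ) ‖x‖
  rw [← Real.exp_eq_exp_ℝ] at h2
  rw [← hasSum_nat_add_iff' 2] at h1 h2
  have h3 : ‖NormedSpace.exp x - ∑ i ∈ Finset.range 2, ((i.factorial : ℂ)⁻¹) • x ^ i‖ ≤
      Real.exp ‖x‖ - ∑ i ∈ Finset.range 2, ‖x‖ ^ i / i.factorial := by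
    rw [← h1.tsum_eq]
    refine tsum_of_norm_bounded h2 fun n => ?_
    rw [norm_smul, norm_inv, Complex.norm_natCast, div_eq_inv_mul]
    exact mul_le_mul_of_nonneg_left (norm_pow_le' x (by omega)) (by positivity)
  simp only [Finset.sum_range_succ, Finset.sum_range_zero, zero_add, Nat.factorial, Nat.cast_one,
    inv_one, one_smul, pow_zero, pow_one, div_one, mul_one] at h3
  have h4 : Real.exp ‖x‖ - 1 - ‖x‖ ≤ ‖x‖ ^ 2 := by
    have := Real.abs_exp_sub_one_sub_id_le (x := ‖x‖) (by rwa [abs_norm])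
    exact (le_abs_self _).trans this
  calc _ = ‖NormedSpace.exp x - (1 + x)‖ := by rw [sub_sub]
    _ ≤ _ := h3.trans (by linarith)

/-- Both terms equal `1 + x + y` up to quadratic remainders and the product `x y`. -/
theorem norm_exp_mul_sub_exp_add_le {A : Type} [NormedRing A] [NormedAlgebra ℂ A] [CompleteSpace A]
    {x y : A} {s : ℝ} (hs : ‖x‖ + ‖y‖ ≤ s) (hs1 : s ≤ 1) :
    ‖NormedSpace.exp x * (1 + y) - NormedSpace.exp (x + y)‖ ≤ 4 * s ^ 2 := by
  have hx0 := norm_nonneg x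
  have hy0 := norm_nonneg y
  have hxy : ‖x + y‖ ≤ s := (norm_add_le _ _).trans hs
  have h1 := norm_exp_sub_one_sub_le (x := x) (by linarith)
  have h2 := norm_exp_sub_one_sub_le (x := x + y) (by linarith)
  set r := NormedSpace.exp x - 1 - x with hr
  set q := NormedSpace.exp (x + y) - 1 - (x + y) with hq
  have : NormedSpace.exp x * (1 + y) - NormedSpace.exp (x + y) = x * y + (r + r * y) - q := by
    have e1 : NormedSpace.exp x = 1 + x + r := by rw [hr]; abel
    have e2 : NormedSpace.exp (x + y) = 1 + (x + y) + q := by rw [hq]; abel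
    rw [e1, e2]; noncomm_ring
  rw [this]
  have a1 := norm_sub_le (x * y + (r + r * y)) q
  have a2 := norm_add_le (x * y) (r + r * y)
  have a3 := norm_add_le r (r * y)
  have a4 := norm_mul_le x y
  have a5 := norm_mul_le r y
  have a6 : ‖x + y‖ ^ 2 ≤ s ^ 2 := by gcongr
  have a7 : ‖r‖ * ‖y‖ ≤ ‖x‖ ^ 2 := by nlinarith [norm_nonneg r]
  have a8 : (‖x‖ + ‖y‖) ^ 2 ≤ s ^ 2 := by gcongr
  nlinarith

/-- Telescoping sum. The factor `β ^ n` is needed because `X` will be a step `e^{-iAh}(1 - ihB)`,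
which is not a contraction. -/
theorem norm_pow_sub_pow_le {A : Type} [NormedRing A] [NormOneClass A] {X Y : A} {β d : ℝ}
    (hβ : 1 ≤ β) (hX : ‖X‖ ≤ β) (hY : ‖Y‖ ≤ 1) (hd : ‖X - Y‖ ≤ d) (n : ℕ) :
    ‖X ^ n - Y ^ n‖ ≤ n * β ^ n * d := by
  have hd0 : 0 ≤ d := (norm_nonneg _).trans hd
  induction n with
  | zero => simp
  | succ n ih =>
    have : X ^ (n + 1) - Y ^ (n + 1) = X * (X ^ n - Y ^ n) + (X - Y) * Y ^ n := by
      rw [pow_succ', pow_succ']; noncomm_ring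
    rw [this]
    have a1 := norm_add_le (X * (X ^ n - Y ^ n)) ((X - Y) * Y ^ n)
    have a2 : ‖X * (X ^ n - Y ^ n)‖ ≤ β * (n * β ^ n * d) :=
      (norm_mul_le _ _).trans (by gcongr)
    have hYn : ‖Y ^ n‖ ≤ 1 := (norm_pow_le _ _).trans (pow_le_one₀ (norm_nonneg _) hY)
    have a3 : ‖(X - Y) * Y ^ n‖ ≤ d * 1 := (norm_mul_le _ _).trans (by gcongr)
    have a4 : 1 ≤ β ^ (n + 1) := one_le_pow₀ hβ
    have a5 : d ≤ β ^ (n + 1) * d := by nlinarith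
    have a6 : β * (n * β ^ n * d) = n * β ^ (n + 1) * d := by rw [pow_succ]; ring
    push_cast
    nlinarith

end Exponential

/-! ### Discrete Dyson series -/

section Dyson

variable {A : Type} [NormedRing A] [NormOneClass A]

/-- The sum of the products `G mₖ ⋯ G m₁` over `m₁ < ⋯ < mₖ < n`. -/
def dyson (G : ℕ → A) : ℕ → ℕ → A
  | 0, _ => 1
  | k + 1, n => ∑ m ∈ Finset.range n, G m * dyson G k m

theorem dyson_succ_succ (G : ℕ → A) (k n : ℕ) :
    dyson G (k + 1) (n + 1) = dyson G (k + 1) n + G n * dyson G k n := by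
  simp only [dyson, Finset.sum_range_succ]

/-- There are `n.choose k` increasing sequences of `k` times below `n`. -/
theorem norm_dyson_le {G : ℕ → A} {b : ℝ} (hG : ∀ m, ‖G m‖ ≤ b) (k n : ℕ) :
    ‖dyson G k n‖ ≤ n.choose k * b ^ k := by
  have hb : 0 ≤ b := (norm_nonneg _).trans (hG 0)
  induction n generalizing k with
  | zero =>
    cases k with
    | zero => simp [dyson]
    | succ k => simp [dyson]
  | succ n ih =>
    cases k with
    | zero => simp [dyson]
    | succ k =>
      rw [dyson_succ_succ]
      have h1 : ‖G n * dyson G k n‖ ≤ b * (n.choose k * b ^ k) :=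
        (norm_mul_le _ _).trans (mul_le_mul (hG n) (ih k) (norm_nonneg _) hb)
      refine (norm_add_le _ _).trans ((add_le_add (ih _) h1).trans_eq ?_)
      rw [Nat.choose_succ_succ]; push_cast; ring

theorem dyson_eq_zero (G : ℕ → A) {k n : ℕ} (h : n < k) : dyson G k n = 0 := by
  induction n generalizing k with
  | zero =>
    cases k with
    | zero => simp at h
    | succ k => simp [dyson]
  | succ n ih =>
    cases k with
    | zero => simp at h
    | succ k => rw [dyson_succ_succ, ih (by omega), ih (by omega)]; simp

/-- Untruncated, the series is the expansion of the ordered product of the factors `1 + G m`. The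
hypothesis `n + 1 ≤ K` guarantees that no order is cut off. -/
theorem sum_dyson_succ (G : ℕ → A) {K n : ℕ} (h : n + 1 ≤ K) :
    ∑ k ∈ Finset.range (K + 1), dyson G k (n + 1) =
      (1 + G n) * ∑ k ∈ Finset.range (K + 1), dyson G k n := by
  rw [Finset.sum_range_succ', add_mul, one_mul]
  have h1 : ∑ k ∈ Finset.range (K + 1), dyson G k n = ∑ k ∈ Finset.range K, dyson G k n := by
    rw [Finset.sum_range_succ, dyson_eq_zero G (by omega : n < K), add_zero]
  conv_rhs => rw [h1, Finset.mul_sum, ← h1, Finset.sum_range_succ']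
  simp only [dyson_succ_succ, Finset.sum_add_distrib]
  simp only [dyson]
  abel

theorem choose_mul_pow_le {n k : ℕ} {b : ℝ} (hb : 0 ≤ b) :
    n.choose k * b ^ k ≤ (n * b) ^ k / k.factorial := by
  rw [mul_pow, mul_div_right_comm]
  gcongr
  exact Nat.choose_le_pow_div k n

/-- The tail of the Dyson series of total weight `z ≤ 1/2`. -/
theorem norm_sum_dyson_sub_le {G : ℕ → A} {b z : ℝ} (hG : ∀ m, ‖G m‖ ≤ b) {n K K' : ℕ}
    (hz : n * b ≤ z) (hz1 : z ≤ 1 / 2) (hK : K ≤ K') :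
    ‖∑ k ∈ Finset.range (K + 1), dyson G k n - ∑ k ∈ Finset.range (K' + 1), dyson G k n‖ ≤
      2 * z / K.factorial := by
  have hb : 0 ≤ b := (norm_nonneg _).trans (hG 0)
  have hz0 : 0 ≤ z := le_trans (by positivity) hz
  obtain ⟨J, rfl⟩ := Nat.exists_eq_add_of_le hK
  rw [show K + J + 1 = K + 1 + J by ring,
    Finset.sum_range_add (fun k => dyson G k n) (K + 1) J, sub_add_cancel_left, norm_neg]
  have hj : ∀ j, ‖dyson G (K + 1 + j) n‖ ≤ z / K.factorial * (1 / 2) ^ j := by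
    intro j
    refine (norm_dyson_le hG _ _).trans ((choose_mul_pow_le hb).trans ?_)
    have h1 : (n * b) ^ (K + 1 + j) ≤ z * (1 / 2) ^ j := by
      calc (n * b) ^ (K + 1 + j) ≤ z ^ (K + 1 + j) := by gcongr
        _ = z * z ^ K * z ^ j := by ring
        _ ≤ z * 1 * (1 / 2) ^ j := by
            gcongr
            exact pow_le_one₀ hz0 (by linarith)
        _ = _ := by ring
    have h2 : (K.factorial : ℝ) ≤ (K + 1 + j).factorial := by
      exact_mod_cast Nat.factorial_le (by omega)
    have h3 : (0 : ℝ) < K.factorial := by positivity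
    calc _ ≤ z * (1 / 2) ^ j / K.factorial := by gcongr
      _ = _ := by ring
  refine (norm_sum_le _ _).trans ((Finset.sum_le_sum fun j _ => hj j).trans ?_)
  rw [← Finset.mul_sum]
  have h4 : ∑ j ∈ Finset.range J, (1 / 2 : ℝ) ^ j ≤ 2 := by
    have := Summable.sum_le_tsum (Finset.range J) (fun j _ => by positivity) summable_geometric_two
    rwa [tsum_geometric_two] at this
  calc _ ≤ z / K.factorial * 2 := by gcongr
    _ = _ := by ring

end Dyson

/-! ### Error of the discretized interaction picture -/

section Evolution

variable {n : ℕ}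

theorem evolution_add (A : Op (Fin n)) (s t : ℝ) :
    evolution A (s + t) = evolution A s * evolution A t := by
  rw [evolution, evolution, evolution, ← Matrix.exp_add_of_commute]
  · rw [← add_smul]; congr 2; push_cast; ring
  · exact ((Commute.refl A).smul_left _).smul_right _

theorem evolution_zero (A : Op (Fin n)) : evolution A 0 = 1 := by
  simp [evolution]

theorem evolution_mem_unitary {A : Op (Fin n)} (hA : A.IsHermitian) (t : ℝ) :
    evolution A t ∈ unitary (Op (Fin n)) := by
  refine mem_unitary_of_conjTranspose_mul_self ?_
  have : (evolution A t)ᴴ = evolution A (-t) := by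
    rw [evolution, ← Matrix.exp_conjTranspose, conjTranspose_smul, hA.eq, evolution]
    congr 2
    simp
  rw [this, ← evolution_add, neg_add_cancel, evolution_zero]

theorem evolution_mul_conjTranspose {A : Op (Fin n)} (hA : A.IsHermitian) (t : ℝ) :
    evolution A t * (evolution A t)ᴴ = 1 := (Unitary.mem_iff.1 (evolution_mem_unitary hA t)).2

theorem evolution_nsmul (A : Op (Fin n)) (t : ℝ) (k : ℕ) :
    evolution A (k * t) = evolution A t ^ k := by
  induction k with
  | zero => simp [evolution_zero]
  | succ k ih => rw [pow_succ, ← ih, ← evolution_add]; congr 1; push_cast; ring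

/-- The interaction-picture Hamiltonian at time `h m`, times `-i h`. -/
def interaction (A B : Op (Fin n)) (h : ℝ) (m : ℕ) : Op (Fin n) :=
  (-(Complex.I * h)) • ((evolution A (m * h))ᴴ * B * evolution A (m * h))

theorem norm_interaction_le {A B : Op (Fin n)} (hA : A.IsHermitian) {b h : ℝ} (hB : ‖B‖ ≤ b)
    (hh : 0 ≤ h) (m : ℕ) : ‖interaction A B h m‖ ≤ h * b := by
  rw [interaction, norm_smul, norm_neg, norm_mul, Complex.norm_I, one_mul, Complex.norm_real,
    Real.norm_of_nonneg hh]
  gcongr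
  refine (l2_opNorm_mul _ _).trans ?_
  rw [norm_unitary (evolution_mem_unitary hA _), mul_one]
  refine (l2_opNorm_mul _ _).trans ?_
  rw [l2_opNorm_conjTranspose, norm_unitary (evolution_mem_unitary hA _), one_mul]
  exact hB

/-- Multiplication by `e^{-iAmh}` leaves the rotating frame: it turns the rotated `B` at time `mh`
into `B` itself, so each factor `1 + G m` becomes one step of the product formula. -/
theorem evolution_mul_sum_dyson {A B : Op (Fin n)} (hA : A.IsHermitian) (h : ℝ) {K m : ℕ}
    (hK : m ≤ K) : evolution A (m * h) *
      ∑ k ∈ Finset.range (K + 1), dyson (interaction A B h) k m =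
      (evolution A h * (1 + (-(Complex.I * h)) • B)) ^ m := by
  induction m with
  | zero =>
    rw [Finset.sum_range_succ']
    simp [dyson, evolution_zero]
  | succ m ih =>
    rw [sum_dyson_succ _ hK, pow_succ', ← ih (by omega)]
    have h1 : evolution A ((m + 1 : ℕ) * h) = evolution A h * evolution A (m * h) := by
      rw [← evolution_add]; congr 1; push_cast; ring
    have h2 : evolution A (m * h) * interaction A B h m =
        (-(Complex.I * h)) • B * evolution A (m * h) := by
      rw [interaction, Matrix.mul_smul, ← Matrix.mul_assoc, ← Matrix.mul_assoc,
        evolution_mul_conjTranspose hA, Matrix.one_mul, Matrix.smul_mul]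
    rw [h1, Matrix.mul_assoc, ← Matrix.mul_assoc (evolution A (m * h)), Matrix.mul_add, h2,
      Matrix.mul_one, Matrix.mul_assoc (evolution A h)]
    congr 1
    simp only [Matrix.add_mul, Matrix.one_mul, Matrix.mul_assoc]

theorem norm_step_sub_le {A B : Op (Fin n)} {a b h : ℝ} (hA : ‖A‖ ≤ a) (hB : ‖B‖ ≤ b)
    (hh : 0 ≤ h) (h1 : h * (a + b) ≤ 1) :
    ‖evolution A h * (1 + (-(Complex.I * h)) • B) - evolution (A + B) h‖ ≤
      4 * (h * (a + b)) ^ 2 := by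
  rw [evolution, evolution, smul_add]
  refine norm_exp_mul_sub_exp_add_le ?_ h1
  have : ‖(-(Complex.I * (h : ℂ)))‖ = h := by
    rw [norm_neg, norm_mul, Complex.norm_I, one_mul, Complex.norm_real, Real.norm_of_nonneg hh]
  rw [norm_smul, norm_smul, this]
  nlinarith

/-- The error of the truncated and discretized Dyson series. -/
theorem norm_evolution_mul_dyson_sub_le {A B : Op (Fin n)} (hA : A.IsHermitian)
    (hB : B.IsHermitian) {a b τ : ℝ} (ha : ‖A‖ ≤ a) (hb : ‖B‖ ≤ b) (hτ : 0 ≤ τ)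
    (hτb : b * τ ≤ 1 / 2) {K M : ℕ} (hM : 0 < M) (hMτ : τ * (a + b) ≤ M) :
    ‖evolution A τ * ∑ k ∈ Finset.range (K + 1), dyson (interaction A B (τ / M)) k M -
      evolution (A + B) τ‖ ≤ 2 * (b * τ) / K.factorial + 8 * (τ * (a + b)) ^ 2 / M := by
  have hM0 : (0 : ℝ) < M := by exact_mod_cast hM
  have hb0 : 0 ≤ b := (norm_nonneg _).trans hb
  have ha0 : 0 ≤ a := (norm_nonneg _).trans ha
  set h := τ / M with hh
  have hh0 : 0 ≤ h := by positivity
  have hMh : M * h = τ := by rw [hh]; field_simp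
  have h1 : h * (a + b) ≤ 1 := by
    rw [hh, div_mul_eq_mul_div, div_le_one hM0]; exact hMτ
  have h2 := norm_step_sub_le ha hb hh0 h1
  have hG := norm_interaction_le (B := B) hA hb hh0
  -- Orders up to `K + M` contain the full series on `M` times, so `h4` can identify the longer sum
  -- with a power.
  have h3 := norm_sum_dyson_sub_le hG (n := M) (K := K) (K' := K + M) (z := b * τ)
    (by rw [← mul_assoc, hMh, mul_comm]) hτb (by omega)
  have h4 := evolution_mul_sum_dyson (B := B) hA h (m := M) (K := K + M) (by omega)
  have h5 : evolution (A + B) τ = evolution (A + B) h ^ M := by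
    rw [← evolution_nsmul, hMh]
  have hX : ‖evolution A h * (1 + (-(Complex.I * h)) • B)‖ ≤ 1 + h * b := by
    refine (l2_opNorm_mul _ _).trans ?_
    rw [norm_unitary (evolution_mem_unitary hA _), one_mul]
    refine (norm_add_le _ _).trans ?_
    rw [norm_one, norm_smul, norm_neg, norm_mul, Complex.norm_I, one_mul, Complex.norm_real,
      Real.norm_of_nonneg hh0]
    gcongr
  have h6 := norm_pow_sub_pow_le (le_add_of_nonneg_right (by positivity : 0 ≤ h * b)) hX
    (norm_unitary (evolution_mem_unitary (hA.add hB) h)).le h2 M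
  -- The steps exceed norm one by at most `hb` each, in total by a factor at most `e^{bτ} ≤
  -- e^{1/2}`.
  have h7 : (1 + h * b) ^ M ≤ 2 := by
    have e1 : (1 + h * b) ^ M ≤ Real.exp (h * b) ^ M := by
      gcongr
      linarith [Real.add_one_le_exp (h * b)]
    have e2 : Real.exp (h * b) ^ M = Real.exp (b * τ) := by
      rw [← Real.exp_nat_mul, ← mul_assoc, hMh, mul_comm]
    have e3 : Real.exp (b * τ) ≤ Real.exp (1 / 2) := Real.exp_le_exp.2 hτb
    have e4 : Real.exp (1 / 2) ≤ 2 := by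
      have : Real.exp (1 / 2) ^ 2 ≤ 2 ^ 2 := by
        rw [← Real.exp_nat_mul]
        norm_num
        linarith [Real.exp_one_lt_d9]
      exact le_of_sq_le_sq this (by norm_num)
    linarith
  rw [hMh] at h4
  have key : evolution A τ * ∑ k ∈ Finset.range (K + 1), dyson (interaction A B h) k M -
      evolution (A + B) τ = evolution A τ *
        (∑ k ∈ Finset.range (K + 1), dyson (interaction A B h) k M -
          ∑ k ∈ Finset.range (K + M + 1), dyson (interaction A B h) k M) +
      ((evolution A h * (1 + (-(Complex.I * h)) • B)) ^ M - evolution (A + B) h ^ M) := by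
    rw [Matrix.mul_sub, h4, h5]; abel
  rw [key]
  refine (norm_add_le _ _).trans (add_le_add ?_ ?_)
  · refine (l2_opNorm_mul _ _).trans ?_
    rw [norm_unitary (evolution_mem_unitary hA _), one_mul]
    exact h3
  · refine h6.trans ?_
    calc _ ≤ (M : ℝ) * 2 * (4 * (h * (a + b)) ^ 2) := by gcongr
      _ = _ := by rw [hh]; field_simp; ring

end Evolution

end QSim
end


open scoped Matrix.Norms.L2Operator

noncomputable section

namespace QSim

set_option linter.unusedSectionVars false

open Matrix Function

/-! ### Geometric series of a block encoding -/

section Geometric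

theorem sum_range_two_pow_succ {A : Type} [Semiring A] (Z : A) (r : ℕ) :
    ∑ j ∈ Finset.range (2 ^ (r + 1)), Z ^ j =
      (∑ j ∈ Finset.range (2 ^ r), Z ^ j) * (1 + Z ^ 2 ^ r) := by
  rw [pow_succ, mul_two, Finset.sum_range_add, mul_add, mul_one, Finset.sum_mul]
  congr 1
  exact Finset.sum_congr rfl fun j _ => by rw [← pow_add, add_comm]

variable {S : Type} [Fintype S] [DecidableEq S]

theorem sum_pow_half_pos (r : ℕ) : 0 < ∑ j ∈ Finset.range (2 ^ r), (1 / 2 : ℝ) ^ j :=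
  Finset.sum_pos (fun _ _ => by positivity) ⟨0, Finset.mem_range.2 (by positivity)⟩

theorem sum_pow_half_le (n : ℕ) : ∑ j ∈ Finset.range n, (1 / 2 : ℝ) ^ j ≤ 2 := by
  have := Summable.sum_le_tsum (Finset.range n) (fun j _ => by positivity) summable_geometric_two
  rwa [tsum_geometric_two] at this

/-- The normalized truncated geometric series is a product of linear combinations of two terms. -/
theorem BE.normalized_geometric {X : Op S} {δ a N : ℝ} (h : BE X δ a N) (r : ℕ) :
    BE ((((∑ j ∈ Finset.range (2 ^ r), (1 / 2 : ℝ) ^ j)⁻¹ : ℝ) : ℂ) •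
      ∑ j ∈ Finset.range (2 ^ r), ((1 / 2 : ℂ) • X) ^ j)
      ((2 ^ r - 1) * δ) ((2 ^ r - 1) * a + r) (7 * (2 ^ r - 1) * N + 2 * r) := by
  induction r with
  | zero => simpa using BE.one
  | succ r ih =>
    set g : ℝ := ∑ j ∈ Finset.range (2 ^ r), (1 / 2 : ℝ) ^ j with hg
    have hg0 : 0 < g := sum_pow_half_pos r
    set q : ℝ := (1 / 2 : ℝ) ^ 2 ^ r with hq
    have hq0 : 0 < q := by positivity
    -- The weights `1 - p` and `p` must be in the ratio `1 : q`, so that the new factor is `(1 +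
    -- (X/2)^{2^r}) / (1 + q)`.
    have h1 := (h.pow (2 ^ r)).lcu (p := q / (1 + q)) (by positivity)
      ((div_le_one (by positivity)).2 (by linarith))
    have h2 := ih.mul h1
    have e : (((g⁻¹ : ℝ) : ℂ) • ∑ j ∈ Finset.range (2 ^ r), ((1 / 2 : ℂ) • X) ^ j) *
        (((1 - q / (1 + q) : ℝ) : ℂ) • 1 + ((q / (1 + q) : ℝ) : ℂ) • X ^ 2 ^ r) =
        (((∑ j ∈ Finset.range (2 ^ (r + 1)), (1 / 2 : ℝ) ^ j)⁻¹ : ℝ) : ℂ) •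
          ∑ j ∈ Finset.range (2 ^ (r + 1)), ((1 / 2 : ℂ) • X) ^ j := by
      rw [sum_range_two_pow_succ, sum_range_two_pow_succ, ← hg, ← hq]
      have e1 : (((1 - q / (1 + q) : ℝ) : ℂ) • 1 + ((q / (1 + q) : ℝ) : ℂ) • X ^ 2 ^ r) =
          (((1 + q)⁻¹ : ℝ) : ℂ) • (1 + ((1 / 2 : ℂ) • X) ^ 2 ^ r) := by
        rw [show 1 - q / (1 + q) = (1 + q)⁻¹ by field_simp; ring, smul_pow, smul_add, smul_smul]
        congr 2
        rw [hq]; push_cast; rw [div_eq_inv_mul]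
      rw [e1, Matrix.smul_mul, Matrix.mul_smul, smul_smul, mul_inv]
      push_cast; rfl
    rw [e] at h2
    refine h2.mono (le_of_eq ?_) (le_of_eq ?_) (le_of_eq ?_) <;> push_cast <;> ring

/-- The normalization of the previous lemma depends on `r`. Since the total weight `g` is at most
`2`, multiplying by the scalar `g / 2` replaces it by the fixed factor `1/2`. -/
theorem BE.geometric {X : Op S} {δ a N : ℝ} (h : BE X δ a N) (hδ : 0 ≤ δ) (ha : 0 ≤ a)
    (hN : 0 ≤ N) (r : ℕ) :
    BE ((1 / 2 : ℂ) • ∑ j ∈ Finset.range (2 ^ r), ((1 / 2 : ℂ) • X) ^ j)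
      (2 ^ r * δ) (2 ^ r * (a + 1)) (2 ^ r * (7 * N + 2)) := by
  set g : ℝ := ∑ j ∈ Finset.range (2 ^ r), (1 / 2 : ℝ) ^ j with hg
  have hg0 : 0 < g := sum_pow_half_pos r
  have hg2 : g ≤ 2 := sum_pow_half_le _
  have hz : ‖((g / 2 : ℝ) : ℂ)‖ ≤ 1 := by
    rw [Complex.norm_real, Real.norm_of_nonneg (by positivity)]; linarith
  have h1 := (BE.scalar hz).mul (h.normalized_geometric r)
  have e : ((g / 2 : ℝ) : ℂ) • (1 : Op S) *
      ((g⁻¹ : ℝ) : ℂ) • ∑ j ∈ Finset.range (2 ^ r), ((1 / 2 : ℂ) • X) ^ j =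
      (1 / 2 : ℂ) • ∑ j ∈ Finset.range (2 ^ r), ((1 / 2 : ℂ) • X) ^ j := by
    rw [Matrix.smul_mul, Matrix.one_mul, smul_smul, ← Complex.ofReal_mul]
    congr 1
    rw [show g / 2 * g⁻¹ = 1 / 2 by field_simp]
    push_cast; rfl
  rw [← hg, e] at h1
  have hr : (r : ℝ) + 1 ≤ 2 ^ r := by exact_mod_cast r.lt_two_pow_self
  exact h1.mono (by nlinarith) (by nlinarith) (by nlinarith)

end Geometric

/-! ### The Dyson series as a block encoding -/

section Segment

variable {S : Type} [Fintype S] [DecidableEq S]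

/-- One application of `X/2` to the column of Dyson sums multiplies by `G` at each time and sums
over all earlier times, which is the recursion of `dyson`. The entries `2⁻ᴸ` of `shiftOp` and the
`1/2` cancel the prefactor `2 · 2^L`. -/
theorem pow_mul_opColumn_eq {L : ℕ} (G : ℕ → Op S) (u : ℂ) (j : ℕ) :
    (((1 / 2 : ℂ) • (emb (Sum.inl : Fin L → Fin L ⊕ S) (shiftOp L) *
      clockOp fun a => (2 * 2 ^ L : ℂ) • G (clockVal a))) ^ j : Op (Fin L ⊕ S)) *
      opColumn (fun _ : Fin L → Bool => u • (1 : Op S)) = opColumn fun a => u • dyson G j (clockVal a) := by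
  induction j with
  | zero => rw [pow_zero, Matrix.one_mul]; rfl
  | succ j ih =>
    rw [pow_succ', Matrix.mul_assoc, ih, Matrix.smul_mul, Matrix.mul_assoc, clockOp_mul_opColumn,
      emb_inl_eq_opMatrix, opMatrix_mul_opColumn]
    have key : ∀ a : Fin L → Bool, (1 / 2 : ℂ) • ∑ b, (shiftOp L a b • (1 : Op S)) *
        ((2 * 2 ^ L : ℂ) • G (clockVal b) * u • dyson G j (clockVal b)) =
        u • dyson G (j + 1) (clockVal a) := by
      intro a
      have : ∀ b : Fin L → Bool, (shiftOp L a b • (1 : Op S)) *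
          ((2 * 2 ^ L : ℂ) • G (clockVal b) * u • dyson G j (clockVal b)) =
          (fun m => if m < clockVal a then (2 * u) • (G m * dyson G j m) else 0) (clockVal b) := by
        intro b
        simp only [shiftOp]
        split_ifs with h
        · rw [Matrix.smul_mul, Matrix.one_mul, Matrix.smul_mul, Matrix.mul_smul, smul_smul,
            smul_smul]
          congr 1
          field_simp
        · rw [zero_smul, Matrix.zero_mul]
      rw [Finset.sum_congr rfl fun b _ => this b, sum_clockVal L
        (fun m => if m < clockVal a then (2 * u) • (G m * dyson G j m) else 0),
        ← Finset.sum_filter]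
      have hf : (Finset.range (2 ^ L)).filter (fun m => m < clockVal a) =
          Finset.range (clockVal a) := by
        ext m
        simp only [Finset.mem_filter, Finset.mem_range]
        exact ⟨fun h => h.2, fun h => ⟨h.trans (clockVal_lt a), h⟩⟩
      rw [hf, ← Finset.smul_sum, smul_smul, dyson]
      congr 1
      ring
    have e : ∀ v : (Fin L → Bool) → Op S,
        (1 / 2 : ℂ) • opColumn v = opColumn fun a => (1 / 2 : ℂ) • v a := fun v => rfl
    rw [e]
    congr 1
    funext a
    exact key a

/-- The Dyson series as an expectation in the uniform state of the clock. -/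
theorem compress_geometric_eq {L : ℕ} (G : ℕ → Op S) (K : ℕ) {W : Op (Fin L)}
    (hW : ∀ x, W x (fun _ => false) = ((((Real.sqrt 2)⁻¹ ^ L : ℝ)) : ℂ)) {Y X : Op (Fin L ⊕ S)}
    (hY : Y = clockOp fun a => (2 * 2 ^ L : ℂ) • G (clockVal a))
    (hX : X = emb (Sum.inl : Fin L → Fin L ⊕ S) (shiftOp L) * Y) :
    QSim.compress (Sum.inr : S → Fin L ⊕ S) ((emb (Sum.inl : Fin L → Fin L ⊕ S) W)ᴴ *
      (Y * ((1 / 2 : ℂ) • ∑ j ∈ Finset.range K, ((1 / 2 : ℂ) • X) ^ j) *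
        emb (Sum.inl : Fin L → Fin L ⊕ S) W)) =
      ∑ k ∈ Finset.range K, dyson G (k + 1) (2 ^ L) := by
  set u : ℂ := ((((Real.sqrt 2)⁻¹ ^ L : ℝ)) : ℂ) with hu
  have hc : emb (Sum.inl : Fin L → Fin L ⊕ S) W * ket (Sum.inr : S → Fin L ⊕ S) =
      opColumn fun _ : Fin L → Bool => u • (1 : Op S) := by
    rw [emb_inl_mul_ket_inr]
    congr 1; funext a; rw [hW]
  have h1 : (∑ j ∈ Finset.range K, ((1 / 2 : ℂ) • X) ^ j : Op (Fin L ⊕ S)) *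
      opColumn (fun _ : Fin L → Bool => u • (1 : Op S)) =
      opColumn fun a => ∑ j ∈ Finset.range K, u • dyson G j (clockVal a) := by
    rw [Matrix.sum_mul, hX, hY, Finset.sum_congr rfl fun j _ => pow_mul_opColumn_eq G u j]
    ext x y
    simp only [opColumn, Matrix.sum_apply]
  have h2 : QSim.compress (Sum.inr : S → Fin L ⊕ S) ((emb (Sum.inl : Fin L → Fin L ⊕ S) W)ᴴ *
      (Y * ((1 / 2 : ℂ) • ∑ j ∈ Finset.range K, ((1 / 2 : ℂ) • X) ^ j) *
        emb (Sum.inl : Fin L → Fin L ⊕ S) W)) =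
      (emb (Sum.inl : Fin L → Fin L ⊕ S) W * ket (Sum.inr : S → Fin L ⊕ S))ᴴ *
      (Y * ((1 / 2 : ℂ) • ((∑ j ∈ Finset.range K, ((1 / 2 : ℂ) • X) ^ j : Op (Fin L ⊕ S)) *
        (emb (Sum.inl : Fin L → Fin L ⊕ S) W * ket (Sum.inr : S → Fin L ⊕ S))))) := by
    rw [QSim.compress, conjTranspose_mul]
    simp only [Matrix.mul_assoc, Matrix.smul_mul]
  have e : ∀ v : (Fin L → Bool) → Op S,
      (1 / 2 : ℂ) • opColumn v = opColumn fun a => (1 / 2 : ℂ) • v a := fun v => rfl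
  rw [h2, hc, h1, e, hY, clockOp_mul_opColumn, conjTranspose_opColumn_mul]
  have huu : star u * u = ((2 : ℂ) ^ L)⁻¹ := by
    rw [hu, ← uniform_mul_self]
    congr 1
    exact Complex.conj_ofReal _
  have h3 : ∀ a : Fin L → Bool, (u • (1 : Op S))ᴴ * ((2 * 2 ^ L : ℂ) • G (clockVal a) *
      (1 / 2 : ℂ) • ∑ j ∈ Finset.range K, u • dyson G j (clockVal a)) =
      (fun m => ∑ j ∈ Finset.range K, G m * dyson G j m) (clockVal a) := by
    intro a
    rw [conjTranspose_smul, conjTranspose_one, ← Finset.smul_sum, Matrix.smul_mul, Matrix.one_mul,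
      Matrix.smul_mul, Matrix.mul_smul, Matrix.mul_smul, smul_smul, smul_smul, smul_smul,
      Matrix.mul_sum]
    have : star u * (2 * 2 ^ L) * (1 / 2) * u = 1 := by
      calc _ = star u * u * 2 ^ L := by ring
        _ = 1 := by rw [huu]; field_simp
    rw [this, one_smul]
  rw [Finset.sum_congr rfl fun a _ => h3 a,
    sum_clockVal L (fun m => ∑ j ∈ Finset.range K, G m * dyson G j m), Finset.sum_comm]
  rfl

/-- The leading factor `Y` in the expectation supplies the latest time, so the geometric series with
`2^r` terms yields the orders `1` to `2^r`. -/
theorem BE.dyson {L : ℕ} {G : ℕ → Op S} {δ a N : ℝ} (hδ : 0 ≤ δ) (ha : 0 ≤ a) (hN : 0 ≤ N)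
    (h : BE (clockOp fun c : Fin L → Bool => (2 * 2 ^ L : ℂ) • G (clockVal c)) δ a N) (r : ℕ) :
    BE ((1 / 2 : ℂ) • ∑ k ∈ Finset.range (2 ^ r + 1), QSim.dyson G k (2 ^ L))
      (2 * 2 ^ r * δ) (2 ^ r * (2 * L + 3 + 2 * a)) (2 ^ r * (2415 * L + 114 + 56 * N)) := by
  obtain ⟨W, hWu, hWi, hW⟩ := exists_uniform (Fin L)
  rw [Fintype.card_fin] at hWi
  simp only [Fintype.card_fin] at hW
  obtain ⟨Y, hY⟩ : ∃ Y, Y = clockOp fun c : Fin L → Bool => (2 * 2 ^ L : ℂ) • G (clockVal c) :=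
    ⟨_, rfl⟩
  obtain ⟨X, hX⟩ : ∃ X, X = QSim.emb (Sum.inl : Fin L → Fin L ⊕ S) (QSim.shiftOp L) * Y :=
    ⟨_, rfl⟩
  have hi : Injective (Sum.inl : Fin L → Fin L ⊕ S) := Sum.inl_injective
  have hj : Injective (Sum.inr : S → Fin L ⊕ S) := Sum.inr_injective
  rw [← hY] at h
  have hXb : BE X (0 + δ) (L + 1 + a) (49 * L + 2 + N) := by
    rw [hX]; exact ((BE.shiftOp L).emb hi).mul h
  have hWe := emb_mem_unitary hi hWu
  have b1 := hWi.emb hi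
  have b2 := BE.impl hWe b1
  have b3 := BE.impl (Unitary.star_mem hWe) (b1.star hWe)
  have b4 := (h.mul (hXb.geometric (by positivity) (by positivity) (by positivity) r))
  have b5 := (b3.mul (b4.mul b2)).compress hj
  have e := compress_geometric_eq G (2 ^ r) hW hY hX
  rw [star_eq_conjTranspose, e] at b5
  -- The order zero term is added with equal weight; this produces the factor `1/2` that
  -- amplification removes.
  have b6 := b5.lcu (p := 1 / 2) (by norm_num) (by norm_num)
  have e2 : (((1 - 1 / 2 : ℝ) : ℂ) • (1 : Op S) + (((1 / 2 : ℝ)) : ℂ) •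
      ∑ k ∈ Finset.range (2 ^ r), QSim.dyson G (k + 1) (2 ^ L)) =
      (1 / 2 : ℂ) • ∑ k ∈ Finset.range (2 ^ r + 1), QSim.dyson G k (2 ^ L) := by
    rw [Finset.sum_range_succ', smul_add, add_comm, QSim.dyson]
    norm_num
  rw [e2] at b6
  have hr : (1 : ℝ) ≤ 2 ^ r := one_le_pow₀ (by norm_num)
  have hL : (0 : ℝ) ≤ L := by positivity
  have m1 := mul_nonneg (sub_nonneg.2 hr) hδ
  have m2 := mul_nonneg (sub_nonneg.2 hr) ha
  have m3 := mul_nonneg (sub_nonneg.2 hr) hN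
  have m4 := mul_nonneg (sub_nonneg.2 hr) hL
  refine b6.mono ?_ ?_ ?_
  · linarith
  · rw [Fintype.card_sum, Fintype.card_fin]; push_cast; linarith
  · linarith

end Segment

/-! ### Simulation of one segment -/

section EvolutionSegment

variable {n : ℕ}

theorem sum_div_two_pow_le {δ : ℝ} (hδ : 0 ≤ δ) (L : ℕ) :
    ∑ j : Fin L, δ / 2 ^ (L - (j : ℕ)) ≤ δ := by
  rw [Fin.sum_univ_eq_sum_range (fun j => δ / 2 ^ (L - j))]
  have : ∑ j ∈ Finset.range L, δ / 2 ^ (L - j) = δ - δ / 2 ^ L := by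
    induction L with
    | zero => simp
    | succ L ih =>
      rw [Finset.sum_range_succ]
      have : ∀ j ∈ Finset.range L, δ / 2 ^ (L + 1 - j) = δ / 2 ^ (L - j) / 2 := fun j hj => by
        rw [Nat.sub_add_comm (Finset.mem_range.1 hj).le, pow_succ]; field_simp
      rw [Finset.sum_congr rfl this, ← Finset.sum_div, ih, Nat.add_sub_cancel_left, pow_succ]
      field_simp
      ring
  rw [this]
  have : 0 ≤ δ / 2 ^ L := by positivity
  linarith

/-- Bit `j` of the clock stands for the duration `τ / 2^{L-j}`. Precision proportional to the
duration keeps the sum of the errors below `δ`. -/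
theorem Impl.clockOp_evolution {A : Op (Fin n)} (hA : A.IsHermitian) {τ δ N : ℝ} (hδ : 0 ≤ δ)
    (h : ∀ j : ℕ, Impl (evolution A (τ / 2 ^ j)) (δ / 2 ^ j) N) (L : ℕ) :
    Impl (QSim.clockOp fun c : Fin L → Bool => evolution A (clockVal c * (τ / (2 ^ L : ℕ)))) δ
      (7 * (L * N)) := by
  have h1 := Impl.clockOp_exp (E := evolution A) (evolution_add A) (evolution_zero A)
    (evolution_mem_unitary hA) (C := Fin L) (fun j => h (L - (j : ℕ))) Finset.univ
  have e : (fun c : Fin L → Bool => evolution A (clockVal c * (τ / (2 ^ L : ℕ)))) =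
      fun c => evolution A (∑ j, if c j then τ / 2 ^ (L - (j : ℕ)) else 0) := by
    funext c
    congr 1
    rw [clockVal]
    push_cast
    rw [Finset.sum_mul]
    refine Finset.sum_congr rfl fun j _ => ?_
    split_ifs
    · rw [← pow_sub_mul_pow (2 : ℝ) j.2.le]; field_simp
    · rw [zero_mul]
  rw [e]
  refine h1.mono (sum_div_two_pow_le hδ L) (le_of_eq ?_)
  simp

/-- Conjugating `B` by the clock-controlled evolution rotates it at all times at once. The remaining
scalar is `-2i b τ`, whose modulus is at most one because `b τ ≤ 1/2`. -/
theorem BE.clockOp_interaction {A B : Op (Fin n)} (hA : A.IsHermitian) {b τ δ N a C : ℝ}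
    (hb : 0 < b) (hτ : 0 ≤ τ) (hτb : b * τ ≤ 1 / 2) (hB : BE (((1 / b : ℝ) : ℂ) • B) 0 a C)
    (hδ : 0 ≤ δ) (h : ∀ j : ℕ, Impl (evolution A (τ / 2 ^ j)) (δ / 2 ^ j) N) (L : ℕ) :
    BE (clockOp fun c : Fin L → Bool =>
      (2 * 2 ^ L : ℂ) • interaction A B (τ / (2 ^ L : ℕ)) (clockVal c))
      (2 * δ) (a + 1) (C + 1 + 14 * (L * N)) := by
  have hj : Injective (Sum.inr : Fin n → Fin L ⊕ Fin n) := Sum.inr_injective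
  have i1 := Impl.clockOp_evolution hA hδ h L
  have u1 : (clockOp fun c : Fin L → Bool => evolution A (clockVal c * (τ / (2 ^ L : ℕ)))) ∈
      unitary (Op (Fin L ⊕ Fin n)) := clockOp_mem_unitary fun c => evolution_mem_unitary hA _
  have hz : ‖(-(Complex.I * ((2 * (b * τ) : ℝ) : ℂ)))‖ ≤ 1 := by
    rw [norm_neg, norm_mul, Complex.norm_I, one_mul, Complex.norm_real,
      Real.norm_of_nonneg (by positivity)]
    linarith
  have b1 := ((BE.scalar hz).mul hB).emb hj
  have b2 := (BE.impl (Unitary.star_mem u1) (i1.star u1)).mul (b1.mul (BE.impl u1 i1))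
  rw [star_eq_conjTranspose, clockOp_conjTranspose, emb_inr_eq_clockOp, clockOp_mul,
    clockOp_mul] at b2
  have e : (fun c : Fin L → Bool =>
      (2 * 2 ^ L : ℂ) • interaction A B (τ / (2 ^ L : ℕ)) (clockVal c)) = fun c =>
      (evolution A (clockVal c * (τ / (2 ^ L : ℕ))))ᴴ *
        ((-(Complex.I * ((2 * (b * τ) : ℝ) : ℂ))) • (1 : Op (Fin n)) * ((1 / b : ℝ) : ℂ) • B *
          evolution A (clockVal c * (τ / (2 ^ L : ℕ)))) := by
    funext c
    rw [interaction, Matrix.smul_mul, Matrix.one_mul, smul_smul, smul_smul, Matrix.smul_mul,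
      Matrix.mul_smul, Matrix.mul_assoc]
    congr 1
    have : (b : ℂ) ≠ 0 := by exact_mod_cast hb.ne'
    push_cast
    field_simp
  rw [e]
  exact b2.mono (by linarith) (by linarith) (by linarith)

/-- One short step of Hamiltonian simulation in the interaction picture. -/
theorem Impl.evolution_segment {A B : Op (Fin n)} (hA : A.IsHermitian) (hB : B.IsHermitian)
    {a b τ δ η N na C : ℝ} (ha : ‖A‖ ≤ a) (hb : ‖B‖ ≤ b) (hb0 : 0 < b) (hτ : 0 ≤ τ)
    (hτb : b * τ ≤ 1 / 2) (hBE : BE (((1 / b : ℝ) : ℂ) • B) 0 na C) (hna0 : 0 ≤ na) (hna : na ≤ C)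
    (hC : 1 ≤ C) (hδ : 0 ≤ δ)
    (h : ∀ j : ℕ, Impl (evolution A (τ / 2 ^ j)) (δ / 2 ^ j) N) (hN : 1 ≤ N) {L r : ℕ}
    (hL : 1 ≤ L) (hLτ : τ * (a + b) ≤ 2 ^ L)
    (hη : 2 * (b * τ) / (2 ^ r).factorial + 8 * (τ * (a + b)) ^ 2 / 2 ^ L ≤ η) (hη1 : η ≤ 1) :
    Impl (evolution (A + B) τ) (15 * (2 ^ r * δ) + 4 * η) (10000 * (2 ^ r * (C + L * N))) := by
  have b1 := BE.clockOp_interaction hA hb0 hτ hτb hBE hδ h L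
  have b2 := BE.dyson (by positivity) (by positivity) (by positivity) b1 r
  have i0 : Impl (evolution A τ) δ N := by simpa using h 0
  have b3 := (BE.impl (evolution_mem_unitary hA τ) i0).mul b2
  have key := norm_evolution_mul_dyson_sub_le hA hB ha hb hτ hτb (K := 2 ^ r) (M := 2 ^ L)
    (by positivity) (by push_cast; exact hLτ)
  push_cast at key
  have b4 := b3.amplify (evolution_mem_unitary (hA.add hB) τ) (η := η) (by
    rw [Matrix.mul_smul, smul_smul, show (2 : ℂ) * (1 / 2) = 1 by norm_num, one_smul]
    push_cast
    exact key.trans hη) hη1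
  have hr : (1 : ℝ) ≤ 2 ^ r := one_le_pow₀ (by norm_num)
  have hL1 : (1 : ℝ) ≤ L := by exact_mod_cast hL
  have hLN : (L : ℝ) ≤ L * N := by nlinarith
  have hNL : N ≤ L * N := by nlinarith
  -- The error is three times that of the amplified operator, `3 (δ + 4 · 2^r δ) ≤ 15 · 2^r δ`, plus
  -- `4η` from the amplification.
  refine b4.mono ?_ ?_
  · nlinarith [mul_nonneg (sub_nonneg.2 hr) hδ]
  · have m : 3 * (2415 * L + 114 + 56 * (C + 1 + 14 * (L * N))) + 3 * N +
        184 * (2 * L + 3 + 2 * (na + 1)) + 11 ≤ 10000 * (C + L * N) := by linarith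
    have := mul_le_mul_of_nonneg_left m (by linarith : (0 : ℝ) ≤ 2 ^ r)
    nlinarith

end EvolutionSegment

end QSim

end


open scoped Matrix.Norms.L2Operator

noncomputable section

namespace QSim

set_option linter.unusedSectionVars false

open Matrix Function

/-! ### Shifted logarithms, truncation order and clock size -/

section Logarithms

theorem lg_mono {x y : ℝ} (hx : 0 ≤ x) (h : x ≤ y) : lg x ≤ lg y :=
  Real.log_le_log (by positivity) (by linarith)

theorem one_le_lg {x : ℝ} (hx : 0 ≤ x) : 1 ≤ lg x := by
  rw [lg, Real.le_log_iff_exp_le (by positivity)]; linarith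

theorem lg_mul_le {x y : ℝ} (hx : 0 ≤ x) (hy : 0 ≤ y) : lg (x * y) ≤ lg x + lg y := by
  have he : 1 ≤ Real.exp 1 := Real.one_le_exp (by norm_num)
  rw [lg, lg, lg, ← Real.log_mul (by positivity) (by positivity)]
  refine Real.log_le_log (by positivity) ?_
  nlinarith [mul_nonneg (Real.exp_pos 1).le hx, mul_nonneg (Real.exp_pos 1).le hy]

theorem lg_lg_le {x : ℝ} (hx : 0 ≤ x) : lg (lg x) ≤ 2 * lg x := by
  have he : 1 ≤ Real.exp 1 := Real.one_le_exp (by norm_num)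
  have he2 : 2 ≤ Real.exp 1 := by linarith [Real.add_one_le_exp 1]
  have h1 : lg x ≤ Real.exp 1 + x := (Real.log_le_sub_one_of_pos (by positivity)).trans (by linarith)
  have h2 : lg (lg x) ≤ Real.log ((Real.exp 1 + x) * (Real.exp 1 + x)) := by
    have := one_le_lg hx
    refine Real.log_le_log (by positivity) ?_
    nlinarith
  rw [Real.log_mul (by positivity) (by positivity)] at h2
  exact h2.trans_eq (two_mul _).symm

theorem exp_one_le_log {y : ℝ} (hy : 0 ≤ y) :
    Real.exp 1 ≤ Real.log (Real.exp (Real.exp 1) + y) := by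
  rw [Real.le_log_iff_exp_le (by positivity)]; linarith

theorem one_le_log_log {y : ℝ} (hy : 0 ≤ y) :
    1 ≤ Real.log (Real.log (Real.exp (Real.exp 1) + y)) := by
  have h := exp_one_le_log hy
  rwa [Real.le_log_iff_exp_le ((Real.exp_pos 1).trans_le h)]

theorem one_le_lgRatio {y : ℝ} (hy : 0 ≤ y) : 1 ≤ lgRatio y := by
  have h := exp_one_le_log hy
  rw [lgRatio, one_le_div (by linarith [one_le_log_log hy])]
  exact (Real.log_le_sub_one_of_pos ((Real.exp_pos 1).trans_le h)).trans (by linarith)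

theorem lgRatio_le {y : ℝ} (hy : 0 ≤ y) : lgRatio y ≤ 3 * lg y := by
  have he2 : Real.exp 1 ≤ 3 := by linarith [Real.exp_one_lt_d9]
  have h0 := exp_one_le_log hy
  have h1 : lgRatio y ≤ Real.log (Real.exp (Real.exp 1) + y) :=
    div_le_self ((Real.exp_pos 1).le.trans h0) (one_le_log_log hy)
  have h2 : Real.log (Real.exp (Real.exp 1) + y) ≤
      Real.log (Real.exp (Real.exp 1 - 1) * (Real.exp 1 + y)) := by
    refine Real.log_le_log (by positivity) ?_
    rw [mul_add, ← Real.exp_add, sub_add_cancel]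
    have : 1 ≤ Real.exp (Real.exp 1 - 1) :=
      Real.one_le_exp (by linarith [Real.add_one_le_exp 1])
    nlinarith
  rw [Real.log_mul (by positivity) (by positivity), Real.log_exp] at h2
  have h3 := one_le_lg hy
  rw [lg] at *
  linarith

/-- `K ≥ 5 log y / log log y` implies `K! ≥ 32 y`. -/
theorem le_factorial {y : ℝ} (hy : 0 ≤ y) {K : ℕ} (hK : 5 * lgRatio y ≤ K) :
    32 * y ≤ K.factorial := by
  set l := Real.log (Real.exp (Real.exp 1) + y) with hl
  have hle : Real.exp 1 ≤ l := exp_one_le_log hy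
  have he : 2.7 ≤ Real.exp 1 := by linarith [Real.exp_one_gt_d9]
  have hl0 : 0 < l := by linarith
  have hll : 1 ≤ Real.log l := one_le_log_log hy
  have hR : lgRatio y = l / Real.log l := rfl
  have hR1 := one_le_lgRatio hy
  have hK0 : (0 : ℝ) < K := by linarith
  have hlogR : Real.log (lgRatio y) = Real.log l - Real.log (Real.log l) := by
    rw [hR, Real.log_div hl0.ne' (by linarith)]
  -- This is `log z ≤ z - 1` at `z = log l / e`; the resulting slope `1/e` is below `2/5`.
  have hlog3 : Real.log (Real.log l) ≤ Real.log l / Real.exp 1 := by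
    have := Real.log_le_sub_one_of_pos (show 0 < Real.log l / Real.exp 1 by positivity)
    rw [Real.log_div (by linarith) (Real.exp_pos 1).ne', Real.log_exp] at this
    linarith
  have hlog3' : Real.log (Real.log l) ≤ Real.log l * (2 / 5) := by
    refine hlog3.trans ?_
    rw [div_le_iff₀ (Real.exp_pos 1)]
    nlinarith
  have hlog5 : 1 ≤ Real.log 5 := by
    rw [Real.le_log_iff_exp_le (by norm_num)]
    linarith [Real.exp_one_lt_d9]
  have hlogK : Real.log 5 + Real.log (lgRatio y) ≤ Real.log K := by
    rw [← Real.log_mul (by norm_num) (by linarith)]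
    exact Real.log_le_log (by positivity) hK
  -- Since `log K - 1 ≥ log l - log log l ≥ (3/5) log l` and `K ≥ 5 l / log l`, the product is at
  -- least `3l`. Combined with `K! ≥ (K/e)^K` this gives `K! ≥ e^{3l}`.
  have h1 : 3 * l ≤ K * (Real.log K - 1) := by
    have a1 : Real.log l * (3 / 5) ≤ Real.log K - 1 := by linarith
    have a2 : 5 * lgRatio y * (Real.log l * (3 / 5)) ≤ K * (Real.log K - 1) :=
      mul_le_mul hK a1 (by positivity) hK0.le
    have a3 : 5 * lgRatio y * (Real.log l * (3 / 5)) = 3 * l := by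
      rw [hR]; field_simp
    linarith
  have h2 : Real.exp (K * (Real.log K - 1)) ≤ K.factorial := by
    rw [mul_sub, mul_one, Real.exp_sub, mul_comm (K : ℝ) (Real.log K), Real.exp_mul,
      Real.exp_log hK0, Real.rpow_natCast]
    have := Real.pow_div_factorial_le_exp (K : ℝ) hK0.le K
    rw [div_le_iff₀ (by positivity)] at this ⊢
    linarith
  have h3 : 32 * y ≤ Real.exp (3 * l) := by
    have a1 : Real.exp l = Real.exp (Real.exp 1) + y := Real.exp_log (by positivity)
    have a2 : (6 : ℝ) ≤ Real.exp l := by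
      have b1 := Real.exp_le_exp.2 hle
      have b2 := Real.exp_le_exp.2 (show (2 : ℝ) ≤ Real.exp 1 by linarith)
      have b3 : Real.exp 2 = Real.exp 1 * Real.exp 1 := by rw [← Real.exp_add]; norm_num
      nlinarith
    have a3 : Real.exp (3 * l) = Real.exp l * Real.exp l * Real.exp l := by
      rw [← Real.exp_add, ← Real.exp_add]; ring_nf
    have a4 : y ≤ Real.exp l := by rw [a1]; linarith [Real.exp_pos (Real.exp 1)]
    rw [a3]
    nlinarith [mul_le_mul a2 a2 (by norm_num) (by positivity)]
  exact h3.trans ((Real.exp_le_exp.2 h1).trans h2)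

theorem exists_two_pow_between {x : ℝ} (hx : 1 ≤ x) : ∃ r : ℕ, x ≤ 2 ^ r ∧ (2 : ℝ) ^ r ≤ 2 * x := by
  obtain ⟨r, h1, h2⟩ := exists_nat_pow_near hx (by norm_num : (1 : ℝ) < 2)
  refine ⟨r + 1, h2.le, ?_⟩
  rw [pow_succ]; linarith

/-- As `2 ≥ e^{1/2}`, `16 lg v` bits give `2^L ≥ (e + v)^8`; six of the factors, each at least
`2.7`, absorb the constant `256`, which the discretization error demands. -/
theorem exists_clock_size {v : ℝ} (hv : 0 ≤ v) :
    ∃ L : ℕ, 1 ≤ L ∧ 256 * (1 + v) ^ 2 ≤ 2 ^ L ∧ (L : ℝ) ≤ 17 * lg v := by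
  have h1 := one_le_lg hv
  have he : 2.7 ≤ Real.exp 1 := by linarith [Real.exp_one_gt_d9]
  refine ⟨⌈16 * lg v⌉₊, Nat.one_le_ceil_iff.2 (by linarith), ?_, ?_⟩
  · have a1 : Real.exp (1 / 2) ≤ 2 := by
      have b1 : Real.exp (1 / 2) * Real.exp (1 / 2) = Real.exp 1 := by
        rw [← Real.exp_add]; norm_num
      nlinarith [Real.exp_pos (1 / 2), Real.exp_one_lt_d9]
    have a2 : Real.exp (1 / 2) ^ ⌈16 * lg v⌉₊ ≤ (2 : ℝ) ^ ⌈16 * lg v⌉₊ :=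
      pow_le_pow_left₀ (Real.exp_pos _).le a1 _
    refine le_trans ?_ a2
    rw [← Real.exp_nat_mul]
    have a3 : Real.exp (8 * lg v) ≤ Real.exp (⌈16 * lg v⌉₊ * (1 / 2)) :=
      Real.exp_le_exp.2 (by linarith [Nat.le_ceil (16 * lg v)])
    refine le_trans ?_ a3
    have a4 : Real.exp (8 * lg v) = (Real.exp 1 + v) ^ 8 := by
      rw [show (8 : ℝ) * lg v = (8 : ℕ) * lg v by norm_num, Real.exp_nat_mul, lg,
        Real.exp_log (by positivity)]
    rw [a4]
    calc 256 * (1 + v) ^ 2 ≤ 2.7 ^ 6 * (1 + v) ^ 2 := by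
          gcongr; norm_num
      _ ≤ (Real.exp 1 + v) ^ 6 * (Real.exp 1 + v) ^ 2 := by
          gcongr <;> linarith
      _ = _ := by ring
  · exact (Nat.ceil_lt_add_one (by linarith)).le.trans (by linarith)

/-- The shifted logarithm is subadditive on products, and a sum of quantities at least one is
bounded by a multiple of their product. -/
theorem lg_le_of_product {u a b c : ℝ} (hc : 0 ≤ c) (hb : 0 ≤ b) (hu : 0 ≤ u) (ha : 0 ≤ a)
    (h : u ≤ c * lg a * a * b) : lg u ≤ (lg c + 4) * (lg a * lg b) := by
  have h1 := one_le_lg ha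
  have h2 := one_le_lg hb
  have h3 := one_le_lg hc
  have h4 := lg_lg_le ha
  have a1 : lg u ≤ lg c + lg (lg a) + lg a + lg b := by
    refine (lg_mono hu h).trans ((lg_mul_le (by positivity) hb).trans ?_)
    have := lg_mul_le (x := c * lg a) (by positivity) ha
    have := lg_mul_le (x := c) hc (show 0 ≤ lg a by linarith)
    linarith
  have a2 : 1 ≤ lg a * lg b := one_le_mul_of_one_le_of_one_le h1 h2
  have a3 : lg a ≤ lg a * lg b := by nlinarith
  have a4 : lg b ≤ lg a * lg b := by nlinarith
  nlinarith

end Logarithms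

/-! ### Dependence of the cost on duration and precision -/

section Cost

theorem evolutionCost_le {c₀ c₁ γ s δ s' δ' D g : ℝ} (hγ : 0 ≤ γ) (hc₀ : 1 ≤ c₀) (hc₁ : 0 ≤ c₁)
    (hs : |s| ≤ |s'|) (hδ : 0 ≤ δ) (hδ' : 0 ≤ δ') (hD : 1 ≤ D) (hg : 1 ≤ g)
    (h : lg (|s| / δ) ≤ D * (g * lg (|s'| / δ'))) :
    evolutionCost c₀ c₁ γ s δ ≤ D ^ γ * g ^ γ * evolutionCost c₀ c₁ γ s' δ' := by
  have h1 := one_le_lg (show 0 ≤ |s| / δ by positivity)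
  have h2 := one_le_lg (show 0 ≤ |s'| / δ' by positivity)
  have h3 : lg (|s| / δ) ^ γ ≤ D ^ γ * g ^ γ * lg (|s'| / δ') ^ γ := by
    rw [mul_assoc, ← Real.mul_rpow (by linarith) (by linarith),
      ← Real.mul_rpow (by linarith) (by nlinarith)]
    exact Real.rpow_le_rpow (by linarith) h hγ
  have h4 : 1 ≤ D ^ γ * g ^ γ := one_le_mul_of_one_le_of_one_le (Real.one_le_rpow hD hγ)
    (Real.one_le_rpow hg hγ)
  have h5 : 0 ≤ lg (|s| / δ) ^ γ := Real.rpow_nonneg (by linarith) _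
  have h6 : c₁ * |s| * lg (|s| / δ) ^ γ ≤
      c₁ * |s'| * (D ^ γ * g ^ γ * lg (|s'| / δ') ^ γ) := by gcongr
  rw [evolutionCost, evolutionCost]
  nlinarith

theorem one_le_evolutionCost {c₀ c₁ γ s δ : ℝ} (hc₀ : 1 ≤ c₀) (hc₁ : 0 ≤ c₁) (hδ : 0 ≤ δ) :
    1 ≤ evolutionCost c₀ c₁ γ s δ := by
  have h1 := one_le_lg (show 0 ≤ |s| / δ by positivity)
  have h5 : 0 ≤ lg (|s| / δ) ^ γ := Real.rpow_nonneg (by linarith) _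
  rw [evolutionCost]
  nlinarith [mul_nonneg (mul_nonneg hc₁ (abs_nonneg s)) h5]

end Cost

/-! ### Passage between `ApproximableWith`, `BlockEncodes` and the predicates `Impl`, `BE` -/

section Interface

variable {n : ℕ}

theorem zeroAncilla_eq_ket (a n : ℕ) : zeroAncilla a n = ket (Sum.inr : Fin n → Fin a ⊕ Fin n) := by
  ext z x
  rw [zeroAncilla, ket, fnMatrix, extZero_inr]

theorem Impl.of_approximableWith {U : Op (Fin n)} {δ : ℝ} {N : ℕ} (h : ApproximableWith U δ N) :
    Impl U δ N := by
  obtain ⟨a, c, rfl, hc⟩ := h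
  rw [Approximates, zeroAncilla_eq_ket] at hc
  exact Impl.intro ⟨c, le_rfl, hc⟩

theorem Impl.approximableWith {U : Op (Fin n)} {δ x : ℝ} (h : Impl U δ x) :
    ∃ N : ℕ, ApproximableWith U δ N ∧ (N : ℝ) ≤ x := by
  obtain ⟨T, _, _, c, hc, h⟩ := h
  have he : Injective (Sum.map (Fintype.equivFin T) (id : Fin n → Fin n)) :=
    Sum.map_injective.2 ⟨(Fintype.equivFin T).injective, injective_id⟩
  obtain ⟨d, hd, hd'⟩ := c.exists_emb _ he
  refine ⟨d.length, ⟨_, d, rfl, ?_⟩, by rwa [hd]⟩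
  rw [Approximates, zeroAncilla_eq_ket, hd']
  exact (norm_emb_ket_comp_le Sum.inr_injective he _ U).trans h

theorem BE.of_blockEncodes {a : ℕ} {c : Circuit (Fin a ⊕ Fin n)} {B : Op (Fin n)} {α C : ℝ}
    (h : BlockEncodes c B α) (hC : (c.length : ℝ) ≤ C) : BE (((1 / α : ℝ) : ℂ) • B) 0 a C := by
  rw [BlockEncodes, zeroAncilla_eq_ket] at h
  exact BE.intro (Circuit.toOp c) (by simp) c.toOp_mem_unitary ((Impl.circuit c).mono le_rfl hC) h

theorem approximableWith_of_two_le {U : Op (Fin n)} (hU : U ∈ unitary (Op (Fin n))) {ε : ℝ}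
    (hε : 2 ≤ ε) : ApproximableWith U ε 0 := by
  refine ⟨0, [], rfl, ?_⟩
  have hi : Injective (Sum.inr : Fin n → Fin 0 ⊕ Fin n) := Sum.inr_injective
  rw [Approximates, zeroAncilla_eq_ket, Circuit.toOp, Matrix.one_mul]
  have h1 : ‖ket (Sum.inr : Fin n → Fin 0 ⊕ Fin n) * U‖ ≤ 1 :=
    (norm_ket_mul_le hi U).trans (norm_unitary hU).le
  have h2 := norm_ket hi
  exact (norm_sub_le _ _).trans (by linarith)

theorem Impl.pow {U : Op (Fin n)} {δ N : ℝ} (h : Impl U δ N) (hU : U ∈ unitary (Op (Fin n)))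
    (k : ℕ) : Impl (U ^ k) (k * δ) (k * N) := by
  induction k with
  | zero => simpa using Impl.one (S := Fin n)
  | succ k ih =>
    rw [pow_succ]
    exact (ih.mul h (norm_unitary hU).le).mono (by push_cast; linarith) (by push_cast; linarith)

end Interface

end QSim

end


open scoped Matrix.Norms.L2Operator

noncomputable section

namespace QSim

set_option linter.unusedSectionVars false

open Matrix Function

/-! ### Required precision versus the precision named in the theorem -/

section Logarithms

/-- For the first bound, with `s = t/ε` and `b = αB`. The truncation order satisfies `R ≤ 6 lg b ·
lg (s lg b)`, so `R s` is at most a multiple of `w lg w` with `w = s lg b`. This is where the factor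
`lg αB` in the precision comes from. -/
theorem lg_le_of_le {u s b R : ℝ} (hu : 0 ≤ u) (hs : 0 ≤ s) (hb : 0 ≤ b)
    (hR : R ≤ 3 * lg (b * s)) (h : u ≤ 300 * R * s) :
    lg u ≤ (lg 1800 + 4) * lg (s * lg b) := by
  have hb1 := one_le_lg hb
  have hs1 := one_le_lg hs
  have hc := one_le_lg (show (0 : ℝ) ≤ 1800 by norm_num)
  have hsw : s ≤ s * lg b := le_mul_of_one_le_right hs hb1
  have hw : 0 ≤ s * lg b := hs.trans hsw
  have hw1 := one_le_lg hw
  have h1 := lg_mono hs hsw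
  have h2 : R ≤ 6 * (lg b * lg (s * lg b)) := by
    have := lg_mul_le hb hs
    nlinarith
  have h3 : u ≤ 1800 * (lg (s * lg b) * (s * lg b)) :=
    h.trans ((mul_le_mul_of_nonneg_right (mul_le_mul_of_nonneg_left h2 (by norm_num)) hs).trans_eq
      (by ring))
  have h4 := lg_mul_le (show (0 : ℝ) ≤ 1800 by norm_num)
    (show 0 ≤ lg (s * lg b) * (s * lg b) by positivity)
  have h5 := lg_mul_le (show 0 ≤ lg (s * lg b) by linarith) hw
  have h6 := lg_lg_le hw
  have h7 := lg_mono hu h3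
  nlinarith

/-- For the second bound, `s` is eliminated through `s ≤ 2v · 1/(bε)`, which uses `b s ≤ v` and `ε ≤
2`; the dependence on `v` is left to the power of `lg v`. -/
theorem lg_le_of_le' {u s b R ε v : ℝ} (hu : 0 ≤ u) (hs : 0 ≤ s) (hb : 0 < b) (hε : 0 < ε)
    (hε2 : ε ≤ 2) (hv : b * s ≤ v) (hR : R ≤ 3 * lg (b * s)) (h : u ≤ 300 * R * s) :
    lg u ≤ (lg 1800 + 4) * (lg v * lg (1 / b / ε)) := by
  have hbs : 0 ≤ b * s := by positivity
  have hv0 := hbs.trans hv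
  have hv1 := one_le_lg hv0
  refine lg_le_of_product (by norm_num) (by positivity) hu hv0 (h.trans ?_)
  have h1 := lg_mono hbs hv
  have h2 : s ≤ 2 * v * (1 / b / ε) := by
    rw [div_div, mul_one_div, le_div_iff₀ (by positivity)]
    nlinarith
  calc 300 * R * s ≤ 300 * (3 * lg v) * (2 * v * (1 / b / ε)) := by
        gcongr
        linarith
    _ = _ := by ring

end Logarithms

/-! ### Assembly of the segments -/

section Main

variable {n : ℕ}

/-- The simulation cost in terms of the duration `τ` of a segment and the precision `δ` to which
the evolution under `A` is implemented. -/
theorem Impl.evolution_sum {A B : Op (Fin n)} (hA : A.IsHermitian) (hB : B.IsHermitian)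
    {a b c₀ c₁ γ na C : ℝ} (hγ : 0 ≤ γ) (ha : ‖A‖ ≤ a) (hb : ‖B‖ ≤ b) (hb0 : 0 < b) (hc₀ : 1 ≤ c₀)
    (hc₁ : 0 ≤ c₁) (hBE : BE (((1 / b : ℝ) : ℂ) • B) 0 na C) (hna0 : 0 ≤ na) (hna : na ≤ C)
    (hC : 1 ≤ C) (h : ∀ s δ : ℝ, 0 < δ → Impl (evolution A s) δ (evolutionCost c₀ c₁ γ s δ))
    {t ε : ℝ} (ht : 0 < t) (hε : 0 < ε) (hε2 : ε ≤ 2) : ∃ τ δ : ℝ, 0 ≤ τ ∧ 0 < δ ∧ τ ≤ 1 / b ∧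
      τ / δ ≤ 300 * lgRatio (b * t / ε) * (t / ε) ∧
      Impl (evolution (A + B) t) ε (300000 * (max 1 (b * t) * lgRatio (b * t / ε) *
        (C + 17 * lg (t * (a + b) / ε) * evolutionCost c₀ c₁ γ τ δ))) := by
  have ha0 : 0 ≤ a := (norm_nonneg _).trans ha
  set x := b * t with hx
  have hx0 : 0 < x := by positivity
  set y := x / ε with hy
  have hy0 : 0 < y := by positivity
  set v := t * (a + b) / ε with hv
  have hv0 : 0 ≤ v := by positivity
  set R := lgRatio y with hR
  have hR1 : 1 ≤ R := one_le_lgRatio hy0.le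
  obtain ⟨r, hr1, hr2⟩ := exists_two_pow_between (show 1 ≤ 5 * R by linarith)
  obtain ⟨L, hL1, hL2, hL3⟩ := exists_clock_size hv0
  have hfac : 32 * y ≤ (2 ^ r).factorial := le_factorial hy0.le (by push_cast; exact hr1)
  -- The number of segments; `m ≥ 2bt` makes `b τ ≤ 1/2` in each of them.
  obtain ⟨m, hm⟩ : ∃ m : ℕ, m = ⌈2 * x⌉₊ := ⟨_, rfl⟩
  have hm1 : (1 : ℝ) ≤ m := by
    rw [hm]; exact_mod_cast Nat.one_le_ceil_iff.2 (show 0 < 2 * x by positivity)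
  have hm0 : (0 : ℝ) < m := by linarith
  have hm2 : 2 * x ≤ m := hm ▸ Nat.le_ceil _
  have hm3 : (m : ℝ) ≤ 3 * max 1 x := by
    have h1 := (Nat.ceil_lt_add_one (show 0 ≤ 2 * x by positivity)).le
    rw [← hm] at h1
    linarith [le_max_left 1 x, le_max_right 1 x]
  have hK0 : (0 : ℝ) < 2 ^ r := by positivity
  set τ := t / m with hτ
  have hτ0 : 0 ≤ τ := by positivity
  -- Half of the error budget: `m` segments with error `15 · 2^r δ` contribute `ε/2`. The other half
  -- is `4η` per segment with `η = ε/(8m)`.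
  set δ := ε / (30 * 2 ^ r * m) with hδ
  have hδ0 : 0 < δ := by positivity
  have hbτ : b * τ = x / m := by rw [hτ, hx]; ring
  have hτb : b * τ ≤ 1 / 2 := by
    rw [hbτ, div_le_iff₀ hm0]; linarith
  have hN := one_le_evolutionCost (γ := γ) (s := τ) hc₀ hc₁ hδ0.le
  have hseg : ∀ j : ℕ, Impl (evolution A (τ / 2 ^ j)) (δ / 2 ^ j) (evolutionCost c₀ c₁ γ τ δ) := by
    intro j
    refine (h (τ / 2 ^ j) (δ / 2 ^ j) (by positivity)).mono le_rfl ?_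
    -- Duration and precision shrink together, so the logarithm in the cost is unchanged and one
    -- bound serves all clock bits.
    have e : |τ / 2 ^ j| / (δ / 2 ^ j) = |τ| / δ := by
      rw [abs_div, abs_of_pos (show (0 : ℝ) < 2 ^ j by positivity)]; field_simp
    have e2 : |τ / 2 ^ j| ≤ |τ| := by
      rw [abs_div, abs_of_pos (show (0 : ℝ) < 2 ^ j by positivity)]
      exact div_le_self (abs_nonneg _) (one_le_pow₀ (by norm_num))
    simpa using evolutionCost_le (D := 1) (g := 1) hγ hc₀ hc₁ e2 (δ := δ / 2 ^ j) (δ' := δ)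
      (by positivity) hδ0.le le_rfl le_rfl (by rw [e, one_mul, one_mul])
  have hτv : τ * (a + b) = v * ε / m := by
    rw [hτ, hv]; field_simp
  have hτv1 : τ * (a + b) ≤ 2 * v := by
    rw [hτv, div_le_iff₀ hm0]
    nlinarith
  have hLτ : τ * (a + b) ≤ 2 ^ L := by nlinarith
  -- Truncation and discretization each receive `ε/(16m)`: the former uses `32y ≤ (2^r)!`, the
  -- latter `256 v² ≤ 2^L` together with `ε/m ≤ 2`.
  have hη : 2 * (b * τ) / (2 ^ r).factorial + 8 * (τ * (a + b)) ^ 2 / 2 ^ L ≤ ε / (8 * m) := by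
    have h1 : 2 * (b * τ) / (2 ^ r).factorial ≤ ε / (16 * m) := by
      rw [hbτ, div_le_div_iff₀ (by positivity) (by positivity)]
      have : x = y * ε := by rw [hy]; field_simp
      have h2 : 2 * (x / m) * (16 * m) = 32 * y * ε := by
        rw [this]; field_simp; ring
      rw [h2, mul_comm ε]
      exact mul_le_mul_of_nonneg_right hfac hε.le
    have h2 : 8 * (τ * (a + b)) ^ 2 / 2 ^ L ≤ ε / (16 * m) := by
      rw [hτv, div_le_div_iff₀ (by positivity) (by positivity)]
      have h3 : 8 * (v * ε / m) ^ 2 * (16 * m) = ε * (128 * v ^ 2 * (ε / m)) := by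
        field_simp; ring
      rw [h3]
      have h4 : ε / m ≤ 2 := (div_le_self hε.le hm1).trans hε2
      have h5 : 128 * v ^ 2 * (ε / m) ≤ 128 * v ^ 2 * 2 := by gcongr
      have h6 : 128 * v ^ 2 * 2 ≤ 2 ^ L := by nlinarith
      exact mul_le_mul_of_nonneg_left (h5.trans h6) hε.le
    calc _ ≤ ε / (16 * m) + ε / (16 * m) := add_le_add h1 h2
      _ = ε / (8 * m) := by field_simp; ring
  have hη1 : ε / (8 * m) ≤ 1 := by
    rw [div_le_one (by positivity)]; linarith
  have key := (Impl.evolution_segment hA hB ha hb hb0 hτ0 hτb hBE hna0 hna hC hδ0.le hseg hN hL1 hLτ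
    hη hη1).pow (evolution_mem_unitary (hA.add hB) τ) m
  rw [← evolution_nsmul, show (m : ℝ) * τ = t by rw [hτ]; field_simp] at key
  refine ⟨τ, δ, hτ0, hδ0, ?_, ?_, key.mono (le_of_eq ?_) ?_⟩
  · rw [le_div_iff₀ hb0]; linarith
  · have : τ / δ = 30 * 2 ^ r * (t / ε) := by rw [hτ, hδ]; field_simp
    rw [this]
    exact mul_le_mul_of_nonneg_right (by linarith) (by positivity)
  · rw [hδ]; field_simp; ring
  · have hLN : C + L * evolutionCost c₀ c₁ γ τ δ ≤
        C + 17 * lg v * evolutionCost c₀ c₁ γ τ δ := by gcongr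
    have hlg := one_le_lg hv0
    have h1 : (2 : ℝ) ^ r ≤ 10 * R := by linarith
    calc (m : ℝ) * (10000 * (2 ^ r * (C + L * evolutionCost c₀ c₁ γ τ δ)))
        ≤ (3 * max 1 x) * (10000 * ((10 * R) *
          (C + 17 * lg v * evolutionCost c₀ c₁ γ τ δ))) := by gcongr
      _ = _ := by ring

end Main

end QSim

end

theorem mainTheorem4 (γ : ℝ) (hγ : 0 < γ) :
    ∃ (K : ℝ) (p : ℕ), 0 < K ∧
      ∀ (ns na CB : ℕ) (A B : QSim.Op (Fin ns)) (αA αB c₀ c₁ : ℝ),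
        A.IsHermitian → B.IsHermitian → ‖A‖ ≤ αA → ‖B‖ ≤ αB → 0 < αB →
        1 ≤ c₀ → 0 ≤ c₁ → 1 ≤ CB → na ≤ CB →
        (∃ OB : QSim.Circuit (Fin na ⊕ Fin ns), OB.length ≤ CB ∧ QSim.BlockEncodes OB B αB) →
        (∀ s δ : ℝ, 0 < δ → ∃ N : ℕ, (N : ℝ) ≤ QSim.evolutionCost c₀ c₁ γ s δ ∧
          QSim.ApproximableWith (QSim.evolution A s) δ N) →
        ∀ t ε : ℝ, 0 < t → 0 < ε →
          ∃ N : ℕ, QSim.ApproximableWith (QSim.evolution (A + B) t) ε N ∧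
            (N : ℝ) ≤ K * (max 1 (αB * t) *
              (CB + QSim.evolutionCost c₀ c₁ γ (1 / αB) (ε / (αB * t * QSim.lg αB)) *
                QSim.lg (t * (αA + αB) / ε)) *
              QSim.lgRatio (αB * t / ε)) ∧
            (N : ℝ) ≤ K * (max 1 (αB * t) *
              (CB + QSim.evolutionCost c₀ c₁ γ (1 / αB) ε) *
              QSim.lg (t * (αA + αB) / ε) ^ p) := by
  have hD : 1 ≤ QSim.lg 1800 + 4 := by linarith [QSim.one_le_lg (show (0 : ℝ) ≤ 1800 by norm_num)]
  have hD1 : 1 ≤ (QSim.lg 1800 + 4) ^ γ := Real.one_le_rpow hD hγ.le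
  set D := (QSim.lg 1800 + 4) ^ γ with hDdef
  -- The constant is `300000 · 17 · 3 · D`. In the exponent, `⌈γ⌉₊` pays for the change of
  -- precision, one power for the clock size, and one for bounding `lgRatio` by `3 lg v`; the last
  -- is the source of the factor `3`.
  refine ⟨15300000 * D, ⌈γ⌉₊ + 2, by positivity, ?_⟩
  intro ns na CB A B αA αB c₀ c₁ hA hB hAα hBα hα hc₀ hc₁ hCB hna hOB hexp t ε ht hε
  obtain ⟨OB, hlen, hOB⟩ := hOB
  have hs : 0 < t / ε := by positivity
  have hα0 : 0 ≤ αA := (norm_nonneg _).trans hAα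
  have hCB1 : (1 : ℝ) ≤ CB := by exact_mod_cast hCB
  have hy0 : 0 ≤ αB * t / ε := by positivity
  have hv0 : 0 ≤ t * (αA + αB) / ε := by positivity
  have hys : αB * t / ε = αB * (t / ε) := mul_div_assoc _ _ _
  have hyv' : αB * t / ε ≤ t * (αA + αB) / ε :=
    div_le_div_of_nonneg_right (by nlinarith [mul_nonneg ht.le hα0]) hε.le
  have hyv : αB * (t / ε) ≤ t * (αA + αB) / ε := hys ▸ hyv'
  have hR1 := QSim.one_le_lgRatio hy0
  have hlv := QSim.one_le_lg hv0
  have hlα := QSim.one_le_lg hα.le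
  set v := t * (αA + αB) / ε with hv
  set y := αB * t / ε with hy
  set R := QSim.lgRatio y with hR
  set X := max 1 (αB * t) with hX
  have hX0 : 0 < X := lt_of_lt_of_le one_pos (le_max_left _ _)
  have hQ1 := QSim.one_le_evolutionCost (γ := γ) (s := 1 / αB)
    (δ := ε / (αB * t * QSim.lg αB)) hc₀ hc₁ (by positivity)
  have hQ2 := QSim.one_le_evolutionCost (γ := γ) (s := 1 / αB) (δ := ε) hc₀ hc₁ hε.le
  set Q₁ := QSim.evolutionCost c₀ c₁ γ (1 / αB) (ε / (αB * t * QSim.lg αB)) with hQ₁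
  set Q₂ := QSim.evolutionCost c₀ c₁ γ (1 / αB) ε with hQ₂
  -- Two unitaries are never further than `2` apart, so for `ε ≥ 2` the empty circuit suffices; the
  -- main argument needs `ε ≤ 2`.
  rcases le_or_gt 2 ε with hε2 | hε2
  · refine ⟨0, QSim.approximableWith_of_two_le (QSim.evolution_mem_unitary (hA.add hB) t) hε2, ?_, ?_⟩
    · rw [Nat.cast_zero]; positivity
    · rw [Nat.cast_zero]; positivity
  have hE : ∀ s δ : ℝ, 0 < δ →
      QSim.Impl (QSim.evolution A s) δ (QSim.evolutionCost c₀ c₁ γ s δ) := fun s δ hδ => by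
    obtain ⟨N, hN, hN'⟩ := hexp s δ hδ
    exact (QSim.Impl.of_approximableWith hN').mono le_rfl hN
  obtain ⟨τ, δ, hτ0, hδ0, hτ, hτδ, himpl⟩ := QSim.Impl.evolution_sum hA hB hγ.le hAα hBα hα hc₀ hc₁
    (QSim.BE.of_blockEncodes hOB (by exact_mod_cast hlen)) (Nat.cast_nonneg na)
    (by exact_mod_cast hna) hCB1 hE ht hε hε2.le
  obtain ⟨N, hN, hNle⟩ := himpl.approximableWith
  refine ⟨N, hN, ?_, ?_⟩
  · have hcost : QSim.evolutionCost c₀ c₁ γ τ δ ≤ D * Q₁ := by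
      have h1 := QSim.evolutionCost_le (γ := γ) (c₀ := c₀) (c₁ := c₁) (s := τ) (s' := 1 / αB)
        (δ := δ) (δ' := ε / (αB * t * QSim.lg αB)) (D := QSim.lg 1800 + 4) (g := 1) hγ.le hc₀ hc₁
        (by rw [abs_of_nonneg hτ0, abs_of_pos (by positivity)]; exact hτ) hδ0.le (by positivity)
        hD le_rfl ?_
      · rwa [Real.one_rpow, mul_one] at h1
      · rw [abs_of_nonneg hτ0, abs_of_pos (by positivity), one_mul,
          show 1 / αB / (ε / (αB * t * QSim.lg αB)) = t / ε * QSim.lg αB by field_simp]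
        exact QSim.lg_le_of_le (R := R) (by positivity) hs.le hα.le
          (hys ▸ QSim.lgRatio_le hy0) hτδ
    have h1 : CB + 17 * QSim.lg v * QSim.evolutionCost c₀ c₁ γ τ δ ≤
        17 * D * (CB + Q₁ * QSim.lg v) := by
      have h2 : 17 * QSim.lg v * QSim.evolutionCost c₀ c₁ γ τ δ ≤ 17 * QSim.lg v * (D * Q₁) := by
        gcongr
      nlinarith
    calc (N : ℝ) ≤ 300000 * (X * R * (17 * D * (CB + Q₁ * QSim.lg v))) := by
          refine hNle.trans ?_
          gcongr
      _ = 5100000 * D * (X * (CB + Q₁ * QSim.lg v) * R) := by ring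
      _ ≤ 15300000 * D * (X * (CB + Q₁ * QSim.lg v) * R) := by gcongr; norm_num
  · have hcost : QSim.evolutionCost c₀ c₁ γ τ δ ≤ D * QSim.lg v ^ γ * Q₂ := by
      refine QSim.evolutionCost_le hγ.le hc₀ hc₁
        (by rw [abs_of_nonneg hτ0, abs_of_pos (by positivity)]; exact hτ) hδ0.le hε.le hD hlv ?_
      rw [abs_of_nonneg hτ0, abs_of_pos (by positivity)]
      exact QSim.lg_le_of_le' (R := R) (by positivity) hs.le hα hε hε2.le hyv
        (hys ▸ QSim.lgRatio_le hy0) hτδ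
    have hlγ : 1 ≤ QSim.lg v ^ γ := Real.one_le_rpow hlv hγ.le
    have hlγ' : QSim.lg v ^ γ ≤ QSim.lg v ^ ⌈γ⌉₊ := by
      rw [← Real.rpow_natCast]
      exact Real.rpow_le_rpow_of_exponent_le hlv (Nat.le_ceil γ)
    have h1 : CB + 17 * QSim.lg v * QSim.evolutionCost c₀ c₁ γ τ δ ≤
        17 * D * (QSim.lg v * QSim.lg v ^ ⌈γ⌉₊) * (CB + Q₂) := by
      have h2 : 17 * QSim.lg v * QSim.evolutionCost c₀ c₁ γ τ δ ≤
          17 * QSim.lg v * (D * QSim.lg v ^ ⌈γ⌉₊ * Q₂) := by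
        refine mul_le_mul_of_nonneg_left (hcost.trans ?_) (by positivity)
        gcongr
      have h3 : 1 ≤ D * (QSim.lg v * QSim.lg v ^ ⌈γ⌉₊) :=
        one_le_mul_of_one_le_of_one_le hD1
          (one_le_mul_of_one_le_of_one_le hlv (hlγ.trans hlγ'))
      nlinarith
    have hT := QSim.one_le_evolutionCost (γ := γ) (s := τ) hc₀ hc₁ hδ0.le
    have h0 : 0 ≤ CB + 17 * QSim.lg v * QSim.evolutionCost c₀ c₁ γ τ δ := by
      have : 0 ≤ QSim.lg v * QSim.evolutionCost c₀ c₁ γ τ δ := by nlinarith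
      linarith
    have hRv : R ≤ 3 * QSim.lg v :=
      (QSim.lgRatio_le hy0).trans (by linarith [QSim.lg_mono hy0 hyv'])
    calc (N : ℝ) ≤ 300000 * (X * (3 * QSim.lg v) *
          (17 * D * (QSim.lg v * QSim.lg v ^ ⌈γ⌉₊) * (CB + Q₂))) := by
          refine hNle.trans ?_
          exact mul_le_mul_of_nonneg_left (mul_le_mul (mul_le_mul_of_nonneg_left hRv hX0.le) h1 h0
            (by positivity)) (by norm_num)
      _ = 15300000 * D * (X * (CB + Q₂) * QSim.lg v ^ (⌈γ⌉₊ + 2)) := by ring
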